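/- **Setting.** Write $L^2=L^2(\mathbb R^3,\mathbb R^3)$ with norm $\|\cdot\|$, $A=\sqrt{-\Delta}$, $\langle A\rangle=(1+A^2)^{1/2}$, $H^r=\{f\in L^2:\|f\|_{H^r}=\|\langle A\rangle^r f\|<\infty\}$ for $r\ge 0$. Norms such as $\|A^re^{aA}f\|$ equal $+\infty$ if $f$ is not in the domain of the operator. Let $M$ be a real $3\times3$ matrix and let $P$ be an orthogonal projection on $L^2$ that is fibered in Fourier space, $\widehat{Pf}(\xi)=P(\xi)\hat f(\xi)$ (for example the Leray projection). Let $0<T<\infty$, $I=\,]0,T]$, $\bar I=[0,T]$. For $r\ge 1/2$ let $\mathcal S_{r,I}$ be the class of strong solutions of $\partial_tu=\Delta u-P(Mu\cdot\nabla)u$ on $I$, that is, of all $u\in C(\bar I,H^r)$ such that 1. $u(t)\in PH^r$ for all $t\in\bar I$; 2. $t\mapsto t^{3/8}A^{5/4}u(t)$ is bounded and continuous from $I$ to $L^2$, and $t^{3/8}\|A^{5/4}u(t)\|\to0$ as $t\to0$; 3. $u\in C^1(I,\mathcal S'(\mathbb R^3))$, differentiability being in the weak-$*$ topology, and $\frac{d}{dt}u=-A^2u-P(Mu\cdot\nabla)u$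 for $t\in I$ in the sense of distributions. **Proposition.** Let $\theta:\bar I\to[0,\infty[$ be continuous and such that, for some $\lambda\ge0$, $$\theta(s+t)\le\lambda\sqrt s+\theta(t)\quad\text{for all } s,t,s+t\in\bar I.$$ Suppose that $u\in\mathcal S_{1/2,I}$ obeys $A^{1/2}e^{\theta(\cdot)A}u(\cdot)\in C(\bar I,L^2)$, and let $u_0=u(0)$. Then there exist $\delta_0>0$ and constants $K_1,K_2,K_3>0$ (which may depend on $M,P,\theta,u,T,\delta_0$, but not on $\delta$, $v_0$ or $t$) such that for all $0\le\delta\le\delta_0$ and all $v_0\in PH^{1/2}$ with $\|A^{1/2}e^{\theta(0)A}(v_0-u_0)\|\le\delta$ the following holds. i) There exists $v\in\mathcal S_{1/2,I}$ with $v(0)=v_0$ such that, for all $t\in I$, $$\|A^{1/2}e^{\theta(t)A}(v(t)-u(t))\|\le K_1\delta,\qquad t^{3/8}\|A^{5/4}e^{\theta(t)A}(v(t)-u(t))\|\le K_2\delta.$$ ii) If moreover $\|e^{\theta(0)A}(v_0-u_0)\|_{H^{1/2}}\le\delta$, then this $v$ satisfies in addition, for all $t\in I$, $$\|e^{\theta(t)A}(v(t)-u(t))\|\le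 K_3\delta.$$ -/

import Mathlib

open MeasureTheory Set Filter Topology
open scoped ENNReal SchwartzMap FourierTransform Laplacian LineDeriv

noncomputable section

namespace NavierStokes

/-- Euclidean space `ℝ³`. -/
abbrev R3 : Type := EuclideanSpace ℝ (Fin 3)

/-- Hermitian space `ℂ³`. -/
abbrev C3 : Type := EuclideanSpace ℂ (Fin 3)

/-- The Hilbert space `L²(ℝ³, ℝ³)` of real square integrable vector fields. -/
abbrev VF : Type := Lp R3 2 (volume : Measure R3)

/-- The coordinatewise inclusion `ℝ³ → ℂ³`. -/
def complexifyVec : R3 →L[ℝ] C3 :=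
  LinearMap.toContinuousLinearMap
    { toFun := fun v => WithLp.toLp 2 (fun i => ((v i : ℝ) : ℂ))
      map_add' := fun v w => by ext i; simp
      map_smul' := fun c v => by ext i; simp }

/-- The `L²` Fourier transform `∫ e^{-2πi x·ξ} f(x) dx` of a real vector field. -/
def fourierVF (f : VF) : Lp C3 2 (volume : Measure R3) :=
  𝓕 (complexifyVec.compLp f)

/-- `FunA m f g` says that `f` is in the domain of `m(A)` and `m(A) f = g`, where `A = √(-Δ)`.
With the above normalization of the Fourier transform, `A` is multiplication by `2π|ξ|`. -/
def FunA (m : ℝ → ℝ) (f g : VF) : Prop :=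
  ∀ᵐ ξ : R3, fourierVF g ξ = m (2 * Real.pi * ‖ξ‖) • fourierVF f ξ

/-- The norm `‖m(A) f‖` in `L²`; it is `∞` if `f` is not in the domain of `m(A)`. -/
def normA (m : ℝ → ℝ) (f : VF) : ℝ≥0∞ :=
  eLpNorm (fun ξ : R3 => m (2 * Real.pi * ‖ξ‖) • fourierVF f ξ) 2 volume

/-- `t ↦ m(t, A) u(t)` defines an element of `C(J, L²)`. -/
def ContinuousOnA (m : ℝ → ℝ → ℝ) (u : ℝ → VF) (J : Set ℝ) : Prop :=
  ∃ U : ℝ → VF, ContinuousOn U J ∧ ∀ t ∈ J, FunA (m t) (u t) (U t)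

/-- The symbol of `A^r e^{aA}`. -/
def symHom (r a : ℝ) (ρ : ℝ) : ℝ := ρ ^ r * Real.exp (a * ρ)

/-- The symbol of `⟨A⟩^r e^{aA}`, where `⟨x⟩ = (1 + x²)^{1/2}`. -/
def symInhom (r a : ℝ) (ρ : ℝ) : ℝ := (1 + ρ ^ 2) ^ (r / 2) * Real.exp (a * ρ)

/-- The Sobolev space `H^r` (for `r ≥ 0`) of real vector fields. -/
def sobolev (r : ℝ) : Set VF := {f | normA (symInhom r 0) f < ∞}

/-- `P` is an orthogonal projection on `L²(ℝ³, ℝ³)` which is fibered in Fourier space: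
the Fourier transform of `P f` at `ξ` is `p(ξ)` applied to the Fourier transform of `f` at `ξ`. -/
structure IsFiberedProjection (P : VF →L[ℝ] VF) : Prop where
  isStarProjection : IsStarProjection P
  fibered : ∃ p : R3 → (C3 →L[ℂ] C3), Measurable p ∧
    ∀ f : VF, ∀ᵐ ξ : R3, fourierVF (P f) ξ = p ξ (fourierVF f ξ)

/-- `D` is the distributional partial derivative `∂_j f`. -/
def IsWeakPartial (j : Fin 3) (f D : VF) : Prop :=
  ∀ φ : 𝓢(R3, R3), ∫ x, inner ℝ (D x) (φ x) =
    -∫ x, inner ℝ (f x) ((∂_{(EuclideanSpace.single j (1 : ℝ) : R3)} φ) x)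

/-- The field `N` is `(M f · ∇) f = ∑_j (M f)_j ∂_j f`. -/
def IsConvection (M : Matrix (Fin 3) (Fin 3) ℝ) (f N : VF) : Prop :=
  ∃ D : Fin 3 → VF, (∀ j, IsWeakPartial j f (D j)) ∧
    ∀ᵐ x : R3, N x = ∑ j : Fin 3, (M.mulVec (fun i => f x i)) j • D j x

/-- `u` is in the space `𝓑⁰` on `]0, T]` with exponents `s₁`, `s₂`: the function
`t ↦ t^{s₁} A^{s₂} u(t)` is bounded and continuous from `]0, T]` to `L²`, and it tends to `0`
as `t → 0`. -/
def MemB0 (s₁ s₂ T : ℝ) (u : ℝ → VF) : Prop :=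
  ∃ U : ℝ → VF, (∀ t ∈ Ioc 0 T, FunA (fun ρ => t ^ s₁ * ρ ^ s₂) (u t) (U t)) ∧
    ContinuousOn U (Ioc 0 T) ∧ (∃ C : ℝ, ∀ t ∈ Ioc 0 T, ‖U t‖ ≤ C) ∧
    Tendsto (fun t => ‖U t‖) (𝓝[Ioc 0 T] 0) (𝓝 0)

/-- The class `𝒮_{r, ]0, T]}` of strong solutions of `∂ₜ u = Δ u - P (M u · ∇) u`, `u = P u`.
The time derivative is the weak-* derivative in the space of tempered distributions. -/
structure IsStrongSolution (M : Matrix (Fin 3) (Fin 3) ℝ) (P : VF →L[ℝ] VF) (r T : ℝ)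
    (u : ℝ → VF) : Prop where
  continuousOn : ContinuousOnA (fun _ => symInhom r 0) u (Icc 0 T)
  mem_range : ∀ t ∈ Icc 0 T, u t ∈ P '' sobolev r
  memB0 : MemB0 (3 / 8) (5 / 4) T u
  equation : ∃ N : ℝ → VF, (∀ t ∈ Ioc 0 T, IsConvection M (u t) (N t)) ∧
    ∀ φ : 𝓢(R3, R3),
      ContinuousOn (fun t => (∫ x, inner ℝ (u t x) ((Δ φ) x)) -
        ∫ x, inner ℝ (P (N t) x) (φ x)) (Ioc 0 T) ∧
      ∀ t ∈ Ioc 0 T, HasDerivWithinAt (fun s => ∫ x, inner ℝ (u s x) (φ x))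
        ((∫ x, inner ℝ (u t x) ((Δ φ) x)) - ∫ x, inner ℝ (P (N t) x) (φ x)) (Ioc 0 T) t

end NavierStokes

end

/-! Write v = u + w. The perturbation w starts at v₀ - u₀ and solves w' = -A²w - P[(Mu·∇)w + (Mw·∇)u
+ (Mw·∇)w]. Its rescaled nonlinearity G(t) = t^{3/4} P[...] is found as a fixed point in C([0,T],
L²), with w = e^{-tA²}(v₀ - u₀) - ∫₀ᵗ e^{-(t-s)A²} s^{-3/4} G(s) ds (`mild`, `pertMap`). The natural
norm is the scale-invariant t^{3/8}‖A^{5/4}w(t)‖.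

Two facts make the weight e^{θ(t)A} as harmless as the weight 1. First, ‖ω(A)(Mf·∇)g‖ ≤
C‖A^{5/4}ω(A)f‖‖A^{5/4}ω(A)g‖ whenever ω(|ξ|) ≤ ω(|ξ-η|)ω(|η|), because the weight can be
distributed under the convolution (`exists_product`). Second, the hypothesis on θ says that the
weight grows between times s and t by at most e^{λ√(t-s)A}, and e^{-(t-s)A²} absorbs this growth up
to a constant depending on λ only (`smoothing_mul_exp_le`, `TimeWeight.normA_duh_le`).

The given solution is only known to have A^{1/2}e^{θA}u continuous, while the fixed point argument
needs t^{3/8}‖A^{5/4}e^{θ(t)A}u(t)‖ to be bounded, and small as t → 0. This is proved on short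
windows ]a, a+τ] with τ independent of a (`IsStrongSolution.exists_windowBound`). Duhamel's formula
gives a quadratic inequality r ≤ e + Cr² for the weighted norm. To exploit it without knowing that
the norm is finite, the exponent θρ is capped at N. The unweighted bound is the case N = 0, and the
cap is raised in small steps, each of which keeps the norm in the range where the quadratic
inequality improves it.

Since u and T are arbitrary, the terms linear in w are not small by themselves. The norm of G is
therefore weighted by e^{-κt}. For small t the norm of u is small; for the other t a large κ makes
the kernel small (`tendsto_kernInt`, `exists_rate`). The fixed point lies in a ball of weighted
functions which is closed in the unweighted sup norm, so that the contraction only has to be checked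
without weight (`PertConst.mapsTo`, `PertConst.dist_le`). All radii are proportional to δ, which
gives the linear dependence on δ in the conclusions (`exists_pertConst`).

Weak and mild formulations are exchanged after truncation to frequencies ≤ n, where A² is bounded
and e^{-τA²} is a group (`WeakHeat.duhamel`, `hasDerivWithinAt_mild`). -/

noncomputable section

namespace NavierStokes

/-! ### Real vector fields and their Fourier transforms -/

@[simp] lemma complexifyVec_apply (v : R3) (i : Fin 3) : complexifyVec v i = ((v i : ℝ) : ℂ) := rfl

lemma norm_complexifyVec (v : R3) : ‖complexifyVec v‖ = ‖v‖ := by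
  simp [EuclideanSpace.norm_eq]

/-- The coordinatewise complex conjugation on `ℂ³`. -/
def conjVec : C3 →L[ℝ] C3 :=
  LinearMap.toContinuousLinearMap
    { toFun := fun v => WithLp.toLp 2 (fun i => (starRingEnd ℂ) (v i))
      map_add' := fun v w => by ext i; simp
      map_smul' := fun c v => by ext i; simp }

@[simp] lemma conjVec_apply (v : C3) (i : Fin 3) : conjVec v i = (starRingEnd ℂ) (v i) := rfl

/-- The coordinatewise real part `ℂ³ → ℝ³`. -/
def reVec : C3 →L[ℝ] R3 :=
  LinearMap.toContinuousLinearMap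
    { toFun := fun v => WithLp.toLp 2 (fun i => (v i).re)
      map_add' := fun v w => by ext i; simp
      map_smul' := fun c v => by ext i; simp }

@[simp] lemma reVec_apply (v : C3) (i : Fin 3) : reVec v i = (v i).re := rfl

/-- The coordinatewise imaginary part `ℂ³ → ℝ³`. -/
def imVec : C3 →L[ℝ] R3 :=
  LinearMap.toContinuousLinearMap
    { toFun := fun v => WithLp.toLp 2 (fun i => (v i).im)
      map_add' := fun v w => by ext i; simp
      map_smul' := fun c v => by ext i; simp }

@[simp] lemma imVec_apply (v : C3) (i : Fin 3) : imVec v i = (v i).im := rfl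

lemma complexify_re_im (v : C3) :
    complexifyVec (reVec v) + Complex.I • complexifyVec (imVec v) = v := by
  ext i
  simp [mul_comm Complex.I, Complex.re_add_im]

/-- Complexification of real vector fields. -/
abbrev complexify (f : VF) : Lp C3 2 (volume : Measure R3) := complexifyVec.compLp f

lemma coeFn_complexify (f : VF) : ∀ᵐ x, complexify f x = complexifyVec (f x) :=
  complexifyVec.coeFn_compLp f

lemma norm_complexify (f : VF) : ‖complexify f‖ = ‖f‖ := by
  rw [Lp.norm_def, Lp.norm_def]
  congr 1
  refine eLpNorm_congr_norm_ae ?_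
  filter_upwards [coeFn_complexify f] with x hx
  rw [hx, norm_complexifyVec]

/-- The Fourier transform of real vector fields as a continuous linear map. -/
def fourierVFL : VF →L[ℝ] Lp C3 2 (volume : Measure R3) :=
  ((Lp.fourierTransformₗᵢ R3 C3).toContinuousLinearEquiv : Lp C3 2 (volume : Measure R3) →L[ℂ] _).restrictScalars ℝ ∘L
    complexifyVec.compLpL 2 volume

lemma continuous_fourierVF : Continuous fourierVF := fourierVFL.continuous

lemma norm_fourierVF (f : VF) : ‖fourierVF f‖ = ‖f‖ := by
  rw [fourierVF, Lp.norm_fourier_eq, norm_complexify]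

lemma fourierVF_add (f g : VF) : fourierVF (f + g) = fourierVF f + fourierVF g :=
  fourierVFL.map_add f g

lemma fourierVF_sub (f g : VF) : fourierVF (f - g) = fourierVF f - fourierVF g :=
  fourierVFL.map_sub f g

lemma fourierVF_smul (c : ℝ) (f : VF) : fourierVF (c • f) = c • fourierVF f :=
  fourierVFL.map_smul c f

lemma fourierVF_zero : fourierVF 0 = 0 := fourierVFL.map_zero

lemma fourierVF_injective : Function.Injective fourierVF := by
  intro f g h
  have : ‖fourierVF (f - g)‖ = 0 := by rw [fourierVF_sub, h, sub_self, norm_zero]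
  rw [norm_fourierVF, norm_eq_zero] at this
  exact sub_eq_zero.1 this

/-- Hermitian symmetry, which characterizes the Fourier transforms of real vector fields. -/
def HermSymm (k : R3 → C3) : Prop := ∀ᵐ ξ, k (-ξ) = conjVec (k ξ)

lemma toLp_complexify (φ : 𝓢(R3, R3)) :
    complexify (φ.toLp 2) = (φ.postcompCLM complexifyVec).toLp 2 := by
  ext1
  filter_upwards [coeFn_complexify (φ.toLp 2), φ.coeFn_toLp 2,
    (φ.postcompCLM complexifyVec).coeFn_toLp 2] with x h1 h2 h3
  rw [h1, h2, h3]; rfl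

lemma fourierVF_toLp (φ : 𝓢(R3, R3)) :
    fourierVF (φ.toLp 2) = (𝓕 (φ.postcompCLM complexifyVec)).toLp 2 := by
  rw [← SchwartzMap.toLp_fourier_eq, ← toLp_complexify]; rfl

lemma fourier_conj_symm (φ : 𝓢(R3, R3)) (ξ : R3) :
    𝓕 (φ.postcompCLM complexifyVec) (-ξ) = conjVec (𝓕 (φ.postcompCLM complexifyVec) ξ) := by
  rw [SchwartzMap.fourier_coe, Real.fourier_eq, Real.fourier_eq, ← ContinuousLinearMap.integral_comp_comm]
  · congr 1
    ext x i
    have h2 : (starRingEnd ℂ) 2 = 2 := map_ofNat _ 2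
    simp [Circle.smul_def, Real.fourierChar_apply, ← Complex.exp_conj, h2]
  · refine (Real.fourierIntegral_convergent_iff ξ).2 ?_
    exact SchwartzMap.integrable _

/-- For Schwartz fields this is conjugation of the Fourier integral. Both sides depend continuously
on f in L², so density finishes. -/
lemma hermSymm_fourierVF (f : VF) : HermSymm (fourierVF f) := by
  have hmp : MeasurePreserving (fun x : R3 => -x) := Measure.measurePreserving_neg volume
  suffices h : Lp.compMeasurePreserving _ hmp (fourierVF f) = conjVec.compLp (fourierVF f) by
    filter_upwards [Lp.coeFn_compMeasurePreserving (fourierVF f) hmp,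
      conjVec.coeFn_compLp (fourierVF f)] with x h1 h2
    rw [← h2, ← h, h1]; rfl
  refine DenseRange.induction_on (p := fun f : VF =>
    Lp.compMeasurePreserving _ hmp (fourierVF f) = conjVec.compLp (fourierVF f))
    (SchwartzMap.denseRange_toLpCLM (p := 2) (μ := volume) (E := R3) (F := R3) ENNReal.ofNat_ne_top) f ?_ ?_
  · refine isClosed_eq ?_ ?_
    · exact (Lp.isometry_compMeasurePreserving hmp).continuous.comp continuous_fourierVF
    · exact (conjVec.compLpL 2 volume).continuous.comp continuous_fourierVF
  · intro φ
    rw [SchwartzMap.toLpCLM_apply, fourierVF_toLp]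
    set ψ := 𝓕 (φ.postcompCLM complexifyVec)
    have hψ : ∀ᵐ x, ψ.toLp 2 volume x = ψ x := ψ.coeFn_toLp 2 volume
    ext1
    filter_upwards [Lp.coeFn_compMeasurePreserving (ψ.toLp 2) hmp,
      conjVec.coeFn_compLp (ψ.toLp 2), hmp.quasiMeasurePreserving.ae hψ, hψ]
      with x h1 h2 h3 h4
    rw [h1, h2, h4, Function.comp_apply, h3, fourier_conj_symm]

/-- Split the inverse transform of k into a + ib with a, b real fields. Since k and the transforms
of a and b are all Hermitian, conjugation changes the sign of the b-part and leaves k symmetric only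
if b = 0. This is how operators defined by symbols are seen to preserve real fields. -/
lemma exists_fourierVF_eq (k : Lp C3 2 (volume : Measure R3)) (hk : HermSymm k) :
    ∃ g : VF, fourierVF g = k := by
  set G := 𝓕⁻ k
  have hG : complexify (reVec.compLp G) + Complex.I • complexify (imVec.compLp G) = G := by
    ext1
    filter_upwards [Lp.coeFn_add (complexify (reVec.compLp G)) (Complex.I • complexify (imVec.compLp G)),
      Lp.coeFn_smul Complex.I (complexify (imVec.compLp G)), coeFn_complexify (reVec.compLp G),
      coeFn_complexify (imVec.compLp G), reVec.coeFn_compLp G, imVec.coeFn_compLp G]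
      with x h1 h2 h3 h4 h5 h6
    rw [h1, Pi.add_apply, h2, Pi.smul_apply, h3, h4, h5, h6, complexify_re_im]
  have hk' : fourierVF (reVec.compLp G) + Complex.I • fourierVF (imVec.compLp G) = k := by
    have := congrArg 𝓕 hG
    rw [FourierTransform.fourier_add, FourierTransform.fourier_smul] at this
    rw [fourierVF, fourierVF, this]
    exact FourierTransform.fourier_fourierInv_eq k
  have h2 : fourierVF (imVec.compLp G) = 0 := by
    set a := fourierVF (reVec.compLp G) with ha
    set b := fourierVF (imVec.compLp G) with hb
    have hae : ∀ᵐ ξ, k ξ = a ξ + Complex.I • b ξ := by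
      filter_upwards [Lp.coeFn_add a (Complex.I • b), Lp.coeFn_smul Complex.I b] with x h1 h2
      rw [← hk', h1, Pi.add_apply, h2, Pi.smul_apply]
    have hae' := (Measure.measurePreserving_neg (volume : Measure R3)).quasiMeasurePreserving.ae hae
    ext1
    filter_upwards [hae, hae', hk, hermSymm_fourierVF (reVec.compLp G), hermSymm_fourierVF (imVec.compLp G),
      Lp.coeFn_zero C3 2 (volume : Measure R3)] with x h1 h2 h3 h4 h5 h6
    rw [h6, Pi.zero_apply]
    rw [← ha] at h4
    rw [← hb] at h5
    rw [h1] at h3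
    rw [h2, h4, h5] at h3
    ext i
    have := congrArg (fun v : C3 => v i) h3
    simp at this
    have h7 : (starRingEnd ℂ) (b x i) = 0 := by
      have h8 : (2 * Complex.I) * (starRingEnd ℂ) (b x i) = 0 := by linear_combination this
      simpa using h8
    simpa using h7
  refine ⟨reVec.compLp G, ?_⟩
  rw [h2, smul_zero, add_zero] at hk'
  exact hk'

/-! ### Functions of `A` -/

lemma two_pi_norm_nonneg (ξ : R3) : 0 ≤ 2 * Real.pi * ‖ξ‖ := by positivity

lemma measurable_two_pi_norm : Measurable fun ξ : R3 => 2 * Real.pi * ‖ξ‖ := by fun_prop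

lemma FunA.congr {m m' : ℝ → ℝ} {f g : VF} (h : FunA m f g) (hm : ∀ ρ, 0 ≤ ρ → m ρ = m' ρ) :
    FunA m' f g := by
  filter_upwards [h] with ξ hξ
  rw [hξ, hm _ (two_pi_norm_nonneg ξ)]

lemma FunA.unique {m : ℝ → ℝ} {f g g' : VF} (h : FunA m f g) (h' : FunA m f g') : g = g' := by
  refine fourierVF_injective (Lp.ext ?_)
  filter_upwards [h, h'] with ξ h1 h2
  rw [h1, h2]

lemma FunA.add {m : ℝ → ℝ} {f g f' g' : VF} (h : FunA m f g) (h' : FunA m f' g') :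
    FunA m (f + f') (g + g') := by
  rw [FunA, fourierVF_add, fourierVF_add]
  filter_upwards [h, h', Lp.coeFn_add (fourierVF f) (fourierVF f'),
    Lp.coeFn_add (fourierVF g) (fourierVF g')] with ξ h1 h2 h3 h4
  rw [h3, h4, Pi.add_apply, Pi.add_apply, h1, h2, smul_add]

lemma FunA.smul {m : ℝ → ℝ} {f g : VF} (h : FunA m f g) (c : ℝ) : FunA m (c • f) (c • g) := by
  rw [FunA, fourierVF_smul, fourierVF_smul]
  filter_upwards [h, Lp.coeFn_smul c (fourierVF f), Lp.coeFn_smul c (fourierVF g)] with ξ h1 h2 h3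
  rw [h2, h3, Pi.smul_apply, Pi.smul_apply, h1, smul_comm]

lemma FunA.sub {m : ℝ → ℝ} {f g f' g' : VF} (h : FunA m f g) (h' : FunA m f' g') :
    FunA m (f - f') (g - g') := by
  simpa [sub_eq_add_neg] using h.add (h'.smul (-1))

lemma FunA.const_mul {m : ℝ → ℝ} {f g : VF} (h : FunA m f g) (c : ℝ) :
    FunA (fun ρ => c * m ρ) f (c • g) := by
  rw [FunA, fourierVF_smul]
  filter_upwards [h, Lp.coeFn_smul c (fourierVF g)] with ξ h1 h2
  rw [h2, Pi.smul_apply, h1, smul_smul]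

lemma FunA.comp {m m' : ℝ → ℝ} {f g h : VF} (h₁ : FunA m f g) (h₂ : FunA m' g h) :
    FunA (fun ρ => m' ρ * m ρ) f h := by
  filter_upwards [h₁, h₂] with ξ h1 h2
  rw [h2, h1, smul_smul]

lemma FunA.cancel {m m' : ℝ → ℝ} {f g h : VF} (h₁ : FunA m f g)
    (h₂ : FunA (fun ρ => m' ρ * m ρ) f h) : FunA m' g h := by
  filter_upwards [h₁, h₂] with ξ h1 h2
  rw [h2, h1, smul_smul]

lemma FunA.add_symbol {m m' : ℝ → ℝ} {f g g' : VF} (h : FunA m f g) (h' : FunA m' f g') :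
    FunA (fun ρ => m ρ + m' ρ) f (g + g') := by
  rw [FunA, fourierVF_add]
  filter_upwards [h, h', Lp.coeFn_add (fourierVF g) (fourierVF g')] with ξ h1 h2 h3
  rw [h3, Pi.add_apply, h1, h2, add_smul]

lemma funA_one (f : VF) : FunA (fun _ => 1) f f := by
  filter_upwards with ξ; simp

lemma aestronglyMeasurable_symbol_smul {m : ℝ → ℝ} (hm : Measurable m) (f : VF) :
    AEStronglyMeasurable (fun ξ : R3 => m (2 * Real.pi * ‖ξ‖) • fourierVF f ξ) volume :=
  (hm.comp measurable_two_pi_norm).aestronglyMeasurable.smul (Lp.aestronglyMeasurable _)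

lemma enorm_eq_eLpNorm_fourierVF (f : VF) : ‖f‖ₑ = eLpNorm (fourierVF f) 2 volume := by
  rw [← Lp.enorm_def, ← ofReal_norm, ← ofReal_norm, norm_fourierVF]

lemma FunA.normA_eq {m : ℝ → ℝ} {f g : VF} (h : FunA m f g) : normA m f = ‖g‖ₑ := by
  rw [enorm_eq_eLpNorm_fourierVF]
  exact (eLpNorm_congr_ae h).symm

lemma normA_one (f : VF) : normA (fun _ => 1) f = ‖f‖ₑ := (funA_one f).normA_eq

/-- The symbol is real and depends on |ξ| only, so multiplication by it preserves Hermitian symmetry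
and the result is again a real field. -/
lemma exists_funA {m : ℝ → ℝ} (hm : Measurable m) {f : VF} (hf : normA m f < ∞) :
    ∃ g, FunA m f g := by
  have hmem : MemLp (fun ξ : R3 => m (2 * Real.pi * ‖ξ‖) • fourierVF f ξ) 2 volume :=
    ⟨aestronglyMeasurable_symbol_smul hm f, hf⟩
  have hsym : HermSymm hmem.toLp := by
    have h1 : ∀ᵐ ξ, hmem.toLp _ ξ = m (2 * Real.pi * ‖ξ‖) • fourierVF f ξ := hmem.coeFn_toLp
    filter_upwards [h1, (Measure.measurePreserving_neg (volume : Measure R3)).quasiMeasurePreserving.ae h1,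
      hermSymm_fourierVF f] with ξ h2 h3 h4
    rw [h2, h3, h4, norm_neg, map_smul]
  obtain ⟨g, hg⟩ := exists_fourierVF_eq _ hsym
  refine ⟨g, ?_⟩
  rw [FunA, hg]
  exact hmem.coeFn_toLp

lemma normA_le_mul {m m' : ℝ → ℝ} {C : ℝ} (hm : ∀ ρ, 0 ≤ ρ → |m ρ| ≤ C * |m' ρ|) (f : VF) :
    normA m f ≤ ENNReal.ofReal C * normA m' f := by
  refine eLpNorm_le_mul_eLpNorm_of_ae_le_mul (Eventually.of_forall fun ξ => ?_) 2
  rw [norm_smul, norm_smul, Real.norm_eq_abs, Real.norm_eq_abs, ← mul_assoc]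
  gcongr
  exact hm _ (two_pi_norm_nonneg ξ)

lemma normA_mono {m m' : ℝ → ℝ} (hm : ∀ ρ, 0 ≤ ρ → |m ρ| ≤ |m' ρ|) (f : VF) :
    normA m f ≤ normA m' f := by
  simpa using normA_le_mul (C := 1) (by simpa using hm) f

lemma normA_smul (m : ℝ → ℝ) (c : ℝ) (f : VF) : normA m (c • f) = ‖c‖ₑ * normA m f := by
  rw [normA, normA, ← eLpNorm_const_smul, fourierVF_smul]
  refine eLpNorm_congr_ae ?_
  filter_upwards [Lp.coeFn_smul c (fourierVF f)] with ξ h1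
  rw [h1, Pi.smul_apply, Pi.smul_apply, smul_comm]

lemma normA_add_le {m : ℝ → ℝ} (hm : Measurable m) (f g : VF) :
    normA m (f + g) ≤ normA m f + normA m g := by
  rw [normA, normA, normA, fourierVF_add]
  refine le_trans (le_of_eq (eLpNorm_congr_ae ?_)) (eLpNorm_add_le
    (aestronglyMeasurable_symbol_smul hm f) (aestronglyMeasurable_symbol_smul hm g) (by norm_num))
  filter_upwards [Lp.coeFn_add (fourierVF f) (fourierVF g)] with ξ h1
  rw [h1, Pi.add_apply, Pi.add_apply, smul_add]

lemma normA_sub_le {m : ℝ → ℝ} (hm : Measurable m) (f g : VF) :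
    normA m (f - g) ≤ normA m f + normA m g := by
  have := normA_add_le hm f ((-1 : ℝ) • g)
  rw [normA_smul] at this
  simpa [sub_eq_add_neg] using this

/-- `m` is a bounded measurable symbol. -/
def BddSymbol (m : ℝ → ℝ) : Prop := Measurable m ∧ ∃ C, ∀ ρ, 0 ≤ ρ → |m ρ| ≤ C

lemma normA_le_of_bdd {m : ℝ → ℝ} {C : ℝ} (hC : ∀ ρ, 0 ≤ ρ → |m ρ| ≤ C) (f : VF) :
    normA m f ≤ ENNReal.ofReal C * ‖f‖ₑ := by
  rw [← normA_one f]
  exact normA_le_mul (by simpa using hC) f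

lemma BddSymbol.exists_funA {m : ℝ → ℝ} (hm : BddSymbol m) (f : VF) : ∃ g, FunA m f g := by
  obtain ⟨hm, C, hC⟩ := hm
  exact NavierStokes.exists_funA hm ((normA_le_of_bdd hC f).trans_lt
    (ENNReal.mul_lt_top ENNReal.ofReal_lt_top enorm_lt_top))

lemma FunA.norm_le {m : ℝ → ℝ} {C : ℝ} (hC : ∀ ρ, 0 ≤ ρ → |m ρ| ≤ C) {f g : VF}
    (h : FunA m f g) : ‖g‖ ≤ C * ‖f‖ := by
  have h0 : 0 ≤ C := (abs_nonneg _).trans (hC 0 le_rfl)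
  have := normA_le_of_bdd hC f
  rw [h.normA_eq, ← ofReal_norm, ← ofReal_norm, ← ENNReal.ofReal_mul h0] at this
  exact (ENNReal.ofReal_le_ofReal_iff (by positivity)).1 this

open Classical in
/-- The operator `m(A)` for a bounded measurable symbol `m`. -/
def mulA (m : ℝ → ℝ) : VF →L[ℝ] VF :=
  if hm : BddSymbol m then
    LinearMap.mkContinuous
      { toFun := fun f => (hm.exists_funA f).choose
        map_add' := fun f g => (hm.exists_funA (f + g)).choose_spec.unique
          ((hm.exists_funA f).choose_spec.add (hm.exists_funA g).choose_spec)
        map_smul' := fun c f => (hm.exists_funA (c • f)).choose_spec.unique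
          ((hm.exists_funA f).choose_spec.smul c) }
      hm.2.choose (fun f => (hm.exists_funA f).choose_spec.norm_le hm.2.choose_spec)
  else 0

lemma BddSymbol.funA {m : ℝ → ℝ} (hm : BddSymbol m) (f : VF) : FunA m f (mulA m f) := by
  rw [mulA, dif_pos hm]
  exact (hm.exists_funA f).choose_spec

lemma BddSymbol.mul {m m' : ℝ → ℝ} (hm : BddSymbol m) (hm' : BddSymbol m') :
    BddSymbol (fun ρ => m ρ * m' ρ) := by
  obtain ⟨h1, C, hC⟩ := hm
  obtain ⟨h2, C', hC'⟩ := hm'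
  refine ⟨h1.mul h2, C * C', fun ρ hρ => ?_⟩
  rw [abs_mul]
  exact mul_le_mul (hC ρ hρ) (hC' ρ hρ) (abs_nonneg _) ((abs_nonneg _).trans (hC ρ hρ))

lemma FunA.eq_mulA {m : ℝ → ℝ} (hm : BddSymbol m) {f g : VF} (h : FunA m f g) : g = mulA m f :=
  h.unique (hm.funA f)

lemma mulA_mulA {m m' : ℝ → ℝ} (hm : BddSymbol m) (hm' : BddSymbol m') (f : VF) :
    mulA m (mulA m' f) = mulA (fun ρ => m ρ * m' ρ) f :=
  ((hm'.funA f).comp (hm.funA _)).eq_mulA (hm.mul hm')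

lemma mulA_congr {m m' : ℝ → ℝ} (hm : BddSymbol m) (hm' : BddSymbol m')
    (h : ∀ ρ, 0 ≤ ρ → m ρ = m' ρ) (f : VF) : mulA m f = mulA m' f :=
  ((hm.funA f).congr h).eq_mulA hm'

lemma mulA_one (f : VF) : mulA (fun _ => 1) f = f :=
  ((funA_one f).eq_mulA ⟨measurable_const, 1, by simp⟩).symm

lemma mulA_comm {m m' : ℝ → ℝ} (hm : BddSymbol m) (hm' : BddSymbol m') (f : VF) :
    mulA m (mulA m' f) = mulA m' (mulA m f) := by
  rw [mulA_mulA hm hm', mulA_mulA hm' hm]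
  exact mulA_congr (hm.mul hm') (hm'.mul hm) (fun ρ _ => mul_comm _ _) f

lemma norm_mulA_le {m : ℝ → ℝ} (hm : Measurable m) {C : ℝ} (hC : ∀ ρ, 0 ≤ ρ → |m ρ| ≤ C) (f : VF) :
    ‖mulA m f‖ ≤ C * ‖f‖ :=
  (BddSymbol.funA ⟨hm, C, hC⟩ f).norm_le hC

lemma inner_eq_inner_fourierVF (f g : VF) :
    ((inner ℝ f g : ℝ) : ℂ) = inner ℂ (fourierVF f) (fourierVF g) := by
  rw [fourierVF, fourierVF, Lp.inner_fourier_eq, L2.inner_def, L2.inner_def]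
  refine integral_complex_ofReal.symm.trans ?_
  refine integral_congr_ae ?_
  filter_upwards [coeFn_complexify f, coeFn_complexify g] with x h1 h2
  rw [h1, h2]
  simp [PiLp.inner_apply]

lemma inner_mulA {m : ℝ → ℝ} (hm : BddSymbol m) (f g : VF) :
    inner ℝ (mulA m f) g = inner ℝ f (mulA m g) := by
  have : ((inner ℝ (mulA m f) g : ℝ) : ℂ) = (inner ℝ f (mulA m g) : ℝ) := by
    rw [inner_eq_inner_fourierVF, inner_eq_inner_fourierVF, L2.inner_def, L2.inner_def]
    refine integral_congr_ae ?_
    filter_upwards [hm.funA f, hm.funA g] with x h1 h2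
    rw [h1, h2, RCLike.real_smul_eq_coe_smul (K := ℂ), RCLike.real_smul_eq_coe_smul (K := ℂ),
      inner_smul_left, inner_smul_right, RCLike.conj_ofReal]
  exact_mod_cast this

/-! ### Frequency truncations and strong continuity of functions of A. -/

/-- Truncation of a symbol to the frequencies `≤ n`. -/
def trunc (n : ℕ) (m : ℝ → ℝ) (ρ : ℝ) : ℝ := if ρ ≤ n then m ρ else 0

lemma measurable_trunc (n : ℕ) {m : ℝ → ℝ} (hm : Measurable m) : Measurable (trunc n m) :=
  Measurable.ite measurableSet_Iic hm measurable_const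

lemma abs_trunc_le (n : ℕ) (m : ℝ → ℝ) (ρ : ℝ) : |trunc n m ρ| ≤ |m ρ| := by
  unfold trunc; split_ifs <;> simp

lemma bddSymbol_trunc (n : ℕ) {m : ℝ → ℝ} (hm : Measurable m) {C : ℝ}
    (hC : ∀ ρ : ℝ, 0 ≤ ρ → ρ ≤ n → |m ρ| ≤ C) : BddSymbol (trunc n m) := by
  have h0 : 0 ≤ C := (abs_nonneg _).trans (hC 0 le_rfl (by positivity))
  refine ⟨measurable_trunc n hm, C, fun ρ hρ => ?_⟩
  unfold trunc
  split_ifs with h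
  · exact hC ρ hρ h
  · simpa using h0

/-- Fatou's lemma. It reduces bounds for unbounded symbols to bounds for their truncations, which
are bounded operators whenever m is locally bounded. -/
lemma normA_le_of_trunc {m : ℝ → ℝ} (hm : Measurable m) {f : VF} {K : ℝ≥0∞}
    (h : ∀ n, normA (trunc n m) f ≤ K) : normA m f ≤ K := by
  refine Lp.eLpNorm_lim_le_liminf_eLpNorm
    (fun n => aestronglyMeasurable_symbol_smul (measurable_trunc n hm) f) _ ?_ |>.trans ?_
  · refine Eventually.of_forall fun ξ => tendsto_const_nhds.congr' ?_
    obtain ⟨N, hN⟩ := exists_nat_ge (2 * Real.pi * ‖ξ‖)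
    filter_upwards [eventually_ge_atTop N] with n hn
    rw [trunc, if_pos (hN.trans (by exact_mod_cast hn))]
  · refine liminf_le_of_frequently_le' (Frequently.of_forall h)

/-- The spectral projection of `A` onto the frequencies `≤ n`. -/
def cut (n : ℕ) : VF →L[ℝ] VF := mulA (trunc n fun _ => 1)

lemma bddSymbol_cut (n : ℕ) : BddSymbol (trunc n fun _ => 1) :=
  bddSymbol_trunc n measurable_const (C := 1) (by simp)

lemma eq_of_cut_eq {f g : VF} (h : ∀ n, cut n f = cut n g) : f = g := by
  have : ‖f - g‖ₑ ≤ 0 := by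
    rw [← normA_one]
    refine normA_le_of_trunc measurable_const fun n => ?_
    rw [((bddSymbol_cut n).funA (f - g)).normA_eq, map_sub]
    have := h n
    simp only [cut] at this
    rw [this, sub_self, enorm_zero]
  simpa [sub_eq_zero] using this

/-- Dominated convergence on the Fourier side, with dominating function 2C times the transform of f.
-/
lemma tendsto_mulA {ι : Type*} {l : Filter ι} [l.IsCountablyGenerated] {m : ι → ℝ → ℝ} {m₀ : ℝ → ℝ}
    (hm : ∀ i, Measurable (m i)) (hm₀ : Measurable m₀) {C : ℝ}
    (hC : ∀ i ρ, 0 ≤ ρ → |m i ρ| ≤ C) (hC₀ : ∀ ρ, 0 ≤ ρ → |m₀ ρ| ≤ C)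
    (hlim : ∀ ρ, 0 ≤ ρ → Tendsto (fun i => m i ρ) l (𝓝 (m₀ ρ))) (f : VF) :
    Tendsto (fun i => mulA (m i) f) l (𝓝 (mulA m₀ f)) := by
  rw [tendsto_iff_edist_tendsto_0]
  have hC0 : 0 ≤ C := (abs_nonneg _).trans (hC₀ 0 le_rfl)
  have h1 : ∀ i, edist (mulA (m i) f) (mulA m₀ f) =
      (∫⁻ ξ, ‖(m i (2 * Real.pi * ‖ξ‖) - m₀ (2 * Real.pi * ‖ξ‖)) • fourierVF f ξ‖ₑ ^ (2 : ℝ)) ^ (1 / 2 : ℝ) := by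
    intro i
    rw [edist_eq_enorm_sub, enorm_eq_eLpNorm_fourierVF, eLpNorm_eq_lintegral_rpow_enorm_toReal (by norm_num) (by norm_num), fourierVF_sub]
    simp only [ENNReal.toReal_ofNat]
    congr 1
    refine lintegral_congr_ae ?_
    filter_upwards [BddSymbol.funA ⟨hm i, C, hC i⟩ f, BddSymbol.funA ⟨hm₀, C, hC₀⟩ f,
      Lp.coeFn_sub (fourierVF (mulA (m i) f)) (fourierVF (mulA m₀ f))] with ξ h1 h2 h3
    rw [h3, Pi.sub_apply, h1, h2, sub_smul]
  simp only [h1]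
  have h0 : (0 : ℝ≥0∞) = 0 ^ (1 / 2 : ℝ) := by simp
  rw [h0]
  refine (ENNReal.continuous_rpow_const.tendsto 0).comp ?_
  have hz : (0 : ℝ≥0∞) = ∫⁻ ξ : R3, 0 := by simp
  rw [hz]
  refine tendsto_lintegral_filter_of_dominated_convergence
    (fun ξ => ‖(2 * C) • fourierVF f ξ‖ₑ ^ (2 : ℝ)) ?_ ?_ ?_ ?_
  · refine Eventually.of_forall fun i => Measurable.pow_const ?_ _
    exact (((((hm i).sub hm₀).comp measurable_two_pi_norm).smul
      (Lp.stronglyMeasurable (fourierVF f)).measurable)).enorm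
  · refine Eventually.of_forall fun i => Eventually.of_forall fun ξ => ?_
    refine ENNReal.rpow_le_rpow ?_ (by norm_num)
    rw [← ofReal_norm, ← ofReal_norm, norm_smul, norm_smul]
    refine ENNReal.ofReal_le_ofReal ?_
    gcongr
    rw [Real.norm_eq_abs, Real.norm_eq_abs, abs_of_nonneg (by positivity : 0 ≤ 2 * C)]
    have h1 := hC i _ (two_pi_norm_nonneg ξ)
    have h2 := hC₀ _ (two_pi_norm_nonneg ξ)
    rw [abs_le] at h1 h2 ⊢
    constructor <;> linarith
  · have : eLpNorm (fun ξ => (2 * C) • fourierVF f ξ) 2 volume < ∞ :=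
      ((Lp.memLp (fourierVF f)).const_smul (2 * C)).2
    rw [eLpNorm_eq_lintegral_rpow_enorm_toReal (by norm_num) (by norm_num)] at this
    simp only [ENNReal.toReal_ofNat] at this
    exact ((ENNReal.rpow_lt_top_iff_of_pos (by norm_num)).1 this).ne
  · refine Eventually.of_forall fun ξ => ?_
    have h1 := (((hlim _ (two_pi_norm_nonneg ξ)).sub_const (m₀ (2 * Real.pi * ‖ξ‖))).smul_const (fourierVF f ξ)).enorm.ennrpow_const 2
    simpa using h1

lemma tendsto_cut (f : VF) : Tendsto (fun n => cut n f) atTop (𝓝 f) := by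
  conv => enter [3]; rw [← mulA_one f]
  refine tendsto_mulA (C := 1) (fun n => measurable_trunc n measurable_const) measurable_const
    (fun n ρ _ => (abs_trunc_le _ _ _).trans (by simp)) (by simp) (fun ρ _ => ?_) f
  refine tendsto_const_nhds.congr' ?_
  obtain ⟨N, hN⟩ := exists_nat_ge ρ
  filter_upwards [eventually_ge_atTop N] with n hn
  rw [trunc, if_pos (hN.trans (by exact_mod_cast hn))]

/-- Strong continuity of a family of functions of `A`, jointly with its argument. -/
lemma continuousOn_mulA {X : Type*} [TopologicalSpace X] [FirstCountableTopology X] {s : Set X}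
    {m : X → ℝ → ℝ} {g : X → VF} (hm : ∀ x ∈ s, Measurable (m x)) {C : ℝ}
    (hC : ∀ x ∈ s, ∀ ρ, 0 ≤ ρ → |m x ρ| ≤ C)
    (hcont : ∀ ρ, 0 ≤ ρ → ContinuousOn (fun x => m x ρ) s) (hg : ContinuousOn g s) :
    ContinuousOn (fun x => mulA (m x) (g x)) s := by
  intro x₀ hx₀
  rw [continuousWithinAt_iff_continuousAt_domRestrict _ hx₀]
  have h1 : Tendsto (fun x : s => mulA (m x) (g x₀)) (𝓝 ⟨x₀, hx₀⟩) (𝓝 (mulA (m x₀) (g x₀))) :=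
    tendsto_mulA (fun x : s => hm x x.2) (hm x₀ hx₀) (fun x : s => hC x x.2) (hC x₀ hx₀)
      (fun ρ hρ => (continuousOn_iff_continuous_domRestrict.1 (hcont ρ hρ)).tendsto ⟨x₀, hx₀⟩) _
  have h2 : Tendsto (fun x : s => mulA (m x) (g x - g x₀)) (𝓝 ⟨x₀, hx₀⟩) (𝓝 0) := by
    have h3 : Tendsto (fun x : s => C * ‖g x - g x₀‖) (𝓝 ⟨x₀, hx₀⟩) (𝓝 0) := by
      have := (((continuousOn_iff_continuous_domRestrict.1 hg).tendsto ⟨x₀, hx₀⟩).sub_const (g x₀)).norm.const_mul C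
      simpa using this
    exact squeeze_zero_norm (fun x => norm_mulA_le (hm x x.2) (hC x x.2) _) h3
  have h3 := h1.add h2
  rw [add_zero] at h3
  refine h3.congr fun x => ?_
  rw [map_sub]
  simp

/-! ### Testing against Schwartz functions -/

lemma inner_toLp (f : VF) (φ : 𝓢(R3, R3)) :
    inner ℝ f (φ.toLp 2) = ∫ x, inner ℝ (f x) (φ x) := by
  rw [L2.inner_def]
  refine integral_congr_ae ?_
  filter_upwards [φ.coeFn_toLp 2 volume] with x hx
  rw [hx]

lemma eq_of_inner_toLp {f g : VF} (h : ∀ φ : 𝓢(R3, R3), inner ℝ f (φ.toLp 2) = inner ℝ g (φ.toLp 2)) :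
    f = g := by
  refine ext_inner_right ℝ fun v => ?_
  refine DenseRange.induction_on (p := fun v : VF => inner ℝ f v = inner ℝ g v)
    (SchwartzMap.denseRange_toLpCLM (p := 2) (μ := volume) (E := R3) (F := R3) ENNReal.ofNat_ne_top) v ?_ ?_
  · exact isClosed_eq (by fun_prop) (by fun_prop)
  · intro φ
    simpa using h φ

lemma IsWeakPartial.unique {j : Fin 3} {f D D' : VF} (h : IsWeakPartial j f D)
    (h' : IsWeakPartial j f D') : D = D' :=
  eq_of_inner_toLp fun φ => by rw [inner_toLp, inner_toLp, h φ, h' φ]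

lemma IsConvection.unique {M : Matrix (Fin 3) (Fin 3) ℝ} {f N N' : VF} (h : IsConvection M f N)
    (h' : IsConvection M f N') : N = N' := by
  obtain ⟨D, hD, hN⟩ := h
  obtain ⟨D', hD', hN'⟩ := h'
  obtain rfl : D = D' := funext fun j => (hD j).unique (hD' j)
  ext1
  filter_upwards [hN, hN'] with x h1 h2
  rw [h1, h2]

lemma lineDeriv_postcomp (φ : 𝓢(R3, R3)) (m : R3) :
    ∂_{m} (φ.postcompCLM complexifyVec) = (∂_{m} φ).postcompCLM complexifyVec := by
  ext1 x
  rw [SchwartzMap.lineDerivOp_apply_eq_fderiv, SchwartzMap.postcompCLM_apply,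
    SchwartzMap.lineDerivOp_apply_eq_fderiv]
  have : (⇑(φ.postcompCLM complexifyVec) : R3 → C3) = complexifyVec ∘ φ := rfl
  rw [this, fderiv_comp _ complexifyVec.differentiableAt φ.differentiableAt]
  simp

lemma inner_single_one (ξ : R3) (i : Fin 3) :
    inner ℝ ξ (EuclideanSpace.single i (1 : ℝ) : R3) = ξ i := by
  simp [EuclideanSpace.inner_single_right]

lemma fourierVF_lineDeriv (φ : 𝓢(R3, R3)) (m : R3) :
    ∀ᵐ ξ, fourierVF ((∂_{m} φ).toLp 2) ξ =
      (2 * Real.pi * Complex.I * (inner ℝ ξ m : ℝ)) • fourierVF (φ.toLp 2) ξ := by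
  have hg : (fun ξ : R3 => inner ℝ ξ m).HasTemperateGrowth := by fun_prop
  rw [fourierVF_toLp, fourierVF_toLp, ← lineDeriv_postcomp, SchwartzMap.fourier_lineDerivOp_eq]
  filter_upwards [SchwartzMap.coeFn_toLp (𝓕 (φ.postcompCLM complexifyVec)) 2 volume,
    SchwartzMap.coeFn_toLp ((2 * Real.pi * Complex.I) • SchwartzMap.smulLeftCLM C3 (inner ℝ · m)
      (𝓕 (φ.postcompCLM complexifyVec))) 2 volume] with ξ h1 h2
  rw [h1, h2, smul_apply, SchwartzMap.smulLeftCLM_apply_apply hg,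
    RCLike.real_smul_eq_coe_smul (K := ℂ) (inner ℝ ξ m), smul_smul]
  rfl

lemma laplacian_eq_sum_single (φ : 𝓢(R3, R3)) :
    Δ φ = ∑ i : Fin 3, ∂_{EuclideanSpace.single i (1 : ℝ)} (∂_{EuclideanSpace.single i (1 : ℝ)} φ) := by
  rw [SchwartzMap.laplacian_eq_sum (EuclideanSpace.basisFun (Fin 3) ℝ)]
  simp

lemma funA_laplacian (φ : 𝓢(R3, R3)) :
    FunA (fun ρ => -ρ ^ 2) (φ.toLp 2) ((Δ φ).toLp 2) := by
  have h1 : ((Δ φ).toLp 2 : VF) = ∑ i : Fin 3,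
      (∂_{EuclideanSpace.single i (1 : ℝ)} (∂_{EuclideanSpace.single i (1 : ℝ)} φ) : 𝓢(R3, R3)).toLp 2 := by
    rw [laplacian_eq_sum_single]
    exact map_sum (SchwartzMap.toLpCLM ℝ R3 2 (volume : Measure R3)) _ _
  have h2 : fourierVF ((Δ φ).toLp 2) = ∑ i : Fin 3, fourierVF
      ((∂_{EuclideanSpace.single i (1 : ℝ)} (∂_{EuclideanSpace.single i (1 : ℝ)} φ) : 𝓢(R3, R3)).toLp 2) := by
    rw [h1]; exact map_sum fourierVFL _ _
  rw [FunA, h2]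
  have h3 : ∀ i : Fin 3, ∀ᵐ ξ, fourierVF
      ((∂_{EuclideanSpace.single i (1 : ℝ)} (∂_{EuclideanSpace.single i (1 : ℝ)} φ) : 𝓢(R3, R3)).toLp 2) ξ
      = (-(2 * Real.pi) ^ 2 * (ξ i) ^ 2 : ℝ) • fourierVF (φ.toLp 2) ξ := by
    intro i
    filter_upwards [fourierVF_lineDeriv φ (EuclideanSpace.single i 1),
      fourierVF_lineDeriv (∂_{EuclideanSpace.single i (1 : ℝ)} φ) (EuclideanSpace.single i 1)] with ξ h1 h2
    rw [h2, h1, smul_smul, RCLike.real_smul_eq_coe_smul (K := ℂ)]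
    congr 1
    simp only [inner_single_one]
    simp
    linear_combination (2 * Real.pi) ^ 2 * (ξ i : ℂ) ^ 2 * Complex.I_sq
  filter_upwards [Lp.coeFn_finsetSum Finset.univ (fun i : Fin 3 => fourierVF
      ((∂_{EuclideanSpace.single i (1 : ℝ)} (∂_{EuclideanSpace.single i (1 : ℝ)} φ) : 𝓢(R3, R3)).toLp 2)),
    ae_all_iff.2 h3] with ξ h4 h5
  rw [h4, Finset.sum_apply]
  simp only [h5]
  rw [← Finset.sum_smul, ← Finset.mul_sum, ← EuclideanSpace.real_norm_sq_eq, mul_pow]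
  congr 1
  ring

lemma isWeakPartial_of_fourierVF {j : Fin 3} {f D : VF}
    (h : ∀ᵐ ξ, fourierVF D ξ = (2 * Real.pi * Complex.I * (ξ j : ℝ)) • fourierVF f ξ) :
    IsWeakPartial j f D := by
  intro φ
  rw [← inner_toLp, ← inner_toLp]
  have : ((inner ℝ D (φ.toLp 2) : ℝ) : ℂ) =
      ((-inner ℝ f ((∂_{(EuclideanSpace.single j (1 : ℝ) : R3)} φ).toLp 2) : ℝ) : ℂ) := by
    rw [Complex.ofReal_neg, inner_eq_inner_fourierVF, inner_eq_inner_fourierVF, L2.inner_def, L2.inner_def,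
      ← integral_neg]
    refine integral_congr_ae ?_
    filter_upwards [h, fourierVF_lineDeriv φ (EuclideanSpace.single j 1)] with ξ h1 h2
    rw [h1, h2, inner_smul_left, inner_smul_right, inner_single_one]
    have h5 : (starRingEnd ℂ) 2 = 2 := map_ofNat _ 2
    simp [h5]
  exact_mod_cast this

/-- The multiplier 2πiξ_j is dominated by the symbol of A, and it is odd and imaginary, so it
preserves Hermitian symmetry. -/
lemma exists_weakPartial {f : VF} (hf : normA (fun ρ => ρ) f < ∞) (j : Fin 3) :
    ∃ D : VF, (∀ᵐ ξ, fourierVF D ξ = (2 * Real.pi * Complex.I * (ξ j : ℝ)) • fourierVF f ξ) ∧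
      IsWeakPartial j f D := by
  have hmeas : AEStronglyMeasurable (fun ξ : R3 => (2 * Real.pi * Complex.I * (ξ j : ℝ)) • fourierVF f ξ) volume := by
    have hc : Continuous fun ξ : R3 => (2 * Real.pi * Complex.I * (ξ j : ℝ) : ℂ) := by fun_prop
    exact hc.aestronglyMeasurable.smul (Lp.aestronglyMeasurable _)
  have hmem : MemLp (fun ξ : R3 => (2 * Real.pi * Complex.I * (ξ j : ℝ)) • fourierVF f ξ) 2 volume := by
    refine ⟨hmeas, lt_of_le_of_lt (eLpNorm_mono fun ξ => ?_) hf⟩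
    rw [norm_smul, norm_smul]
    gcongr
    have h6 : ‖(2 * Real.pi * Complex.I * (ξ j : ℝ) : ℂ)‖ = 2 * Real.pi * ‖ξ j‖ := by
      simp [abs_of_pos Real.pi_pos]
    rw [h6, Real.norm_of_nonneg (two_pi_norm_nonneg ξ)]
    gcongr
    exact PiLp.norm_apply_le ξ j
  have hsym : HermSymm hmem.toLp := by
    have h1 : ∀ᵐ ξ, hmem.toLp _ ξ = (2 * Real.pi * Complex.I * (ξ j : ℝ)) • fourierVF f ξ := hmem.coeFn_toLp
    filter_upwards [h1, (Measure.measurePreserving_neg (volume : Measure R3)).quasiMeasurePreserving.ae h1,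
      hermSymm_fourierVF f] with ξ h2 h3 h4
    rw [h2, h3, h4]
    ext i
    have h5 : (starRingEnd ℂ) 2 = 2 := map_ofNat _ 2
    simp [h5]
  obtain ⟨D, hD⟩ := exists_fourierVF_eq _ hsym
  have hD' : ∀ᵐ ξ, fourierVF D ξ = (2 * Real.pi * Complex.I * (ξ j : ℝ)) • fourierVF f ξ := by
    rw [hD]; exact hmem.coeFn_toLp
  exact ⟨D, hD', isWeakPartial_of_fourierVF hD'⟩

/-- Links the complex scalar test functions of tempered distributions to the real vector test
functions of the weak formulation, by testing with Re(h) and Im(h) times the i-th basis vector. -/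
lemma apply_smul_complexify (h : 𝓢(R3, ℂ)) (q : VF) (i : Fin 3) :
    (∫ x, h x • complexify q x) i =
      (inner ℝ q ((h.postcompCLM (Complex.reCLM.smulRight (EuclideanSpace.single i (1 : ℝ) : R3))).toLp 2) : ℝ)
      + (inner ℝ q ((h.postcompCLM (Complex.imCLM.smulRight (EuclideanSpace.single i (1 : ℝ) : R3))).toLp 2) : ℝ)
        * Complex.I := by
  have hint : Integrable (fun x => h x • complexify q x) := by
    rw [← memLp_one_iff_integrable]
    exact MemLp.smul (r := 1) (p := 2) (q := 2) (Lp.memLp (complexify q)) (h.memLp 2 volume)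
  have h1 : (∫ x, h x • complexify q x) i = ∫ x, h x * complexify q x i := by
    have := ((EuclideanSpace.proj i : C3 →L[ℂ] ℂ).integral_comp_comm hint).symm
    simpa using this
  have h2 : ∀ ψ : 𝓢(R3, R3), Integrable (fun x => ((inner ℝ (q x) (ψ x) : ℝ) : ℂ)) := by
    intro ψ
    have := (L2.integrable_inner (𝕜 := ℝ) q (ψ.toLp 2)).ofReal (𝕜 := ℂ)
    refine this.congr ?_
    filter_upwards [ψ.coeFn_toLp 2 volume] with x hx
    rw [hx]; rfl
  rw [h1, inner_toLp, inner_toLp, ← integral_complex_ofReal, ← integral_complex_ofReal,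
    ← integral_mul_const, ← integral_add (h2 _) ((h2 _).mul_const _)]
  refine integral_congr_ae ?_
  filter_upwards [coeFn_complexify q] with x hx
  rw [hx]
  simp only [SchwartzMap.postcompCLM_apply, ContinuousLinearMap.smulRight_apply, inner_smul_right,
    EuclideanSpace.inner_single_right, complexifyVec_apply, Complex.reCLM_apply, Complex.imCLM_apply]
  have := Complex.re_add_im (h x)
  simp
  linear_combination (-(q x i : ℂ)) * this

lemma laplacian_postcomp {F G : Type*} [NormedAddCommGroup F] [NormedSpace ℝ F] [NormedAddCommGroup G]
    [NormedSpace ℝ G] (φ : 𝓢(R3, F)) (L : F →L[ℝ] G) :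
    (Δ φ).postcompCLM L = Δ (φ.postcompCLM L) := by
  have h : ∀ (φ : 𝓢(R3, F)) (m : R3), (∂_{m} φ).postcompCLM L = ∂_{m} (φ.postcompCLM L) := by
    intro φ m
    ext1 x
    rw [SchwartzMap.postcompCLM_apply, SchwartzMap.lineDerivOp_apply_eq_fderiv,
      SchwartzMap.lineDerivOp_apply_eq_fderiv]
    have : (⇑(φ.postcompCLM L) : R3 → G) = L ∘ φ := rfl
    rw [this, fderiv_comp _ L.differentiableAt φ.differentiableAt]
    simp
  rw [SchwartzMap.laplacian_eq_sum (EuclideanSpace.basisFun (Fin 3) ℝ),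
    SchwartzMap.laplacian_eq_sum (EuclideanSpace.basisFun (Fin 3) ℝ), map_sum]
  simp only [h]

/-- A weak Laplacian is given by the symbol `-ρ²`. -/
lemma funA_of_inner_laplacian {q Y : VF}
    (h : ∀ φ : 𝓢(R3, R3), inner ℝ q (φ.toLp 2) = inner ℝ Y ((Δ φ).toLp 2)) :
    FunA (fun ρ => -ρ ^ 2) Y q := by
  have h1 : ((complexify q : Lp C3 2 (volume : Measure R3)) : 𝓢'(R3, C3)) =
      Δ ((complexify Y : Lp C3 2 (volume : Measure R3)) : 𝓢'(R3, C3)) := by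
    ext1 g
    rw [TemperedDistribution.laplacian_apply_apply, Lp.toTemperedDistribution_apply,
      Lp.toTemperedDistribution_apply]
    ext i
    rw [apply_smul_complexify, apply_smul_complexify, h, h, laplacian_postcomp, laplacian_postcomp]
  have hg : (fun x : R3 => Complex.ofReal (‖x‖ ^ 2)).HasTemperateGrowth := by fun_prop
  -- Taking Fourier transforms of the distributional identity turns Δ into a multiplication. Both
  -- sides are locally integrable, so equality against test functions gives equality almost
  -- everywhere.
  have h2 : ∀ g : 𝓢(R3, ℂ), ∫ ξ, g ξ • fourierVF q ξ =
      ∫ ξ, g ξ • ((-(2 * Real.pi * ‖ξ‖) ^ 2) • fourierVF Y ξ) := by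
    intro g
    have h3 := congrArg (fun d : 𝓢'(R3, C3) => 𝓕 d g) h1
    simp only [TemperedDistribution.laplacian_eq_fourierMultiplierCLM,
      TemperedDistribution.fourierMultiplierCLM_apply,
      Lp.fourier_toTemperedDistribution_eq] at h3
    rw [Lp.toTemperedDistribution_apply] at h3
    refine h3.trans ?_
    have h4 : ∀ (c : ℝ) (d : 𝓢'(R3, C3)), 𝓕 (c • d) g = c • (𝓕 d) g := fun c d => rfl
    rw [h4, FourierTransform.fourier_fourierInv_eq, TemperedDistribution.smulLeftCLM_apply_apply, Lp.toTemperedDistribution_apply, ← integral_smul]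
    refine integral_congr_ae (Eventually.of_forall fun ξ => ?_)
    simp only [SchwartzMap.smulLeftCLM_apply_apply hg]
    change _ • (_ • fourierVF Y ξ) = _ • (_ • fourierVF Y ξ)
    rw [RCLike.real_smul_eq_coe_smul (K := ℂ), RCLike.real_smul_eq_coe_smul (K := ℂ), smul_smul, smul_smul]
    congr 1
    simp
    ring
  have hloc : LocallyIntegrable (fun ξ => fourierVF q ξ) volume :=
    (Lp.memLp (fourierVF q)).locallyIntegrable (by norm_num)
  have hloc' : LocallyIntegrable (fun ξ => (-(2 * Real.pi * ‖ξ‖) ^ 2) • fourierVF Y ξ) volume := by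
    have h5 : LocallyIntegrable (fun ξ => fourierVF Y ξ) volume :=
      (Lp.memLp (fourierVF Y)).locallyIntegrable (by norm_num)
    rw [← locallyIntegrableOn_univ] at h5 ⊢
    exact h5.continuousOn_smul isOpen_univ.isLocallyClosed (by fun_prop)
  refine ae_eq_of_integral_contDiff_smul_eq hloc hloc' fun g hg1 hg2 => ?_
  have hg₁ : HasCompactSupport (Complex.ofRealCLM ∘ g) := hg2.comp_left rfl
  have hg₂ : ContDiff ℝ ((⊤ : ℕ∞) : WithTop ℕ∞) (Complex.ofRealCLM ∘ g) :=
    Complex.ofRealCLM.contDiff.comp hg1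
  have := h2 (hg₁.toSchwartzMap hg₂)
  simpa [Complex.real_smul] using this

/-! ### A convolution estimate -/

/-- Polar coordinates; the condition s < 3 is integrability at the origin. -/
lemma lintegral_closedBall_rpow {s : ℝ} (hs : s < 3) {R : ℝ} (hR : 0 ≤ R) :
    ∫⁻ k : R3 in Metric.closedBall 0 R, ENNReal.ofReal (‖k‖ ^ (-s)) ≤
      ENNReal.ofReal (3 * (volume : Measure R3).real (Metric.ball 0 1) / (3 - s) * R ^ (3 - s)) := by
  set f : ℝ → ℝ := (Iic R).indicator fun y => y ^ (-s)
  have hf : ∀ k : R3, (Metric.closedBall (0 : R3) R).indicator (fun k => ENNReal.ofReal (‖k‖ ^ (-s))) k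
      = ENNReal.ofReal (f ‖k‖) := by
    intro k
    by_cases hk : ‖k‖ ≤ R
    · simp [f, hk]
    · simp [f, hk]
  have hdim : Module.finrank ℝ R3 = 3 := by simp
  have hEq : EqOn (fun y : ℝ => y ^ (Module.finrank ℝ R3 - 1) • f y)
      ((Ioc 0 R).indicator fun y => y ^ (2 - s)) (Ioi 0) := by
    intro y hy
    rw [hdim]
    by_cases hyR : y ≤ R
    · have h1 : y ∈ Ioc 0 R := ⟨hy, hyR⟩
      simp only [f, indicator_of_mem h1, indicator_of_mem (show y ∈ Iic R from hyR), smul_eq_mul]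
      rw [sub_eq_add_neg, Real.rpow_add hy]
      norm_num
    · have h1 : y ∉ Ioc 0 R := fun h => hyR h.2
      simp only [f, indicator_of_notMem h1, indicator_of_notMem (show y ∉ Iic R from hyR), smul_zero]
  have hI : IntegrableOn (fun y : ℝ => y ^ (2 - s)) (Ioc 0 R) := by
    rw [← intervalIntegrable_iff_integrableOn_Ioc_of_le hR]
    exact intervalIntegral.intervalIntegrable_rpow' (by linarith)
  have hint : Integrable (fun k : R3 => f ‖k‖) := by
    rw [integrable_fun_norm_addHaar volume, integrableOn_congr_fun hEq measurableSet_Ioi]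
    exact (hI.integrable_indicator measurableSet_Ioc).integrableOn
  have hf0 : ∀ y, 0 ≤ y → 0 ≤ f y := fun y hy => by
    simp only [f, indicator]; split_ifs <;> positivity
  rw [← lintegral_indicator Metric.isClosed_closedBall.measurableSet]
  simp only [hf]
  rw [← ofReal_integral_eq_lintegral_ofReal hint (Eventually.of_forall fun k => hf0 _ (norm_nonneg k)),
    integral_fun_norm_addHaar volume, setIntegral_congr_fun measurableSet_Ioi hEq,
    setIntegral_indicator measurableSet_Ioc, hdim]
  have : Ioi (0 : ℝ) ∩ Ioc 0 R = Ioc 0 R := inter_eq_right.2 Ioc_subset_Ioi_self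
  rw [this, ← intervalIntegral.integral_of_le hR, integral_rpow (Or.inl (by linarith))]
  have h2 : 2 - s + 1 = 3 - s := by ring
  rw [h2, Real.zero_rpow (by linarith)]
  refine le_of_eq ?_
  congr 1
  simp
  ring

lemma sq_lintegral_mul_le {α : Type*} [MeasurableSpace α] (μ : Measure α) {f g : α → ℝ≥0∞}
    (hf : Measurable f) (hg : Measurable g) :
    (∫⁻ a, f a * g a ∂μ) ^ 2 ≤ (∫⁻ a, f a ^ 2 ∂μ) * ∫⁻ a, g a ^ 2 ∂μ := by
  have h := ENNReal.lintegral_mul_le_Lp_mul_Lq μ Real.HolderConjugate.two_two hf.aemeasurable hg.aemeasurable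
  have h2 := pow_le_pow_left' h 2
  simp only [Pi.mul_apply, ENNReal.rpow_ofNat, mul_pow] at h2
  rwa [← ENNReal.rpow_ofNat, ← ENNReal.rpow_ofNat (_ ^ (1 / 2 : ℝ)), ← ENNReal.rpow_ofNat (_ ^ (1 / 2 : ℝ)),
    ← ENNReal.rpow_mul, ← ENNReal.rpow_mul, one_div_mul_cancel (by norm_num), ENNReal.rpow_one, ENNReal.rpow_one,
    ENNReal.rpow_ofNat] at h2

/-- Cauchy–Schwarz in η with f(ξ-η) alone in one factor: by translation invariance that factor is
the full norm of f. In the other factor Tonelli lets ξ be integrated first, where the bound on the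
kernel applies. -/
lemma lintegral_kernel_conv_sq_le {K : R3 → R3 → ℝ≥0∞} (hK : Measurable (Function.uncurry K)) {c : ℝ≥0∞}
    (hc : ∀ k₂, ∫⁻ k₁, K k₁ k₂ ^ 2 ≤ c) {f g : R3 → ℝ≥0∞} (hf : Measurable f) (hg : Measurable g) :
    ∫⁻ ξ, (∫⁻ η, K (ξ - η) η * f (ξ - η) * g η) ^ 2 ≤ c * (∫⁻ ξ, f ξ ^ 2) * ∫⁻ ξ, g ξ ^ 2 := by
  have hKm : Measurable fun p : R3 × R3 => K (p.1 - p.2) p.2 :=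
    hK.comp ((measurable_fst.sub measurable_snd).prodMk measurable_snd)
  have h1 : ∀ ξ, (∫⁻ η, K (ξ - η) η * f (ξ - η) * g η) ^ 2 ≤
      (∫⁻ ξ, f ξ ^ 2) * ∫⁻ η, (K (ξ - η) η * g η) ^ 2 := by
    intro ξ
    have h2 := sq_lintegral_mul_le (volume : Measure R3) (f := fun η => f (ξ - η)) (g := fun η => K (ξ - η) η * g η)
      (hf.comp (measurable_const.sub measurable_id))
      ((hKm.comp (measurable_const.prodMk measurable_id)).mul hg)
    rw [lintegral_sub_left_eq_self (fun η => f η ^ 2) ξ] at h2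
    refine le_trans (le_of_eq ?_) h2
    congr 1
    refine lintegral_congr fun η => ?_
    ring
  calc _ ≤ ∫⁻ ξ, (∫⁻ ξ, f ξ ^ 2) * ∫⁻ η, (K (ξ - η) η * g η) ^ 2 := lintegral_mono h1
    _ = (∫⁻ ξ, f ξ ^ 2) * ∫⁻ ξ, ∫⁻ η, (K (ξ - η) η * g η) ^ 2 :=
      lintegral_const_mul _ (((hKm.mul (hg.comp measurable_snd)).pow_const 2).lintegral_prod_right')
    _ = (∫⁻ ξ, f ξ ^ 2) * ∫⁻ η, ∫⁻ ξ, (K (ξ - η) η * g η) ^ 2 := by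
      rw [lintegral_lintegral_swap]
      exact ((hKm.mul (hg.comp measurable_snd)).pow_const 2).aemeasurable
    _ ≤ (∫⁻ ξ, f ξ ^ 2) * ∫⁻ η, c * g η ^ 2 := by
      gcongr with η
      simp only [mul_pow]
      have hm : Measurable fun ξ => K (ξ - η) η ^ 2 :=
        (hKm.comp (measurable_id.prodMk (measurable_const (a := η)))).pow_const 2
      rw [lintegral_mul_const _ hm]
      gcongr
      rw [lintegral_sub_right_eq_self (fun k => K k η ^ 2) η]
      exact hc η
    _ = _ := by
      rw [lintegral_const_mul _ (hg.pow_const 2)]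
      ring

lemma lintegral_kernel_conv_sq_le' {K : R3 → R3 → ℝ≥0∞} (hK : Measurable (Function.uncurry K)) {c : ℝ≥0∞}
    (hc : ∀ k₁, ∫⁻ k₂, K k₁ k₂ ^ 2 ≤ c) {f g : R3 → ℝ≥0∞} (hf : Measurable f) (hg : Measurable g) :
    ∫⁻ ξ, (∫⁻ η, K (ξ - η) η * f (ξ - η) * g η) ^ 2 ≤ c * (∫⁻ ξ, f ξ ^ 2) * ∫⁻ ξ, g ξ ^ 2 := by
  have h := lintegral_kernel_conv_sq_le (K := fun a b => K b a) (hK.comp measurable_swap) hc hg hf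
  refine le_trans (le_of_eq ?_) (h.trans (le_of_eq (by ring)))
  refine lintegral_congr fun ξ => ?_
  rw [← lintegral_sub_left_eq_self _ ξ]
  congr 1
  refine lintegral_congr fun η => ?_
  rw [sub_sub_cancel]
  ring

/-- The constant in the convolution estimate. -/
def convConst : ℝ :=
  2 * (3 * (volume : Measure R3).real (Metric.ball 0 1) / (3 - 5 / 2)
    + 3 * (volume : Measure R3).real (Metric.ball 0 1) / (3 - 1 / 2))

lemma ofReal_rpow_mul_le {a c x : ℝ} (hc : 0 ≤ c) (hx : 0 ≤ x) :
    ENNReal.ofReal (c * x ^ a) * ENNReal.ofReal (x ^ (-a)) ≤ ENNReal.ofReal c := by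
  rw [← ENNReal.ofReal_mul (by positivity)]
  refine ENNReal.ofReal_le_ofReal ?_
  rcases hx.eq_or_lt with rfl | hx
  · by_cases ha : a = 0
    · simp [ha]
    · rw [Real.zero_rpow ha]; simpa using hc
  · rw [mul_assoc, ← Real.rpow_add hx]
    simp

lemma ofReal_rpow_sq {x : ℝ} (hx : 0 ≤ x) (a : ℝ) :
    ENNReal.ofReal (x ^ a) ^ 2 = ENNReal.ofReal (x ^ (2 * a)) := by
  rw [← ENNReal.ofReal_pow (by positivity), ← Real.rpow_mul_natCast hx]
  congr 2
  push_cast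
  ring

/-- The kernel |a|^{-5/4}|b|^{-1/4} is square integrable in neither variable alone, but it is so in
the smaller one. The integral of |a|^{-5/2} over |a| ≤ |b| is a multiple of |b|^{1/2}, which cancels
|b|^{-1/2}; the integral of |b|^{-1/2} over |b| ≤ |a| is a multiple of |a|^{5/2}, which cancels
|a|^{-5/2}. Each region is handled by one of the two Schur-type bounds. -/
lemma lintegral_conv_sq_le_aux {f g : R3 → ℝ≥0∞} (hf : Measurable f) (hg : Measurable g) :
    ∫⁻ ξ, (∫⁻ η, ENNReal.ofReal (‖ξ - η‖ ^ (-(5 / 4 : ℝ))) * ENNReal.ofReal (‖η‖ ^ (-(1 / 4 : ℝ))) *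
      f (ξ - η) * g η) ^ 2 ≤ ENNReal.ofReal convConst * (∫⁻ ξ, f ξ ^ 2) * ∫⁻ ξ, g ξ ^ 2 := by
  set V := (volume : Measure R3).real (Metric.ball 0 1)
  have hV : 0 ≤ V := measureReal_nonneg
  set K : R3 → R3 → ℝ≥0∞ := fun a b => ENNReal.ofReal (‖a‖ ^ (-(5 / 4 : ℝ))) * ENNReal.ofReal (‖b‖ ^ (-(1 / 4 : ℝ)))
  have hK : Measurable (Function.uncurry K) := by
    simp only [K, Function.uncurry_def]
    fun_prop
  have hS : MeasurableSet {p : R3 × R3 | ‖p.1‖ ≤ ‖p.2‖} := measurableSet_le (by fun_prop) (by fun_prop)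
  have hS' : MeasurableSet {p : R3 × R3 | ‖p.2‖ ≤ ‖p.1‖} := measurableSet_le (by fun_prop) (by fun_prop)
  set K₁ : R3 → R3 → ℝ≥0∞ := fun a b => {p : R3 × R3 | ‖p.1‖ ≤ ‖p.2‖}.indicator (Function.uncurry K) (a, b)
  set K₂ : R3 → R3 → ℝ≥0∞ := fun a b => {p : R3 × R3 | ‖p.2‖ ≤ ‖p.1‖}.indicator (Function.uncurry K) (a, b)
  have hK₁ : Measurable (Function.uncurry K₁) := hK.indicator hS
  have hK₂ : Measurable (Function.uncurry K₂) := hK.indicator hS'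
  have hle : ∀ a b, K a b ≤ K₁ a b + K₂ a b := by
    intro a b
    rcases le_total ‖a‖ ‖b‖ with h | h
    · refine le_trans (le_of_eq ?_) le_self_add
      simp [K₁, h]
    · refine le_trans (le_of_eq ?_) le_add_self
      simp [K₂, h]
  have hc₁ : ∀ b, ∫⁻ a, K₁ a b ^ 2 ≤ ENNReal.ofReal (3 * V / (3 - 5 / 2)) := by
    intro b
    have h1 : ∀ a, K₁ a b ^ 2 = (Metric.closedBall (0 : R3) ‖b‖).indicator
        (fun a => ENNReal.ofReal (‖a‖ ^ (-(5 / 2 : ℝ)))) a * ENNReal.ofReal (‖b‖ ^ (-(1 / 2 : ℝ))) := by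
      intro a
      by_cases h : ‖a‖ ≤ ‖b‖
      · simp only [K₁, K, Function.uncurry_apply_pair, indicator_of_mem (show (a, b) ∈ {p : R3 × R3 | ‖p.1‖ ≤ ‖p.2‖} from h), mul_pow,
          ofReal_rpow_sq (norm_nonneg _), indicator_of_mem (show a ∈ Metric.closedBall (0 : R3) ‖b‖ by simpa using h)]
        norm_num
      · simp [K₁, h]
    simp only [h1]
    rw [lintegral_mul_const' _ _ ENNReal.ofReal_ne_top, lintegral_indicator Metric.isClosed_closedBall.measurableSet]
    refine le_trans (mul_le_mul_left (lintegral_closedBall_rpow (by norm_num) (norm_nonneg b)) _) ?_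
    have h2 : (3 - 5 / 2 : ℝ) = 1 / 2 := by norm_num
    have := ofReal_rpow_mul_le (a := 1 / 2) (c := 3 * V / (1 / 2)) (by positivity) (norm_nonneg b)
    rw [h2]
    exact this
  have hc₂ : ∀ a, ∫⁻ b, K₂ a b ^ 2 ≤ ENNReal.ofReal (3 * V / (3 - 1 / 2)) := by
    intro a
    have h1 : ∀ b, K₂ a b ^ 2 = (Metric.closedBall (0 : R3) ‖a‖).indicator
        (fun b => ENNReal.ofReal (‖b‖ ^ (-(1 / 2 : ℝ)))) b * ENNReal.ofReal (‖a‖ ^ (-(5 / 2 : ℝ))) := by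
      intro b
      by_cases h : ‖b‖ ≤ ‖a‖
      · simp only [K₂, K, Function.uncurry_apply_pair, indicator_of_mem (show (a, b) ∈ {p : R3 × R3 | ‖p.2‖ ≤ ‖p.1‖} from h), mul_pow,
          ofReal_rpow_sq (norm_nonneg _), indicator_of_mem (show b ∈ Metric.closedBall (0 : R3) ‖a‖ by simpa using h)]
        rw [mul_comm]
        norm_num
      · simp [K₂, h]
    simp only [h1]
    rw [lintegral_mul_const' _ _ ENNReal.ofReal_ne_top, lintegral_indicator Metric.isClosed_closedBall.measurableSet]
    refine le_trans (mul_le_mul_left (lintegral_closedBall_rpow (by norm_num) (norm_nonneg a)) _) ?_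
    have h2 : (3 - 1 / 2 : ℝ) = 5 / 2 := by norm_num
    have := ofReal_rpow_mul_le (a := 5 / 2) (c := 3 * V / (5 / 2)) (by positivity) (norm_nonneg a)
    rw [h2]
    exact this
  have e₁ := lintegral_kernel_conv_sq_le hK₁ hc₁ hf hg
  have e₂ := lintegral_kernel_conv_sq_le' hK₂ hc₂ hf hg
  clear_value K₁ K₂
  have hm : ∀ {k : R3 → R3 → ℝ≥0∞}, Measurable (Function.uncurry k) →
      Measurable fun p : R3 × R3 => k (p.1 - p.2) p.2 * f (p.1 - p.2) * g p.2 := fun hk =>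
    ((hk.comp ((measurable_fst.sub measurable_snd).prodMk measurable_snd)).mul
      (hf.comp (measurable_fst.sub measurable_snd))).mul (hg.comp measurable_snd)
  have h2 : ∀ a b : ℝ≥0∞, (a + b) ^ 2 ≤ 2 * a ^ 2 + 2 * b ^ 2 := by
    intro a b
    have := ENNReal.rpow_add_le_mul_rpow_add_rpow a b (p := 2) (by norm_num)
    norm_num at this
    rwa [mul_add] at this
  set J₁ : R3 → ℝ≥0∞ := fun ξ => ∫⁻ η, K₁ (ξ - η) η * f (ξ - η) * g η
  set J₂ : R3 → ℝ≥0∞ := fun ξ => ∫⁻ η, K₂ (ξ - η) η * f (ξ - η) * g η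
  have hJ₁ : Measurable J₁ := (hm hK₁).lintegral_prod_right'
  have hJ₂ : Measurable J₂ := (hm hK₂).lintegral_prod_right'
  have hJ : ∀ ξ, (∫⁻ η, K (ξ - η) η * f (ξ - η) * g η) ^ 2 ≤ 2 * J₁ ξ ^ 2 + 2 * J₂ ξ ^ 2 := by
    intro ξ
    refine le_trans ?_ (h2 _ _)
    gcongr
    have hm1 : Measurable fun η => K₁ (ξ - η) η * f (ξ - η) * g η :=
      (hm hK₁).comp ((measurable_const (a := ξ)).prodMk measurable_id)
    simp only [J₁, J₂]
    rw [← lintegral_add_left hm1]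
    refine lintegral_mono fun η => ?_
    rw [← add_mul, ← add_mul]
    exact mul_le_mul_left (mul_le_mul_left (hle _ _) _) _
  change ∫⁻ ξ, (∫⁻ η, K (ξ - η) η * f (ξ - η) * g η) ^ 2 ≤ _
  refine (lintegral_mono fun ξ => hJ ξ).trans ?_
  change ∫⁻ ξ, J₁ ξ ^ 2 ≤ _ at e₁
  change ∫⁻ ξ, J₂ ξ ^ 2 ≤ _ at e₂
  have hJ₁' : Measurable fun ξ => 2 * J₁ ξ ^ 2 := (hJ₁.pow_const 2).const_mul 2
  rw [lintegral_add_left hJ₁',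
    lintegral_const_mul _ (hJ₁.pow_const 2), lintegral_const_mul _ (hJ₂.pow_const 2)]
  refine (add_le_add (mul_le_mul_right e₁ 2) (mul_le_mul_right e₂ 2)).trans (le_of_eq ?_)
  rw [convConst, ENNReal.ofReal_mul (by norm_num), ENNReal.ofReal_add (by positivity) (by positivity)]
  simp only [ENNReal.ofReal_ofNat]
  ring

/-- `‖F * G‖₂ ≤ C ‖|ξ|^{5/4} F‖₂ ‖|ξ|^{1/4} G‖₂`. -/
lemma lintegral_conv_sq_le {F G : R3 → ℝ≥0∞} (hF : Measurable F) (hG : Measurable G) :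
    ∫⁻ ξ, (∫⁻ η, F (ξ - η) * G η) ^ 2 ≤ ENNReal.ofReal convConst *
      (∫⁻ ξ, (ENNReal.ofReal (‖ξ‖ ^ (5 / 4 : ℝ)) * F ξ) ^ 2) *
      ∫⁻ ξ, (ENNReal.ofReal (‖ξ‖ ^ (1 / 4 : ℝ)) * G ξ) ^ 2 := by
  refine le_trans (le_of_eq ?_) (lintegral_conv_sq_le_aux (f := fun ξ => ENNReal.ofReal (‖ξ‖ ^ (5 / 4 : ℝ)) * F ξ)
    (g := fun ξ => ENNReal.ofReal (‖ξ‖ ^ (1 / 4 : ℝ)) * G ξ) (by fun_prop) (by fun_prop))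
  refine lintegral_congr fun ξ => ?_
  congr 1
  refine lintegral_congr_ae ?_
  -- The powers cancel except at η = ξ and η = 0, where the inverse power is not an inverse; these
  -- points are null.
  have hne : ∀ ζ : R3, ∀ᵐ η : R3, η ≠ ζ := fun ζ => (measure_eq_zero_iff_ae_notMem (μ := volume)).1 (measure_singleton ζ)
  have h1 : ∀ (x : R3) (a : ℝ), x ≠ 0 → ENNReal.ofReal (‖x‖ ^ (-a)) * ENNReal.ofReal (‖x‖ ^ a) = 1 := by
    intro x a hx
    rw [← ENNReal.ofReal_mul (by positivity), ← Real.rpow_add (norm_pos_iff.2 hx)]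
    simp
  filter_upwards [hne ξ, hne 0] with η h2 h3
  calc F (ξ - η) * G η = (ENNReal.ofReal (‖ξ - η‖ ^ (-(5 / 4 : ℝ))) * ENNReal.ofReal (‖ξ - η‖ ^ (5 / 4 : ℝ))) *
      (ENNReal.ofReal (‖η‖ ^ (-(1 / 4 : ℝ))) * ENNReal.ofReal (‖η‖ ^ (1 / 4 : ℝ))) * (F (ξ - η) * G η) := by
        rw [h1 _ _ (sub_ne_zero.2 h2.symm), h1 _ _ h3]; simp
    _ = _ := by ring

/-! ### Products and their Fourier transforms -/

/-- The character `e^{-2πi x·ξ}` as an element of `L^∞`. -/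
def charLp (ξ : R3) : Lp ℂ ∞ (volume : Measure R3) :=
  (memLp_top_of_bound (f := fun x : R3 => ((Real.fourierChar (-inner ℝ x ξ) : Circle) : ℂ))
    (Continuous.aestronglyMeasurable (by fun_prop)) 1
    (Eventually.of_forall fun x => (Circle.norm_coe _).le)).toLp

lemma coeFn_charLp (ξ : R3) :
    ∀ᵐ x, charLp ξ x = ((Real.fourierChar (-inner ℝ x ξ) : Circle) : ℂ) :=
  MemLp.coeFn_toLp _

lemma eq_of_dense_of_bilin {X Y Z S : Type*} [NormedAddCommGroup X] [NormedSpace ℂ X]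
    [NormedAddCommGroup Y] [NormedSpace ℂ Y] [NormedAddCommGroup Z] [NormedSpace ℂ Z] {e : S → X} (he : DenseRange e)
    {B₁ : X →L[ℂ] X →L[ℂ] Y} {B₂ : X →L[ℂ] X →L[ℂ] Z} {L : Y → Z} (hL : Continuous L) {T T' : X → X}
    (hT : Continuous T) (hT' : Continuous T')
    (h : ∀ a b, L (B₁ (e a) (e b)) = B₂ (T (e a)) (T' (e b))) (x y : X) :
    L (B₁ x y) = B₂ (T x) (T' y) := by
  refine DenseRange.induction_on₂ (p := fun x y => L (B₁ x y) = B₂ (T x) (T' y)) he ?_ h x y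
  exact isClosed_eq (hL.comp B₁.continuous₂)
    (B₂.continuous₂.comp ((hT.comp continuous_fst).prodMk (hT'.comp continuous_snd)))

lemma convolution_fourierInv (B : C3 →L[ℂ] C3 →L[ℂ] C3) (φ ψ : 𝓢(R3, C3)) :
    SchwartzMap.convolution B (𝓕⁻ φ) (𝓕⁻ ψ) = 𝓕⁻ (SchwartzMap.pairing B φ ψ) := by
  have h := SchwartzMap.fourier_convolution B (𝓕⁻ φ) (𝓕⁻ ψ)
  rw [FourierTransform.fourier_fourierInv_eq φ, FourierTransform.fourier_fourierInv_eq ψ] at h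
  rw [← h, FourierTransform.fourierInv_fourier_eq]

/-- The version for inverse transforms, reflected by ξ ↦ -ξ, under which the inverse transform
becomes the transform. -/
lemma convolution_fourier (B : C3 →L[ℂ] C3 →L[ℂ] C3) (φ ψ : 𝓢(R3, C3)) (ξ : R3) :
    SchwartzMap.convolution B (𝓕 φ) (𝓕 ψ) ξ = 𝓕 (SchwartzMap.pairing B φ ψ) ξ := by
  have h1 := congrArg (fun f : 𝓢(R3, C3) => f (-ξ)) (convolution_fourierInv B φ ψ)
  simp only at h1
  rw [SchwartzMap.fourierInv_coe, Real.fourierInv_eq_fourier_neg, neg_neg, SchwartzMap.convolution_apply,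
    convolution_def, ← integral_neg_eq_self] at h1
  rw [SchwartzMap.fourier_coe, ← h1, SchwartzMap.convolution_apply, convolution_def]
  refine integral_congr_ae (Eventually.of_forall fun t => ?_)
  simp only [SchwartzMap.fourierInv_coe, SchwartzMap.fourier_coe, Real.fourierInv_eq_fourier_neg]
  rw [neg_neg, neg_sub, sub_neg_eq_add, neg_add_eq_sub]

set_option maxHeartbeats 1000000 in
/-- The Fourier transform of a product is the convolution of the Fourier transforms. -/
lemma fourier_bilin_eq (B : C3 →L[ℂ] C3 →L[ℂ] C3) (f g : Lp C3 2 (volume : Measure R3)) (ξ : R3) :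
    𝓕 (fun x => B (f x) (g x)) ξ = ∫ η, B ((𝓕 f : Lp C3 2 (volume : Measure R3)) (ξ - η))
      ((𝓕 g : Lp C3 2 (volume : Measure R3)) η) := by
  have hmp : MeasurePreserving (fun η : R3 => ξ - η) := Measure.measurePreserving_sub_left volume ξ
  -- For fixed ξ both sides are continuous in (f, g) on L² × L²: the left one pairs the L¹ product
  -- with a bounded character, the right one pairs the reflected and shifted transform of f with
  -- that of g. So it suffices to compare them on Schwartz functions.
  have hL : ∀ f g : Lp C3 2 (volume : Measure R3), 𝓕 (fun x => B (f x) (g x)) ξ =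
      (ContinuousLinearMap.lsmul ℂ ℂ).lpPairing (volume : Measure R3) ∞ 1 (charLp ξ) (B.holderL volume 2 2 1 f g) := by
    intro f g
    rw [ContinuousLinearMap.lpPairing_eq_integral, Real.fourier_eq]
    refine integral_congr_ae ?_
    have h1 := B.coeFn_holder (r := 1) f g
    filter_upwards [coeFn_charLp ξ, h1] with x h1 h2
    rw [h1, ContinuousLinearMap.holderL_apply_apply, h2]
    rfl
  have hR : ∀ f g : Lp C3 2 (volume : Measure R3), ∫ η, B (f (ξ - η)) (g η) =
      B.lpPairing (volume : Measure R3) 2 2 (Lp.compMeasurePreserving _ hmp f) g := by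
    intro f g
    rw [ContinuousLinearMap.lpPairing_eq_integral]
    refine integral_congr_ae ?_
    filter_upwards [Lp.coeFn_compMeasurePreserving f hmp] with x h1
    rw [h1]; rfl
  rw [hL, hR]
  have hF : Continuous fun f : Lp C3 2 (volume : Measure R3) => (𝓕 f : Lp C3 2 (volume : Measure R3)) :=
    (Lp.fourierTransformₗᵢ R3 C3).continuous
  have hC : Continuous fun f : Lp C3 2 (volume : Measure R3) => Lp.compMeasurePreserving _ hmp f :=
    (Lp.isometry_compMeasurePreserving hmp).continuous
  refine eq_of_dense_of_bilin (B₁ := B.holderL (volume : Measure R3) 2 2 1) (B₂ := B.lpPairing (volume : Measure R3) 2 2)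
    (SchwartzMap.denseRange_toLpCLM (p := 2) (μ := volume) (E := R3) (F := C3) ENNReal.ofNat_ne_top)
    ((ContinuousLinearMap.lsmul ℂ ℂ).lpPairing (volume : Measure R3) ∞ 1 (charLp ξ)).continuous (hC.comp hF) hF ?_ f g
  · intro φ ψ
    have tφ : 𝓕 (φ.toLp 2 volume) = (𝓕 φ).toLp 2 volume := SchwartzMap.toLp_fourier_eq φ
    have tψ : 𝓕 (ψ.toLp 2 volume) = (𝓕 ψ).toLp 2 volume := SchwartzMap.toLp_fourier_eq ψ
    rw [Function.comp_apply, ← hL, ← hR, SchwartzMap.toLpCLM_apply, SchwartzMap.toLpCLM_apply]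
    have hφ : ∀ᵐ x, φ.toLp 2 volume x = φ x := φ.coeFn_toLp 2 volume
    have hψ : ∀ᵐ x, ψ.toLp 2 volume x = ψ x := ψ.coeFn_toLp 2 volume
    have hφ' : ∀ᵐ x, (𝓕 (φ.toLp 2 volume) : Lp C3 2 (volume : Measure R3)) x = 𝓕 φ x := by
      rw [tφ]; exact (𝓕 φ).coeFn_toLp 2 volume
    have hψ' : ∀ᵐ x, (𝓕 (ψ.toLp 2 volume) : Lp C3 2 (volume : Measure R3)) x = 𝓕 ψ x := by
      rw [tψ]; exact (𝓕 ψ).coeFn_toLp 2 volume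
    have e1 : ∫ η, B ((𝓕 (φ.toLp 2 volume) : Lp C3 2 (volume : Measure R3)) (ξ - η))
        ((𝓕 (ψ.toLp 2 volume) : Lp C3 2 (volume : Measure R3)) η) = ∫ η, B (𝓕 φ (ξ - η)) (𝓕 ψ η) := by
      refine integral_congr_ae ?_
      filter_upwards [hmp.quasiMeasurePreserving.ae hφ', hψ'] with η h1 h2
      rw [h1, h2]
    have e2 : 𝓕 (fun x => B (φ.toLp 2 volume x) (ψ.toLp 2 volume x)) ξ = 𝓕 (SchwartzMap.pairing B φ ψ) ξ := by
      rw [SchwartzMap.fourier_coe, Real.fourier_eq, Real.fourier_eq]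
      refine integral_congr_ae ?_
      filter_upwards [hφ, hψ] with x h1 h2
      exact congrArg (fun v => Real.fourierChar (-inner ℝ x ξ) • v) (congrArg₂ (fun a b => B a b) h1 h2)
    have e3 := convolution_fourier B φ ψ ξ
    have e4 := e2.trans e3.symm
    refine e4.trans ?_
    refine Eq.trans ?_ e1.symm
    rw [SchwartzMap.convolution_apply, convolution_def,
      ← integral_sub_left_eq_self (fun t => B (𝓕 φ t) (𝓕 ψ (ξ - t))) volume ξ]
    simp only [sub_sub_cancel]

/-- An integrable function with square integrable Fourier transform is square integrable. -/
lemma exists_Lp_of_fourier {n : R3 → C3} (hn : Integrable n) (hk : MemLp (𝓕 n) 2 volume) :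
    ∃ N : Lp C3 2 (volume : Measure R3), (∀ᵐ x, N x = n x) ∧ ∀ᵐ ξ, (𝓕 N : Lp C3 2 (volume : Measure R3)) ξ = 𝓕 n ξ := by
  refine ⟨𝓕⁻ hk.toLp, ?_, ?_⟩
  · set N : Lp C3 2 (volume : Measure R3) := 𝓕⁻ hk.toLp with hN
    -- Self-adjointness of the Fourier transform between a Schwartz function and an integrable one
    -- identifies N with n as distributions.
    have key : ∀ h : 𝓢(R3, ℂ), ∫ x, h x • N x = ∫ x, h x • n x := by
      intro h
      rw [← Lp.toTemperedDistribution_apply, hN, ← Lp.fourierInv_toTemperedDistribution_eq,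
        TemperedDistribution.fourierInv_apply, Lp.toTemperedDistribution_apply]
      have e1 : ∫ x, (𝓕⁻ h) x • hk.toLp _ x = ∫ x, (𝓕⁻ h) x • 𝓕 n x := by
        refine integral_congr_ae ?_
        filter_upwards [hk.coeFn_toLp] with x hx
        rw [hx]
      rw [e1]
      have e2 := VectorFourier.integral_fourierIntegral_smul_eq_flip (μ := (volume : Measure R3))
        (ν := (volume : Measure R3)) (L := innerₗ R3) (f := ⇑(𝓕⁻ h : 𝓢(R3, ℂ))) (g := n)
        Real.continuous_fourierChar continuous_inner (𝓕⁻ h : 𝓢(R3, ℂ)).integrable hn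
      rw [flip_innerₗ] at e2
      change ∫ ξ, 𝓕 (𝓕⁻ h : 𝓢(R3, ℂ)) ξ • n ξ = ∫ x, (𝓕⁻ h) x • 𝓕 n x at e2
      rw [FourierTransform.fourier_fourierInv_eq] at e2
      exact e2.symm
    refine ae_eq_of_integral_contDiff_smul_eq ((Lp.memLp N).locallyIntegrable (by norm_num)) hn.locallyIntegrable
      fun g hg1 hg2 => ?_
    have hg₁ : HasCompactSupport (Complex.ofRealCLM ∘ g) := hg2.comp_left rfl
    have hg₂ : ContDiff ℝ ((⊤ : ℕ∞) : WithTop ℕ∞) (Complex.ofRealCLM ∘ g) :=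
      Complex.ofRealCLM.contDiff.comp hg1
    simpa using key (hg₁.toSchwartzMap hg₂)
  · rw [FourierTransform.fourier_fourierInv_eq]
    exact hk.coeFn_toLp

section

/-! ### The convection term -/

/-- `f` is in the domain of `A^{5/4}`. -/
def InDom (f : VF) : Prop := normA (fun ρ => ρ ^ (5 / 4 : ℝ)) f < ∞

lemma measurable_rpow_const (a : ℝ) : Measurable fun ρ : ℝ => ρ ^ a := by fun_prop

lemma InDom.add {f g : VF} (hf : InDom f) (hg : InDom g) : InDom (f + g) :=
  (normA_add_le (measurable_rpow_const _) f g).trans_lt (ENNReal.add_lt_top.2 ⟨hf, hg⟩)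

lemma InDom.sub {f g : VF} (hf : InDom f) (hg : InDom g) : InDom (f - g) :=
  (normA_sub_le (measurable_rpow_const _) f g).trans_lt (ENNReal.add_lt_top.2 ⟨hf, hg⟩)

lemma FunA.inDom {f g : VF} (h : FunA (fun ρ => ρ ^ (5 / 4 : ℝ)) f g) : InDom f := by
  rw [InDom, h.normA_eq]; exact enorm_lt_top

/-- Interpolation with L²: ρ ≤ 1 + ρ^{5/4}. Hence first derivatives of such fields are square
integrable. -/
lemma InDom.normA_lt_top {f : VF} (hf : InDom f) : normA (fun ρ => ρ) f < ∞ := by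
  have h1 : normA (fun ρ => 1 + ρ ^ (5 / 4 : ℝ)) f < ∞ := by
    obtain ⟨g, hg⟩ := exists_funA (measurable_rpow_const _) hf
    rw [((funA_one f).add_symbol hg).normA_eq]
    exact enorm_lt_top
  refine (normA_mono (fun ρ hρ => ?_) f).trans_lt h1
  rw [abs_of_nonneg hρ, abs_of_nonneg (by positivity)]
  rcases le_total ρ 1 with h | h
  · have : 0 ≤ ρ ^ (5 / 4 : ℝ) := by positivity
    linarith
  · have : ρ ^ (1 : ℝ) ≤ ρ ^ (5 / 4 : ℝ) := Real.rpow_le_rpow_of_exponent_le h (by norm_num)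
    rw [Real.rpow_one] at this
    linarith

/-- `N = ∑_j (M f)_j ∂_j g`. -/
def IsProduct (M : Matrix (Fin 3) (Fin 3) ℝ) (f g N : VF) : Prop :=
  ∃ D : Fin 3 → VF, (∀ j, IsWeakPartial j g (D j)) ∧
    ∀ᵐ x : R3, N x = ∑ j : Fin 3, (M.mulVec (fun i => f x i)) j • D j x

variable {M : Matrix (Fin 3) (Fin 3) ℝ}

lemma IsProduct.unique {f g N N' : VF} (h : IsProduct M f g N) (h' : IsProduct M f g N') : N = N' := by
  obtain ⟨D, hD, hN⟩ := h
  obtain ⟨D', hD', hN'⟩ := h'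
  obtain rfl : D = D' := funext fun j => (hD j).unique (hD' j)
  ext1
  filter_upwards [hN, hN'] with x h1 h2
  rw [h1, h2]

lemma IsProduct.add_left {f f' g N N' : VF} (h : IsProduct M f g N) (h' : IsProduct M f' g N') :
    IsProduct M (f + f') g (N + N') := by
  obtain ⟨D, hD, hN⟩ := h
  obtain ⟨D', hD', hN'⟩ := h'
  obtain rfl : D = D' := funext fun j => (hD j).unique (hD' j)
  refine ⟨D, hD, ?_⟩
  filter_upwards [hN, hN', Lp.coeFn_add f f', Lp.coeFn_add N N'] with x h1 h2 h3 h4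
  rw [h4, Pi.add_apply, h1, h2, ← Finset.sum_add_distrib]
  refine Finset.sum_congr rfl fun j _ => ?_
  rw [← add_smul, ← Pi.add_apply, ← Matrix.mulVec_add, h3]
  rfl

lemma IsWeakPartial.add {j : Fin 3} {f f' D D' : VF} (h : IsWeakPartial j f D) (h' : IsWeakPartial j f' D') :
    IsWeakPartial j (f + f') (D + D') := by
  intro φ
  have h1 := h φ
  have h2 := h' φ
  rw [← inner_toLp, ← inner_toLp] at h1 h2 ⊢
  rw [inner_add_left, inner_add_left, h1, h2, neg_add]

lemma IsProduct.add_right {f g g' N N' : VF} (h : IsProduct M f g N) (h' : IsProduct M f g' N') :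
    IsProduct M f (g + g') (N + N') := by
  obtain ⟨D, hD, hN⟩ := h
  obtain ⟨D', hD', hN'⟩ := h'
  refine ⟨fun j => D j + D' j, fun j => (hD j).add (hD' j), ?_⟩
  have h3 : ∀ᵐ x, ∀ j, (D j + D' j) x = D j x + D' j x :=
    ae_all_iff.2 fun j => Lp.coeFn_add (D j) (D' j)
  filter_upwards [hN, hN', h3, Lp.coeFn_add N N'] with x h1 h2 h3 h4
  rw [h4, Pi.add_apply, h1, h2, ← Finset.sum_add_distrib]
  refine Finset.sum_congr rfl fun j _ => ?_
  rw [h3, smul_add]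

/-- A symbol `ω` with `ω(c) ≤ ω(a) ω(b)` whenever `c ≤ a + b`. -/
structure Admissible (ω : ℝ → ℝ) : Prop where
  measurable : Measurable ω
  nonneg : ∀ ρ, 0 ≤ ω ρ
  le_mul : ∀ a b c, 0 ≤ a → 0 ≤ b → 0 ≤ c → c ≤ a + b → ω c ≤ ω a * ω b

lemma admissible_one : Admissible fun _ => 1 := ⟨measurable_const, by simp, by simp⟩

/-- The linear form `a ↦ (M a)_j` on `ℂ³`. -/
def rowForm (M : Matrix (Fin 3) (Fin 3) ℝ) (j : Fin 3) : C3 →L[ℂ] ℂ :=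
  ∑ k, (M j k : ℂ) • (EuclideanSpace.proj k : C3 →L[ℂ] ℂ)

/-- The bilinear map `(a, d) ↦ (M a)_j d` on `ℂ³`. -/
def rowBilin (M : Matrix (Fin 3) (Fin 3) ℝ) (j : Fin 3) : C3 →L[ℂ] C3 →L[ℂ] C3 :=
  (ContinuousLinearMap.lsmul ℂ ℂ).comp (rowForm M j)

lemma rowBilin_apply (j : Fin 3) (a d : C3) :
    rowBilin M j a d = (∑ k, (M j k : ℂ) * a k) • d := by
  simp [rowBilin, rowForm, Finset.sum_smul]

lemma rowBilin_complexifyVec (j : Fin 3) (a d : R3) :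
    rowBilin M j (complexifyVec a) (complexifyVec d) = complexifyVec ((M.mulVec fun i => a i) j • d) := by
  rw [rowBilin_apply, map_smul, RCLike.real_smul_eq_coe_smul (K := ℂ)]
  congr 1
  simp [Matrix.mulVec, dotProduct]

/-- A constant in the bound of the convection term. -/
def rowConst (M : Matrix (Fin 3) (Fin 3) ℝ) : ℝ := ∑ j, ‖rowBilin M j‖

lemma rowConst_nonneg : 0 ≤ rowConst M := Finset.sum_nonneg fun _ _ => ContinuousLinearMap.opNorm_nonneg _

lemma convConst_nonneg : 0 ≤ convConst := by
  have : 0 ≤ (volume : Measure R3).real (Metric.ball 0 1) := measureReal_nonneg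
  unfold convConst
  positivity

/-- The constant in the bound of the convection term. -/
def prodConst (M : Matrix (Fin 3) (Fin 3) ℝ) : ℝ := rowConst M * Real.sqrt convConst

lemma prodConst_nonneg : 0 ≤ prodConst M := mul_nonneg rowConst_nonneg (Real.sqrt_nonneg _)

lemma normA_sq (m : ℝ → ℝ) (f : VF) :
    normA m f ^ 2 = ∫⁻ ξ, (ENNReal.ofReal |m (2 * Real.pi * ‖ξ‖)| * ‖fourierVF f ξ‖ₑ) ^ 2 := by
  rw [normA, eLpNorm_eq_lintegral_rpow_enorm_toReal (by norm_num) (by norm_num)]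
  simp only [ENNReal.toReal_ofNat, ENNReal.rpow_ofNat]
  rw [← ENNReal.rpow_ofNat, ← ENNReal.rpow_mul, one_div_mul_cancel (by norm_num), ENNReal.rpow_one]
  simp only [enorm_smul, Real.enorm_eq_ofReal_abs]

/-- The convolution estimate costs 1/4 derivative on the second factor, which together with the
gradient makes 5/4 on each side. Factors 2π ≥ 1 are given away. -/
lemma lintegral_conv_weight_le {ω : ℝ → ℝ} (hω : Admissible ω) (f g : VF) :
    ∫⁻ ξ : R3, (∫⁻ η, (ENNReal.ofReal (ω (2 * Real.pi * ‖ξ - η‖)) * ‖fourierVF f (ξ - η)‖ₑ) *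
      (ENNReal.ofReal (ω (2 * Real.pi * ‖η‖)) * (ENNReal.ofReal (2 * Real.pi * ‖η‖) * ‖fourierVF g η‖ₑ))) ^ 2 ≤
    ENNReal.ofReal convConst * normA (fun ρ => ρ ^ (5 / 4 : ℝ) * ω ρ) f ^ 2 *
      normA (fun ρ => ρ ^ (5 / 4 : ℝ) * ω ρ) g ^ 2 := by
  have hωm : Measurable fun ξ : R3 => ENNReal.ofReal (ω (2 * Real.pi * ‖ξ‖)) :=
    (hω.measurable.comp measurable_two_pi_norm).ennreal_ofReal
  have hm : ∀ f : VF, Measurable fun ξ : R3 => ‖fourierVF f ξ‖ₑ := fun f =>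
    (Lp.stronglyMeasurable (fourierVF f)).measurable.enorm
  refine (lintegral_conv_sq_le (F := fun ξ => ENNReal.ofReal (ω (2 * Real.pi * ‖ξ‖)) * ‖fourierVF f ξ‖ₑ)
    (G := fun η => ENNReal.ofReal (ω (2 * Real.pi * ‖η‖)) * (ENNReal.ofReal (2 * Real.pi * ‖η‖) * ‖fourierVF g η‖ₑ))
    (hωm.mul (hm f)) (hωm.mul (Measurable.mul (by fun_prop) (hm g)))).trans ?_
  rw [normA_sq, normA_sq]
  have hpi : 1 ≤ 2 * Real.pi := by linarith [Real.pi_gt_three]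
  refine mul_le_mul' (mul_le_mul' le_rfl (lintegral_mono fun ξ => pow_le_pow_left' ?_ 2))
    (lintegral_mono fun ξ => pow_le_pow_left' ?_ 2)
  · rw [← mul_assoc, ← ENNReal.ofReal_mul (by positivity)]
    gcongr
    have h1 := hω.nonneg (2 * Real.pi * ‖ξ‖)
    rw [abs_of_nonneg (by positivity)]
    gcongr
    nlinarith [norm_nonneg ξ]
  · have h1 := hω.nonneg (2 * Real.pi * ‖ξ‖)
    rw [← mul_assoc, ← mul_assoc, ← ENNReal.ofReal_mul (by positivity), ← ENNReal.ofReal_mul (by positivity)]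
    gcongr
    rw [abs_of_nonneg (by positivity)]
    have h2 : (2 * Real.pi * ‖ξ‖) ^ (5 / 4 : ℝ) = (2 * Real.pi * ‖ξ‖) ^ (1 / 4 : ℝ) * (2 * Real.pi * ‖ξ‖) := by
      rw [← Real.rpow_add_one' (two_pi_norm_nonneg ξ) (by norm_num)]
      norm_num
    rw [h2]
    have h3 : ‖ξ‖ ^ (1 / 4 : ℝ) ≤ (2 * Real.pi * ‖ξ‖) ^ (1 / 4 : ℝ) := by
      gcongr
      nlinarith [norm_nonneg ξ]
    calc _ = ‖ξ‖ ^ (1 / 4 : ℝ) * (2 * Real.pi * ‖ξ‖) * ω (2 * Real.pi * ‖ξ‖) := by ring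
      _ ≤ _ := by gcongr

lemma lintegral_sq_le_imp {m : ℝ → ℝ} {f : VF} {a b c : ℝ≥0∞} (h : normA m f ^ 2 ≤ (a * b * c) ^ 2) :
    normA m f ≤ a * b * c :=
  (ENNReal.pow_le_pow_left_iff two_ne_zero).1 h

/-- A product of L² functions is a priori only in L¹. Its transform is a convolution, and
admissibility moves ω(ξ) onto the two factors as ω(ξ-η)ω(η). The field N does not depend on ω, so a
single product satisfies all weighted bounds at once. -/
lemma exists_product {f g : VF} (hf : InDom f) (hg : InDom g) :
    ∃ N : VF, IsProduct M f g N ∧ ∀ ω, Admissible ω → normA ω N ≤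
      ENNReal.ofReal (prodConst M) * normA (fun ρ => ρ ^ (5 / 4 : ℝ) * ω ρ) f *
        normA (fun ρ => ρ ^ (5 / 4 : ℝ) * ω ρ) g := by
  choose D hD hDw using exists_weakPartial hg.normA_lt_top
  set n : R3 → C3 := fun x => ∑ j, rowBilin M j (complexify f x) (complexify (D j) x) with hn
  have hint : ∀ j, Integrable fun x => rowBilin M j (complexify f x) (complexify (D j) x) := fun j =>
    memLp_one_iff_integrable.1 ((rowBilin M j).memLp_of_bilin 1 (Lp.memLp _) (Lp.memLp _))
  have hnint : Integrable n := integrable_finsetSum _ fun j _ => hint j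
  have hF : ∀ ξ, 𝓕 n ξ = ∑ j, ∫ η, rowBilin M j (fourierVF f (ξ - η)) (fourierVF (D j) η) := by
    intro ξ
    have : ∀ j, ∫ η, rowBilin M j (fourierVF f (ξ - η)) (fourierVF (D j) η) =
        𝓕 (fun x => rowBilin M j (complexify f x) (complexify (D j) x)) ξ := fun j =>
      (fourier_bilin_eq _ _ _ _).symm
    simp only [this, Real.fourier_eq, hn, Finset.smul_sum]
    exact integral_finsetSum _ fun j _ => (Real.fourierIntegral_convergent_iff ξ).2 (hint j)
  have hbound : ∀ ξ, ‖𝓕 n ξ‖ₑ ≤ ENNReal.ofReal (rowConst M) *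
      ∫⁻ η, ‖fourierVF f (ξ - η)‖ₑ * (ENNReal.ofReal (2 * Real.pi * ‖η‖) * ‖fourierVF g η‖ₑ) := by
    intro ξ
    rw [hF, rowConst, ENNReal.ofReal_sum_of_nonneg fun _ _ => ContinuousLinearMap.opNorm_nonneg _, Finset.sum_mul]
    refine (enorm_sum_le _ _).trans (Finset.sum_le_sum fun j _ => ?_)
    refine (enorm_integral_le_lintegral_enorm _).trans ?_
    rw [← lintegral_const_mul' _ _ ENNReal.ofReal_ne_top]
    refine lintegral_mono_ae ?_
    filter_upwards [hD j] with η hη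
    rw [hη, ← ofReal_norm, ← ofReal_norm, ← ofReal_norm, ← ENNReal.ofReal_mul (by positivity),
      ← ENNReal.ofReal_mul (by positivity), ← ENNReal.ofReal_mul (ContinuousLinearMap.opNorm_nonneg _)]
    refine ENNReal.ofReal_le_ofReal (((rowBilin M j).le_opNorm₂ _ _).trans ?_)
    have h6 : ‖(2 * Real.pi * Complex.I * (η j : ℝ) : ℂ)‖ = 2 * Real.pi * ‖η j‖ := by
      simp [abs_of_pos Real.pi_pos]
    rw [mul_assoc, norm_smul, h6]
    have := PiLp.norm_apply_le η j
    gcongr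
  have hweight : ∀ ω, Admissible ω →
      ∫⁻ ξ, (ENNReal.ofReal |ω (2 * Real.pi * ‖ξ‖)| * ‖𝓕 n ξ‖ₑ) ^ 2 ≤
      (ENNReal.ofReal (prodConst M) * normA (fun ρ => ρ ^ (5 / 4 : ℝ) * ω ρ) f *
        normA (fun ρ => ρ ^ (5 / 4 : ℝ) * ω ρ) g) ^ 2 := by
    intro ω hω
    have h1 : ∀ ξ, (ENNReal.ofReal |ω (2 * Real.pi * ‖ξ‖)| * ‖𝓕 n ξ‖ₑ) ^ 2 ≤ ENNReal.ofReal (rowConst M) ^ 2 *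
        (∫⁻ η, (ENNReal.ofReal (ω (2 * Real.pi * ‖ξ - η‖)) * ‖fourierVF f (ξ - η)‖ₑ) *
      (ENNReal.ofReal (ω (2 * Real.pi * ‖η‖)) * (ENNReal.ofReal (2 * Real.pi * ‖η‖) * ‖fourierVF g η‖ₑ))) ^ 2 := by
      intro ξ
      rw [← mul_pow]
      refine pow_le_pow_left' ?_ 2
      refine (mul_le_mul' le_rfl (hbound ξ)).trans ?_
      rw [mul_left_comm, ← lintegral_const_mul' _ _ ENNReal.ofReal_ne_top]
      refine mul_le_mul' le_rfl (lintegral_mono fun η => ?_)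
      have h2 := hω.le_mul (2 * Real.pi * ‖ξ - η‖) (2 * Real.pi * ‖η‖) (2 * Real.pi * ‖ξ‖)
        (two_pi_norm_nonneg _) (two_pi_norm_nonneg _) (two_pi_norm_nonneg _) (by
          rw [← mul_add]
          refine mul_le_mul_of_nonneg_left ?_ (by positivity)
          simpa using norm_add_le (ξ - η) η)
      rw [abs_of_nonneg (hω.nonneg _)]
      calc _ ≤ ENNReal.ofReal (ω (2 * Real.pi * ‖ξ - η‖) * ω (2 * Real.pi * ‖η‖)) * _ :=
            mul_le_mul' (ENNReal.ofReal_le_ofReal h2) le_rfl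
        _ = _ := by rw [ENNReal.ofReal_mul (hω.nonneg _)]; ring
    refine (lintegral_mono h1).trans ?_
    rw [lintegral_const_mul' _ _ (ENNReal.pow_ne_top ENNReal.ofReal_ne_top)]
    refine (mul_le_mul' le_rfl (lintegral_conv_weight_le hω f g)).trans (le_of_eq ?_)
    have h3 : ENNReal.ofReal (prodConst M) ^ 2 = ENNReal.ofReal (rowConst M) ^ 2 * ENNReal.ofReal convConst := by
      rw [prodConst, ENNReal.ofReal_mul rowConst_nonneg, mul_pow, ← ENNReal.ofReal_pow (Real.sqrt_nonneg _),
        Real.sq_sqrt convConst_nonneg]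
    rw [mul_pow, mul_pow, h3]
    ring
  -- The trivial weight already shows that the product lies in L².
  have hmem : MemLp (𝓕 n) 2 volume := by
    have hcont : Continuous (𝓕 n) := VectorFourier.fourierIntegral_continuous Real.continuous_fourierChar
      (L := innerₗ R3) continuous_inner hnint
    refine ⟨hcont.aestronglyMeasurable, ?_⟩
    rw [eLpNorm_lt_top_iff_lintegral_rpow_enorm_lt_top (by norm_num) (by norm_num)]
    have h1 := hweight _ admissible_one
    simp only [abs_one, ENNReal.ofReal_one, one_mul, mul_one] at h1
    simp only [ENNReal.toReal_ofNat, ENNReal.rpow_ofNat]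
    refine h1.trans_lt (ENNReal.pow_lt_top (ENNReal.mul_lt_top (ENNReal.mul_lt_top ENNReal.ofReal_lt_top hf) hg))
  obtain ⟨Nc, hNc, hNF⟩ := exists_Lp_of_fourier hnint hmem
  have hDc : ∀ᵐ x, ∀ j, complexify (D j) x = complexifyVec (D j x) := ae_all_iff.2 fun j => coeFn_complexify _
  have hNx : ∀ᵐ x, Nc x = complexifyVec (∑ j, (M.mulVec fun i => f x i) j • D j x) := by
    filter_upwards [hNc, coeFn_complexify f, hDc] with x h1 h2 h3
    rw [h1, map_sum]
    refine Finset.sum_congr rfl fun j _ => ?_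
    rw [h2, h3, rowBilin_complexifyVec]
  set N : VF := reVec.compLp Nc
  have hre : ∀ v : R3, reVec (complexifyVec v) = v := fun v => by ext i; simp
  have hN : ∀ᵐ x, N x = ∑ j, (M.mulVec fun i => f x i) j • D j x := by
    filter_upwards [reVec.coeFn_compLp Nc, hNx] with x h1 h2
    rw [h1, h2, hre]
  have hNc' : complexify N = Nc := by
    ext1
    filter_upwards [coeFn_complexify N, hN, hNx] with x h1 h2 h3
    rw [h1, h2, h3]
  refine ⟨N, ⟨D, hDw, hN⟩, fun ω hω => ?_⟩
  refine lintegral_sq_le_imp ((le_of_eq ?_).trans (hweight ω hω))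
  rw [normA_sq]
  refine lintegral_congr_ae ?_
  have h2 : ∀ᵐ ξ, fourierVF N ξ = 𝓕 n ξ := by
    rw [show fourierVF N = 𝓕 Nc from congrArg 𝓕 hNc']; exact hNF
  filter_upwards [h2] with ξ h1
  rw [h1]

open Classical in
/-- The convection term `(M f · ∇) g` for `f`, `g` in the domain of `A^{5/4}`. -/
def conv (M : Matrix (Fin 3) (Fin 3) ℝ) (f g : VF) : VF :=
  if h : InDom f ∧ InDom g then (exists_product (M := M) h.1 h.2).choose else 0

lemma conv_isProduct {f g : VF} (hf : InDom f) (hg : InDom g) : IsProduct M f g (conv M f g) := by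
  rw [conv, dif_pos ⟨hf, hg⟩]
  exact (exists_product hf hg).choose_spec.1

lemma normA_conv_le {f g : VF} (hf : InDom f) (hg : InDom g) {ω : ℝ → ℝ} (hω : Admissible ω) :
    normA ω (conv M f g) ≤ ENNReal.ofReal (prodConst M) * normA (fun ρ => ρ ^ (5 / 4 : ℝ) * ω ρ) f *
        normA (fun ρ => ρ ^ (5 / 4 : ℝ) * ω ρ) g := by
  rw [conv, dif_pos ⟨hf, hg⟩]
  exact (exists_product hf hg).choose_spec.2 ω hω

lemma conv_isConvection {f : VF} (hf : InDom f) : IsConvection M f (conv M f f) := conv_isProduct hf hf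

lemma conv_add_left {f f' g : VF} (hf : InDom f) (hf' : InDom f') (hg : InDom g) :
    conv M (f + f') g = conv M f g + conv M f' g :=
  (conv_isProduct (hf.add hf') hg).unique ((conv_isProduct hf hg).add_left (conv_isProduct hf' hg))

lemma conv_add_right {f g g' : VF} (hf : InDom f) (hg : InDom g) (hg' : InDom g') :
    conv M f (g + g') = conv M f g + conv M f g' :=
  (conv_isProduct hf (hg.add hg')).unique ((conv_isProduct hf hg).add_right (conv_isProduct hf hg'))

lemma conv_sub_left {f f' g : VF} (hf : InDom f) (hf' : InDom f') (hg : InDom g) :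
    conv M (f - f') g = conv M f g - conv M f' g := by
  rw [eq_sub_iff_add_eq, ← conv_add_left (hf.sub hf') hf' hg, sub_add_cancel]

lemma conv_sub_right {f g g' : VF} (hf : InDom f) (hg : InDom g) (hg' : InDom g') :
    conv M f (g - g') = conv M f g - conv M f g' := by
  rw [eq_sub_iff_add_eq, ← conv_add_right hf (hg.sub hg') hg', sub_add_cancel]

/-- The bound of the convection term in terms of `A^{5/4} f` and `A^{5/4} g`. -/
lemma norm_conv_le {f g F G : VF} (hf : FunA (fun ρ => ρ ^ (5 / 4 : ℝ)) f F)
    (hg : FunA (fun ρ => ρ ^ (5 / 4 : ℝ)) g G) : ‖conv M f g‖ ≤ prodConst M * ‖F‖ * ‖G‖ := by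
  have h := normA_conv_le (M := M) hf.inDom hg.inDom admissible_one
  simp only [mul_one] at h
  rw [normA_one, hf.normA_eq, hg.normA_eq, ← ofReal_norm, ← ofReal_norm, ← ofReal_norm,
    ← ENNReal.ofReal_mul prodConst_nonneg, ← ENNReal.ofReal_mul (mul_nonneg prodConst_nonneg (norm_nonneg _))] at h
  exact (ENNReal.ofReal_le_ofReal_iff (mul_nonneg (mul_nonneg prodConst_nonneg (norm_nonneg _)) (norm_nonneg _))).1 h

end

section

/-! ### The heat semigroup -/

/-- The symbol of `e^{-τ A²}`. -/
def heat (τ ρ : ℝ) : ℝ := Real.exp (-τ * ρ ^ 2)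

lemma measurable_heat (τ : ℝ) : Measurable (heat τ) := by unfold heat; fun_prop

lemma heat_pos (τ ρ : ℝ) : 0 < heat τ ρ := Real.exp_pos _

lemma heat_le_one {τ : ℝ} (hτ : 0 ≤ τ) (ρ : ℝ) : heat τ ρ ≤ 1 :=
  Real.exp_le_one_iff.2 (by nlinarith [mul_nonneg hτ (sq_nonneg ρ)])

lemma abs_heat_le_one {τ : ℝ} (hτ : 0 ≤ τ) (ρ : ℝ) : |heat τ ρ| ≤ 1 := by
  rw [abs_of_pos (heat_pos _ _)]; exact heat_le_one hτ ρ

lemma heat_add (τ σ ρ : ℝ) : heat (τ + σ) ρ = heat τ ρ * heat σ ρ := by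
  rw [heat, heat, heat, ← Real.exp_add]; ring_nf

lemma heat_zero (ρ : ℝ) : heat 0 ρ = 1 := by simp [heat]

lemma bddSymbol_heat {τ : ℝ} (hτ : 0 ≤ τ) : BddSymbol (heat τ) :=
  ⟨measurable_heat τ, 1, fun ρ _ => abs_heat_le_one hτ ρ⟩

/-- The symbol `m` is bounded on bounded sets of frequencies. -/
def LocBdd (m : ℝ → ℝ) : Prop := ∀ n : ℕ, BddSymbol (trunc n m)

lemma LocBdd.of_continuous {m : ℝ → ℝ} (hm : ContinuousOn m (Ici 0)) (hm' : Measurable m) : LocBdd m := by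
  intro n
  obtain ⟨C, hC⟩ := isCompact_Icc.exists_bound_of_continuousOn (hm.mono
    (fun x hx => hx.1 : Icc (0 : ℝ) n ⊆ Ici 0))
  exact bddSymbol_trunc n hm' fun ρ h0 h1 => hC ρ ⟨h0, h1⟩

lemma locBdd_heat (τ : ℝ) : LocBdd (heat τ) :=
  LocBdd.of_continuous (by unfold heat; fun_prop) (measurable_heat τ)

lemma locBdd_sq : LocBdd fun ρ => ρ ^ 2 := LocBdd.of_continuous (by fun_prop) (by fun_prop)

/-- The group `e^{-τ A²}` on the frequencies `≤ n`. -/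
def cutHeat (n : ℕ) (τ : ℝ) : VF →L[ℝ] VF := mulA (trunc n (heat τ))

/-- The operator `A²` on the frequencies `≤ n`. -/
def cutSq (n : ℕ) : VF →L[ℝ] VF := mulA (trunc n fun ρ => ρ ^ 2)

lemma mulA_comp_eq {m m' m'' : ℝ → ℝ} (hm : BddSymbol m) (hm' : BddSymbol m') (hm'' : BddSymbol m'')
    (h : ∀ ρ, 0 ≤ ρ → m ρ * m' ρ = m'' ρ) (f : VF) : mulA m (mulA m' f) = mulA m'' f := by
  rw [mulA_mulA hm hm']
  exact mulA_congr (hm.mul hm') hm'' h f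

lemma trunc_mul_trunc (n : ℕ) (m m' : ℝ → ℝ) (ρ : ℝ) :
    trunc n m ρ * trunc n m' ρ = trunc n (fun ρ => m ρ * m' ρ) ρ := by
  unfold trunc; split_ifs <;> simp

lemma cutHeat_cutHeat (n : ℕ) (τ σ : ℝ) (f : VF) : cutHeat n τ (cutHeat n σ f) = cutHeat n (τ + σ) f :=
  mulA_comp_eq (locBdd_heat τ n) (locBdd_heat σ n) (locBdd_heat _ n) (fun ρ _ => by
    rw [trunc_mul_trunc]; simp only [trunc, heat_add]) f

lemma cutHeat_zero (n : ℕ) (f : VF) : cutHeat n 0 f = cut n f :=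
  mulA_congr (locBdd_heat 0 n) (bddSymbol_cut n) (fun ρ _ => by simp only [trunc, heat_zero]) f

lemma cut_heat {τ : ℝ} (hτ : 0 ≤ τ) (n : ℕ) (f : VF) : cut n (mulA (heat τ) f) = cutHeat n τ f :=
  mulA_comp_eq (bddSymbol_cut n) (bddSymbol_heat hτ) (locBdd_heat τ n) (fun ρ _ => by
    simp only [trunc]; split_ifs <;> simp) f

lemma cutHeat_cut (n : ℕ) (τ : ℝ) (f : VF) : cutHeat n τ (cut n f) = cutHeat n τ f := by
  rw [← cutHeat_zero, cutHeat_cutHeat, add_zero]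

lemma cutSq_cutHeat (n : ℕ) (τ : ℝ) (f : VF) : cutSq n (cutHeat n τ f) = cutHeat n τ (cutSq n f) :=
  mulA_comm (locBdd_sq n) (locBdd_heat τ n) f

lemma cutSq_cut (n : ℕ) (f : VF) : cutSq n (cut n f) = cutSq n f :=
  mulA_comp_eq (locBdd_sq n) (bddSymbol_cut n) (locBdd_sq n) (fun ρ _ => by
    rw [trunc_mul_trunc]; simp [trunc]) f

/-- On frequencies ≤ n the operator A² is bounded, so the exponential is differentiable in operator
norm at every real τ, negative ones included. -/
lemma hasDerivAt_cutHeat (n : ℕ) (τ : ℝ) :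
    HasDerivAt (cutHeat n) (-(cutSq n ∘L cutHeat n τ)) τ := by
  rw [hasDerivAt_iff_isLittleO_nhds_zero]
  -- The exponential bounds `heat τ`, and n⁴ comes from |e^x - 1 - x| ≤ x² with x = -hρ².
  set K := Real.exp (|τ| * (n : ℝ) ^ 2) * (n : ℝ) ^ 4
  refine (Asymptotics.IsBigO.of_bound K ?_).trans_isLittleO (Asymptotics.isLittleO_pow_id one_lt_two)
  have hsmall : ∀ᶠ h : ℝ in 𝓝 0, |h| * (n : ℝ) ^ 2 ≤ 1 := by
    have : Tendsto (fun h : ℝ => |h| * (n : ℝ) ^ 2) (𝓝 0) (𝓝 0) := by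
      have : Continuous fun h : ℝ => |h| * (n : ℝ) ^ 2 := by fun_prop
      simpa using this.tendsto 0
    exact this.eventually_le_const one_pos
  filter_upwards [hsmall] with h hh
  refine ContinuousLinearMap.opNorm_le_bound _ (by positivity) fun f => ?_
  have hsym : FunA (fun ρ => trunc n (heat (τ + h)) ρ + (-1) * trunc n (heat τ) ρ
      + h * (trunc n (fun ρ => ρ ^ 2) ρ * trunc n (heat τ) ρ)) f
      ((cutHeat n (τ + h) - cutHeat n τ - h • -(cutSq n ∘L cutHeat n τ)) f) := by
    have h1 := (((locBdd_heat (τ + h) n).funA f).add_symbol (((locBdd_heat τ n).funA f).const_mul (-1))).add_symbol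
      ((((locBdd_heat τ n).funA f).comp ((locBdd_sq n).funA _)).const_mul h)
    convert h1 using 1
    simp [cutHeat, cutSq, sub_eq_add_neg]
  refine (hsym.norm_le (C := K * ‖h ^ 2‖) fun ρ hρ => ?_)
  simp only [trunc]
  split_ifs with hn
  · have hρn : ρ ^ 2 ≤ (n : ℝ) ^ 2 := by gcongr
    have h2 : |-h * ρ ^ 2| ≤ 1 := by
      rw [abs_mul, abs_neg, abs_of_nonneg (sq_nonneg ρ)]
      exact (by gcongr : |h| * ρ ^ 2 ≤ |h| * (n : ℝ) ^ 2).trans hh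
    have h3 := Real.abs_exp_sub_one_sub_id_le h2
    have h4 : heat (τ + h) ρ + -1 * heat τ ρ + h * (ρ ^ 2 * heat τ ρ) =
        heat τ ρ * (Real.exp (-h * ρ ^ 2) - 1 - -h * ρ ^ 2) := by
      rw [heat_add]; simp only [heat]; ring
    rw [h4, abs_mul, abs_of_pos (heat_pos _ _), Real.norm_eq_abs, abs_of_nonneg (sq_nonneg h)]
    have h5 : heat τ ρ ≤ Real.exp (|τ| * (n : ℝ) ^ 2) := by
      refine Real.exp_le_exp.2 ?_
      calc -τ * ρ ^ 2 ≤ |τ| * ρ ^ 2 := by gcongr; exact neg_le_abs τ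
        _ ≤ _ := by gcongr
    have h6 : (-h * ρ ^ 2) ^ 2 ≤ (n : ℝ) ^ 4 * h ^ 2 := by
      have : (ρ ^ 2) ^ 2 ≤ ((n : ℝ) ^ 2) ^ 2 := by gcongr
      nlinarith [sq_nonneg h]
    calc _ ≤ Real.exp (|τ| * (n : ℝ) ^ 2) * ((n : ℝ) ^ 4 * h ^ 2) := by
          gcongr; exact h3.trans h6
      _ = _ := by simp only [K]; ring
  · simp only [mul_zero, add_zero, abs_zero]
    positivity

lemma continuous_cutHeat (n : ℕ) : Continuous (cutHeat n) :=
  continuous_iff_continuousAt.2 fun τ => (hasDerivAt_cutHeat n τ).continuousAt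

lemma hasDerivAt_cutHeat_neg (n : ℕ) (τ : ℝ) :
    HasDerivAt (fun τ => cutHeat n (-τ)) (cutSq n ∘L cutHeat n (-τ)) τ := by
  have := (hasDerivAt_cutHeat n (-τ)).scomp τ (hasDerivAt_neg τ)
  rw [neg_smul, one_smul, neg_neg] at this
  exact this

/-- A primitive of a function which is continuous on an interval. -/
lemma hasDerivAt_integral_of_continuousOn {E : Type*} [NormedAddCommGroup E] [NormedSpace ℝ E] [CompleteSpace E]
    {g : ℝ → E} {a b t : ℝ} (hg : ContinuousOn g (Icc a b)) (ht : t ∈ Ioo a b) :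
    HasDerivAt (fun s => ∫ r in a..s, g r) (g t) t := by
  have hat : ContinuousAt g t := hg.continuousAt (Icc_mem_nhds ht.1 ht.2)
  refine intervalIntegral.integral_hasDerivAt_right ?_ ?_ hat
  · exact (hg.mono (by rw [uIcc_of_le ht.1.le]; exact Icc_subset_Icc_right ht.2.le)).intervalIntegrable
  · exact (hg.mono Ioo_subset_Icc_self).stronglyMeasurableAtFilter isOpen_Ioo t ht

lemma integral_inner_const {g : ℝ → VF} {a b : ℝ} (hg : IntervalIntegrable g volume a b) (v : VF) :
    ∫ s in a..b, inner ℝ (g s) v = inner ℝ (∫ s in a..b, g s) v := by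
  have h := (innerSL ℝ v).intervalIntegral_comp_comm hg
  simp only [innerSL_apply_apply] at h
  rw [real_inner_comm, ← h]
  simp only [real_inner_comm]

/-- `u` solves `u' = Δ u - f` on `]a, b[`, tested against Schwartz functions. -/
def WeakHeat (u f : ℝ → VF) (a b : ℝ) : Prop :=
  ∀ φ : 𝓢(R3, R3), ∀ t ∈ Ioo a b, HasDerivAt (fun s => inner ℝ (u s) (φ.toLp 2 : VF))
    (inner ℝ (u t) ((Δ φ).toLp 2 : VF) - inner ℝ (f t) (φ.toLp 2 : VF)) t

/-! ### From weak solutions of the heat equation to Duhamel's formula. -/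

section Duhamel

variable {u f : ℝ → VF} {a b : ℝ}

/-- Integration in time removes the derivative: although u(t) need not lie in the domain of A², its
time integral does, because its weak Laplacian is in L². -/
lemma WeakHeat.funA_integral (hw : WeakHeat u f a b) (hab : a ≤ b) (hu : ContinuousOn u (Icc a b))
    (hf : ContinuousOn f (Icc a b)) :
    FunA (fun ρ => -ρ ^ 2) (∫ s in a..b, u s) (u b - u a + ∫ s in a..b, f s) := by
  have hui : IntervalIntegrable u volume a b := hu.intervalIntegrable_of_Icc hab
  have hfi : IntervalIntegrable f volume a b := hf.intervalIntegrable_of_Icc hab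
  refine funA_of_inner_laplacian fun φ => ?_
  have i1 : ∀ v : VF, ContinuousOn (fun s => inner ℝ (u s) v) (Icc a b) := fun v =>
    hu.inner continuousOn_const
  have i2 : ∀ v : VF, ContinuousOn (fun s => inner ℝ (f s) v) (Icc a b) := fun v =>
    hf.inner continuousOn_const
  have h2 := intervalIntegral.integral_eq_sub_of_hasDerivAt_of_le hab (i1 _) (hw φ)
    (((i1 _).sub (i2 _)).intervalIntegrable_of_Icc hab)
  rw [intervalIntegral.integral_sub ((i1 _).intervalIntegrable_of_Icc hab)
    ((i2 _).intervalIntegrable_of_Icc hab), integral_inner_const hui, integral_inner_const hfi] at h2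
  rw [inner_add_left, inner_sub_left]
  linarith

lemma WeakHeat.cut_eq (hw : WeakHeat u f a b) (hab : a ≤ b) (hu : ContinuousOn u (Icc a b))
    (hf : ContinuousOn f (Icc a b)) (n : ℕ) :
    cut n (u b) = cut n (u a) - ∫ s in a..b, (cutSq n (u s) + cut n (f s)) := by
  have hui : IntervalIntegrable u volume a b := hu.intervalIntegrable_of_Icc hab
  have hfi : IntervalIntegrable f volume a b := hf.intervalIntegrable_of_Icc hab
  have h3 := (hw.funA_integral hab hu hf).comp ((bddSymbol_cut n).funA _)
  have h4 : FunA (fun ρ => (-1) * trunc n (fun ρ => ρ ^ 2) ρ) (∫ s in a..b, u s)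
      ((-1 : ℝ) • cutSq n (∫ s in a..b, u s)) := ((locBdd_sq n).funA _).const_mul (-1)
  have h5 : cut n (u b - u a + ∫ s in a..b, f s) = (-1 : ℝ) • cutSq n (∫ s in a..b, u s) :=
    (h3.congr (m' := fun ρ => (-1) * trunc n (fun ρ => ρ ^ 2) ρ) (fun ρ _ => by
      simp only [trunc]; split_ifs <;> simp)).unique h4
  have i1 : IntervalIntegrable (fun s => cutSq n (u s)) volume a b :=
    ((cutSq n).continuous.comp_continuousOn hu).intervalIntegrable_of_Icc hab
  have i2 : IntervalIntegrable (fun s => cut n (f s)) volume a b :=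
    ((cut n).continuous.comp_continuousOn hf).intervalIntegrable_of_Icc hab
  rw [intervalIntegral.integral_add i1 i2, (cutSq n).intervalIntegral_comp_comm hui,
    (cut n).intervalIntegral_comp_comm hfi]
  rw [map_add, map_sub, neg_smul, one_smul] at h5
  rw [← neg_eq_iff_eq_neg.2 h5]
  abel

lemma WeakHeat.mono {a' b' : ℝ} (hw : WeakHeat u f a b) (ha : a ≤ a') (hb : b' ≤ b) :
    WeakHeat u f a' b' := fun φ t ht => hw φ t ⟨ha.trans_lt ht.1, ht.2.trans_le hb⟩

/-- Variation of constants. After truncation the equation is an ODE in L² with a bounded generator,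
and the backward evolution e^{sA²} is available; differentiating e^{sA²}u(s) leaves only the source.
-/
lemma WeakHeat.cut_duhamel (hw : WeakHeat u f a b) (hab : a ≤ b) (hu : ContinuousOn u (Icc a b))
    (hf : ContinuousOn f (Icc a b)) (n : ℕ) :
    cut n (u b) = cutHeat n (b - a) (u a) - ∫ s in a..b, cutHeat n (b - s) (f s) := by
  have hcu : ContinuousOn (fun s => cut n (u s)) (Icc a b) := (cut n).continuous.comp_continuousOn hu
  have hcf : ContinuousOn (fun s => cutSq n (u s) + cut n (f s)) (Icc a b) :=
    ((cutSq n).continuous.comp_continuousOn hu).add ((cut n).continuous.comp_continuousOn hf)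
  have h3 : ∀ t ∈ Ioo a b, HasDerivAt (fun s => cut n (u s)) (-(cutSq n (u t) + cut n (f t))) t := by
    intro t ht
    refine ((hasDerivAt_integral_of_continuousOn hcf ht).const_sub (cut n (u a))).congr_of_eventuallyEq ?_
    filter_upwards [Icc_mem_nhds ht.1 ht.2] with s hs
    exact (hw.mono le_rfl hs.2).cut_eq hs.1 (hu.mono (Icc_subset_Icc_right hs.2))
      (hf.mono (Icc_subset_Icc_right hs.2)) n
  have hc : ContinuousOn (fun s => cutHeat n (-s)) (Icc a b) :=
    ((continuous_cutHeat n).comp continuous_neg).continuousOn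
  have h4 : ∀ t ∈ Ioo a b, HasDerivAt (fun s => cutHeat n (-s) (cut n (u s))) (-cutHeat n (-t) (f t)) t := by
    intro t ht
    have := (hasDerivAt_cutHeat_neg n t).clm_apply (h3 t ht)
    refine this.congr_deriv ?_
    rw [ContinuousLinearMap.comp_apply, map_neg, map_add, cutHeat_cut, cutHeat_cut, cutSq_cutHeat]
    abel
  have hi : IntervalIntegrable (fun s => -cutHeat n (-s) (f s)) volume a b :=
    (hc.clm_apply hf).neg.intervalIntegrable_of_Icc hab
  have h5 := intervalIntegral.integral_eq_sub_of_hasDerivAt_of_le hab (hc.clm_apply hcu) h4 hi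
  have h6 := congrArg (cutHeat n b) h5
  rw [← (cutHeat n b).intervalIntegral_comp_comm hi, map_sub] at h6
  simp only [map_neg, cutHeat_cutHeat, cutHeat_cut, intervalIntegral.integral_neg,
    ← sub_eq_add_neg] at h6
  rw [sub_self, cutHeat_zero] at h6
  rw [sub_eq_iff_eq_add.1 h6.symm]
  abel

/-- Duhamel's formula for weak solutions of `u' = Δ u - f`. -/
lemma WeakHeat.duhamel (hw : WeakHeat u f a b) (hab : a ≤ b) (hu : ContinuousOn u (Icc a b))
    (hf : ContinuousOn f (Icc a b)) :
    u b = mulA (heat (b - a)) (u a) - ∫ s in a..b, mulA (heat (b - s)) (f s) := by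
  refine eq_of_cut_eq fun n => ?_
  have hheat : ContinuousOn (fun s => mulA (heat (b - s)) (f s)) (Icc a b) := by
    refine continuousOn_mulA (m := fun s => heat (b - s)) (fun s _ => measurable_heat _) (C := 1)
      (fun s hs ρ _ => abs_heat_le_one (by linarith [hs.2]) ρ) (fun ρ _ => ?_) hf
    unfold heat; fun_prop
  rw [map_sub, cut_heat (by linarith), ← (cut n).intervalIntegral_comp_comm
    (hheat.intervalIntegrable_of_Icc hab), hw.cut_duhamel hab hu hf]
  congr 1
  refine intervalIntegral.integral_congr fun s hs => ?_
  rw [uIcc_of_le hab] at hs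
  exact (cut_heat (by linarith [hs.2]) n _).symm

end Duhamel

end

section

/-! ### Time weights and smoothing estimates -/

/-- A constant in the smoothing estimates of the heat semigroup. -/
def heatConst (lam : ℝ) : ℝ := 2 * Real.exp (lam ^ 2 / 2)

lemma heatConst_pos (lam : ℝ) : 0 < heatConst lam := by unfold heatConst; positivity

/-- Completing the square, λx - x² ≤ λ²/2 - x²/2, and half of the Gaussian is left to absorb x^α ≤ 1
+ x² ≤ 2e^{x²/2}. -/
lemma rpow_mul_exp_le (lam : ℝ) {α x : ℝ} (hα : 0 ≤ α) (hα' : α ≤ 2) (hx : 0 ≤ x) :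
    x ^ α * Real.exp (lam * x - x ^ 2) ≤ heatConst lam := by
  have h1 : x ^ α ≤ 2 * Real.exp (x ^ 2 / 2) := by
    have h2 : x ^ α ≤ 1 + x ^ 2 := by
      rcases le_total x 1 with h | h
      · have := Real.rpow_le_one hx h hα
        nlinarith [sq_nonneg x]
      · have := Real.rpow_le_rpow_of_exponent_le h hα'
        rw [Real.rpow_two] at this
        linarith
    have h3 := Real.add_one_le_exp (x ^ 2 / 2)
    nlinarith [sq_nonneg x]
  calc x ^ α * Real.exp (lam * x - x ^ 2) ≤ 2 * Real.exp (x ^ 2 / 2) * Real.exp (lam ^ 2 / 2 - x ^ 2 / 2) := by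
        refine mul_le_mul h1 (Real.exp_le_exp.2 ?_) (Real.exp_pos _).le (by positivity)
        nlinarith [sq_nonneg (lam - x)]
    _ = heatConst lam := by
        rw [mul_assoc, ← Real.exp_add, heatConst]
        ring_nf

/-- The symbol of `τ^β A^{2β} e^{-τ A²}`. -/
def smoothing (β τ ρ : ℝ) : ℝ := τ ^ β * ρ ^ (2 * β) * heat τ ρ

lemma smoothing_nonneg {β τ ρ : ℝ} (hτ : 0 ≤ τ) (hρ : 0 ≤ ρ) : 0 ≤ smoothing β τ ρ :=
  mul_nonneg (mul_nonneg (Real.rpow_nonneg hτ _) (Real.rpow_nonneg hρ _)) (heat_pos _ _).le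

/-- Everything depends on x = √τ ρ only. The factor e^{λ√τρ} is exactly the growth of the weight
that the hypothesis on θ permits over a time τ. -/
lemma smoothing_mul_exp_le (lam : ℝ) {β τ ρ : ℝ} (hβ : 0 ≤ β) (hβ' : β ≤ 1) (hτ : 0 ≤ τ) (hρ : 0 ≤ ρ) :
    smoothing β τ ρ * Real.exp (lam * Real.sqrt τ * ρ) ≤ heatConst lam := by
  have h := rpow_mul_exp_le lam (α := 2 * β) (x := Real.sqrt τ * ρ) (by linarith) (by linarith) (by positivity)
  refine le_of_eq_of_le ?_ h
  have h1 : Real.sqrt τ ^ (2 * β) = τ ^ β := by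
    rw [Real.sqrt_eq_rpow, ← Real.rpow_mul hτ]; congr 1; ring
  rw [Real.mul_rpow (Real.sqrt_nonneg _) hρ, h1, smoothing, heat, mul_assoc, ← Real.exp_add, mul_pow,
    Real.sq_sqrt hτ]
  congr 2; ring

lemma smoothing_le {β τ ρ : ℝ} (hβ : 0 ≤ β) (hβ' : β ≤ 1) (hτ : 0 ≤ τ) (hρ : 0 ≤ ρ) :
    smoothing β τ ρ ≤ 2 := by
  have := smoothing_mul_exp_le 0 hβ hβ' hτ hρ
  simpa [heatConst] using this

lemma measurable_smoothing (β τ : ℝ) : Measurable (smoothing β τ) := by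
  unfold smoothing heat; fun_prop

lemma abs_smoothing_le {β τ ρ : ℝ} (hβ : 0 ≤ β) (hβ' : β ≤ 1) (hτ : 0 ≤ τ) (hρ : 0 ≤ ρ) :
    |smoothing β τ ρ| ≤ 2 := by
  rw [abs_of_nonneg (smoothing_nonneg hτ hρ)]; exact smoothing_le hβ hβ' hτ hρ

lemma bddSymbol_smoothing {β τ : ℝ} (hβ : 0 ≤ β) (hβ' : β ≤ 1) (hτ : 0 ≤ τ) : BddSymbol (smoothing β τ) :=
  ⟨measurable_smoothing β τ, 2, fun _ hρ => abs_smoothing_le hβ hβ' hτ hρ⟩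

lemma continuous_smoothing {β : ℝ} (hβ : 0 ≤ β) (ρ : ℝ) : Continuous fun τ => smoothing β τ ρ := by
  unfold smoothing heat
  have : Continuous fun τ : ℝ => τ ^ β := Real.continuous_rpow_const hβ
  fun_prop

/-- A family of frequency weights on `[0, T]` which the heat semigroup absorbs. -/
structure TimeWeight (lam T : ℝ) (ω : ℝ → ℝ → ℝ) : Prop where
  admissible : ∀ t ∈ Icc 0 T, Admissible (ω t)
  continuous : ∀ t ∈ Icc 0 T, Continuous (ω t)
  le_exp_mul : ∀ s t, 0 ≤ s → s ≤ t → t ≤ T → ∀ ρ, 0 ≤ ρ →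
    ω t ρ ≤ Real.exp (lam * Real.sqrt (t - s) * ρ) * ω s ρ

section TimeWeight

variable {lam T : ℝ} {ω : ℝ → ℝ → ℝ}

lemma TimeWeight.one (hlam : 0 ≤ lam) : TimeWeight lam T fun _ _ => 1 :=
  ⟨fun _ _ => admissible_one, fun _ _ => continuous_const, fun s t _ _ _ ρ hρ => by
    rw [mul_one]; exact Real.one_le_exp (by positivity)⟩

lemma TimeWeight.shift (hω : TimeWeight lam T ω) {a : ℝ} (ha : 0 ≤ a) :
    TimeWeight lam (T - a) fun t => ω (a + t) :=
  ⟨fun t ht => hω.admissible _ ⟨by linarith [ht.1], by linarith [ht.2]⟩,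
    fun t ht => hω.continuous _ ⟨by linarith [ht.1], by linarith [ht.2]⟩,
    fun s t hs hst ht ρ hρ => by
      have := hω.le_exp_mul (a + s) (a + t) (by linarith) (by linarith) (by linarith) ρ hρ
      rwa [add_sub_add_left_eq_sub] at this⟩

/-- Smoothing of the heat semigroup in weighted norms. -/
lemma TimeWeight.normA_smoothing_le (hω : TimeWeight lam T ω) {β s t : ℝ} (hβ : 0 ≤ β) (hβ' : β ≤ 1)
    (hs : 0 ≤ s) (hst : s ≤ t) (ht : t ≤ T) (q : ℝ → ℝ) (f : VF) :
    normA (fun ρ => q ρ * (smoothing β (t - s) ρ * ω t ρ)) f ≤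
      ENNReal.ofReal (heatConst lam) * normA (fun ρ => q ρ * ω s ρ) f := by
  refine normA_le_mul (fun ρ hρ => ?_) f
  have h1 := (hω.admissible t ⟨hs.trans hst, ht⟩).nonneg ρ
  have h2 := (hω.admissible s ⟨hs, hst.trans ht⟩).nonneg ρ
  have h3 := smoothing_nonneg (β := β) (sub_nonneg.2 hst) hρ
  rw [abs_mul, abs_mul (q ρ), abs_of_nonneg (mul_nonneg h3 h1), abs_of_nonneg h2]
  calc |q ρ| * (smoothing β (t - s) ρ * ω t ρ)
      ≤ |q ρ| * (smoothing β (t - s) ρ * (Real.exp (lam * Real.sqrt (t - s) * ρ) * ω s ρ)) := by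
        gcongr; exact hω.le_exp_mul s t hs hst ht ρ hρ
    _ = |q ρ| * (smoothing β (t - s) ρ * Real.exp (lam * Real.sqrt (t - s) * ρ)) * ω s ρ := by ring
    _ ≤ |q ρ| * heatConst lam * ω s ρ := by
        gcongr; exact smoothing_mul_exp_le lam hβ hβ' (sub_nonneg.2 hst) hρ
    _ = _ := by ring

end TimeWeight

/-! ### Functions of `A` and integrals -/

lemma funA_of_cut {m : ℝ → ℝ} (hm : LocBdd m) {f g : VF} (h : ∀ n, mulA (trunc n m) f = cut n g) :
    FunA m f g := by
  have h1 : ∀ᵐ ξ : R3, ∀ n : ℕ, trunc n m (2 * Real.pi * ‖ξ‖) • fourierVF f ξ =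
      trunc n (fun _ => 1) (2 * Real.pi * ‖ξ‖) • fourierVF g ξ := by
    refine ae_all_iff.2 fun n => ?_
    filter_upwards [(hm n).funA f, (bddSymbol_cut n).funA g] with ξ h1 h2
    rw [← h1, h n, ← h2, cut]
  filter_upwards [h1] with ξ hξ
  obtain ⟨n, hn⟩ := exists_nat_ge (2 * Real.pi * ‖ξ‖)
  have := hξ n
  rw [trunc, trunc, if_pos hn, if_pos hn, one_smul] at this
  exact this.symm

lemma FunA.trunc_eq {m : ℝ → ℝ} (hm : LocBdd m) {f g : VF} (h : FunA m f g) (n : ℕ) :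
    mulA (trunc n m) f = cut n g := by
  refine ((h.comp ((bddSymbol_cut n).funA g)).congr fun ρ _ => ?_).eq_mulA (hm n) |>.symm
  simp only [trunc]; split_ifs <;> simp

/-- The closed operator m(A) passes under the Bochner integral because its bounded truncations do.
-/
lemma FunA.integral {μ : Measure ℝ} {m : ℝ → ℝ} (hm : LocBdd m) {f g : ℝ → VF} (hf : Integrable f μ)
    (hg : Integrable g μ) (h : ∀ᵐ s ∂μ, FunA m (f s) (g s)) : FunA m (∫ s, f s ∂μ) (∫ s, g s ∂μ) := by
  refine funA_of_cut hm fun n => ?_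
  rw [← (mulA (trunc n m)).integral_comp_comm hf, ← (cut n).integral_comp_comm hg]
  refine integral_congr_ae ?_
  filter_upwards [h] with s hs
  exact hs.trunc_eq hm n

lemma normA_integral_le {μ : Measure ℝ} {m : ℝ → ℝ} (hm : LocBdd m) (hm' : Measurable m) {f : ℝ → VF}
    {b : ℝ → ℝ} (hf : Integrable f μ) (hb : Integrable b μ) (hb0 : ∀ᵐ s ∂μ, 0 ≤ b s)
    (h : ∀ᵐ s ∂μ, normA m (f s) ≤ ENNReal.ofReal (b s)) :
    normA m (∫ s, f s ∂μ) ≤ ENNReal.ofReal (∫ s, b s ∂μ) := by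
  refine normA_le_of_trunc hm' fun n => ?_
  rw [((hm n).funA _).normA_eq, ← (mulA (trunc n m)).integral_comp_comm hf, ← ofReal_norm]
  refine ENNReal.ofReal_le_ofReal (norm_integral_le_of_norm_le hb ?_)
  filter_upwards [h, hb0] with s hs h0
  rw [← ENNReal.ofReal_le_ofReal_iff h0, ofReal_norm, ← ((hm n).funA _).normA_eq]
  exact (normA_mono (fun ρ _ => abs_trunc_le n m ρ) _).trans hs

/-- The weighted norm is the supremum of the continuous norms given by its truncations, hence lower
semicontinuous on L². -/
lemma isClosed_normA_le {m : ℝ → ℝ} (hm : LocBdd m) (hm' : Measurable m) (K : ℝ≥0∞) :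
    IsClosed {f : VF | normA m f ≤ K} := by
  have : {f : VF | normA m f ≤ K} = ⋂ n, {f | ‖mulA (trunc n m) f‖ₑ ≤ K} := by
    ext f
    simp only [mem_ofPred_eq, mem_iInter]
    refine ⟨fun h n => ?_, fun h => normA_le_of_trunc hm' fun n => ?_⟩
    · rw [← ((hm n).funA _).normA_eq]
      exact (normA_mono (fun ρ _ => abs_trunc_le n m ρ) _).trans h
    · rw [((hm n).funA _).normA_eq]
      exact h n
  rw [this]
  exact isClosed_iInter fun n => isClosed_le (by fun_prop) continuous_const

/-! ### The kernel of Duhamel's integral -/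

/-- The kernel `σ^{-3/4} (1 - σ)^{-β}`. -/
def kern (β σ : ℝ) : ℝ := σ ^ (-(3 / 4) : ℝ) * (1 - σ) ^ (-β)

lemma kern_nonneg {β σ : ℝ} (h : σ ∈ Ioc (0 : ℝ) 1) : 0 ≤ kern β σ :=
  mul_nonneg (Real.rpow_nonneg h.1.le _) (Real.rpow_nonneg (sub_nonneg.2 h.2) _)

lemma integrable_kern {β : ℝ} (hβ : β < 1) : Integrable (kern β) (volume.restrict (Ioc 0 1)) := by
  -- The kernel is the integrand of the beta function with parameters 1/4 and 1 - β.
  have h := Complex.betaIntegral_convergent (u := (1 / 4 : ℝ)) (v := (1 - β : ℝ)) (by simp) (by simpa using hβ)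
  rw [intervalIntegrable_iff_integrableOn_Ioc_of_le zero_le_one] at h
  refine h.norm.congr ?_
  filter_upwards [ae_restrict_mem measurableSet_Ioc,
    (measure_eq_zero_iff_ae_notMem.1 (measure_singleton (1 : ℝ)) : ∀ᵐ x : ℝ, x ∉ ({1} : Set ℝ)) |> ae_restrict_of_ae] with σ hσ h1
  have h2 : 0 < 1 - σ := sub_pos.2 (lt_of_le_of_ne hσ.2 h1)
  rw [norm_mul, ← Complex.ofReal_one, ← Complex.ofReal_sub, ← Complex.ofReal_sub, ← Complex.ofReal_sub,
    Complex.norm_cpow_eq_rpow_re_of_pos hσ.1, Complex.norm_cpow_eq_rpow_re_of_pos h2, kern]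
  simp only [Complex.ofReal_re]
  congr 2 <;> norm_num

/-- The integral `∫₀¹ σ^{-3/4} (1 - σ)^{-β} e^{-x (1 - σ)} dσ`. -/
def kernInt (β x : ℝ) : ℝ := ∫ σ in Ioc (0 : ℝ) 1, kern β σ * Real.exp (-(x * (1 - σ)))

lemma integrable_kern_exp {β : ℝ} (hβ : β < 1) {x : ℝ} (hx : 0 ≤ x) :
    Integrable (fun σ => kern β σ * Real.exp (-(x * (1 - σ)))) (volume.restrict (Ioc 0 1)) := by
  refine (integrable_kern hβ).mul_bdd (c := 1) (by fun_prop) ?_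
  filter_upwards [ae_restrict_mem measurableSet_Ioc] with σ hσ
  rw [Real.norm_eq_abs, Real.abs_exp, Real.exp_le_one_iff]
  nlinarith [hσ.2, mul_nonneg hx (sub_nonneg.2 hσ.2)]

lemma kernInt_nonneg (β x : ℝ) : 0 ≤ kernInt β x :=
  setIntegral_nonneg measurableSet_Ioc fun _ hσ => mul_nonneg (kern_nonneg hσ) (Real.exp_pos _).le

lemma kernInt_anti {β : ℝ} (hβ : β < 1) {x y : ℝ} (hx : 0 ≤ x) (hxy : x ≤ y) : kernInt β y ≤ kernInt β x := by
  refine setIntegral_mono_on (integrable_kern_exp hβ (hx.trans hxy)) (integrable_kern_exp hβ hx) measurableSet_Ioc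
    fun σ hσ => ?_
  have := kern_nonneg (β := β) hσ
  have h1 := sub_nonneg.2 hσ.2
  gcongr

/-- With x = κt this is the source of smallness at times away from 0: a large rate κ makes Duhamel's
integral small relative to e^{κt}. -/
lemma tendsto_kernInt {β : ℝ} (hβ : β < 1) : Tendsto (kernInt β) atTop (𝓝 0) := by
  have hz : (0 : ℝ) = ∫ _ in Ioc (0 : ℝ) 1, (0 : ℝ) := by simp
  rw [hz]
  refine tendsto_integral_filter_of_dominated_convergence (kern β) ?_ ?_ (integrable_kern hβ) ?_
  · filter_upwards [eventually_ge_atTop 0] with x hx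
    exact (integrable_kern_exp hβ hx).aestronglyMeasurable
  · filter_upwards [eventually_ge_atTop 0] with x hx
    filter_upwards [ae_restrict_mem measurableSet_Ioc] with σ hσ
    rw [Real.norm_eq_abs, abs_of_nonneg (mul_nonneg (kern_nonneg hσ) (Real.exp_pos _).le)]
    refine mul_le_of_le_one_right (kern_nonneg hσ) (Real.exp_le_one_iff.2 ?_)
    nlinarith [hσ.2, mul_nonneg hx (sub_nonneg.2 hσ.2)]
  · filter_upwards [ae_restrict_mem measurableSet_Ioc,
      (measure_eq_zero_iff_ae_notMem.1 (measure_singleton (1 : ℝ)) : ∀ᵐ x : ℝ, x ∉ ({1} : Set ℝ)) |> ae_restrict_of_ae] with σ hσ h1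
    have h2 : 0 < 1 - σ := sub_pos.2 (lt_of_le_of_ne hσ.2 h1)
    have h3 : Tendsto (fun x : ℝ => -(x * (1 - σ))) atTop atBot :=
      tendsto_neg_atTop_atBot.comp (tendsto_id.atTop_mul_const h2)
    simpa using (Real.tendsto_exp_atBot.comp h3).const_mul (kern β σ)

end

section

/-! ### Duhamel's integral -/

/-- The part `∫₀¹ σ^{-3/4} (1 - σ)^{-β} m(A) G(tσ) dσ` of Duhamel's integral, where `m(A)` is
the smoothing operator of order `2β` at time `t (1 - σ)`. -/
def smoothInt (β : ℝ) (G : ℝ → VF) (t : ℝ) : VF :=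
  ∫ σ in Ioc (0 : ℝ) 1, kern β σ • mulA (smoothing β (t * (1 - σ))) (G (t * σ))

/-- Duhamel's integral `∫₀ᵗ e^{-(t - s) A²} s^{-3/4} G(s) ds`, rescaled to the unit interval. -/
def duh (G : ℝ → VF) (t : ℝ) : VF := t ^ (1 / 4 : ℝ) • smoothInt 0 G t

section Duh

variable {T β t : ℝ} {G : ℝ → VF}

lemma mul_mem_Icc {σ : ℝ} (ht : t ∈ Icc 0 T) (hσ : σ ∈ Icc (0 : ℝ) 1) : t * σ ∈ Icc 0 T :=
  ⟨mul_nonneg ht.1 hσ.1, (mul_le_of_le_one_right ht.1 hσ.2).trans ht.2⟩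

lemma continuousOn_comp_mul (hG : ContinuousOn G (Icc 0 T)) {σ : ℝ} (hσ : σ ∈ Icc (0 : ℝ) 1) :
    ContinuousOn (fun t => G (t * σ)) (Icc 0 T) :=
  hG.comp (by fun_prop) fun _ ht => mul_mem_Icc ht hσ

lemma continuousOn_smoothing_integrand (hβ : 0 ≤ β) (hβ' : β ≤ 1) (hG : ContinuousOn G (Icc 0 T))
    (ht : t ∈ Icc 0 T) :
    ContinuousOn (fun σ => mulA (smoothing β (t * (1 - σ))) (G (t * σ))) (Icc 0 1) := by
  refine continuousOn_mulA (m := fun σ => smoothing β (t * (1 - σ))) (C := 2)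
    (fun σ _ => measurable_smoothing _ _) (fun σ hσ ρ hρ => abs_smoothing_le hβ hβ'
      (mul_nonneg ht.1 (sub_nonneg.2 hσ.2)) hρ) (fun ρ _ => ?_)
    (hG.comp (by fun_prop) fun σ hσ => mul_mem_Icc ht hσ)
  exact ((continuous_smoothing hβ ρ).comp (by fun_prop : Continuous fun σ : ℝ => t * (1 - σ))).continuousOn

lemma aestronglyMeasurable_smoothInt (hβ : 0 ≤ β) (hβ' : β ≤ 1) (hG : ContinuousOn G (Icc 0 T))
    (ht : t ∈ Icc 0 T) (γ : ℝ) :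
    AEStronglyMeasurable (fun σ => kern γ σ • mulA (smoothing β (t * (1 - σ))) (G (t * σ)))
      (volume.restrict (Ioc 0 1)) := by
  have hk : Measurable (kern γ) := by unfold kern; fun_prop
  refine hk.aestronglyMeasurable.smul ?_
  exact ((continuousOn_smoothing_integrand hβ hβ' hG ht).mono Ioc_subset_Icc_self).aestronglyMeasurable
    measurableSet_Ioc

lemma exists_norm_bound (hG : ContinuousOn G (Icc 0 T)) : ∃ C, ∀ t ∈ Icc 0 T, ‖G t‖ ≤ C :=
  isCompact_Icc.exists_bound_of_continuousOn hG

lemma norm_smoothing_integrand_le (hβ : 0 ≤ β) (hβ' : β ≤ 1) {C : ℝ} (hC : ∀ t ∈ Icc 0 T, ‖G t‖ ≤ C)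
    (ht : t ∈ Icc 0 T) {γ σ : ℝ} (hσ : σ ∈ Ioc (0 : ℝ) 1) :
    ‖kern γ σ • mulA (smoothing β (t * (1 - σ))) (G (t * σ))‖ ≤ kern γ σ * (2 * C) := by
  rw [norm_smul, Real.norm_eq_abs, abs_of_nonneg (kern_nonneg hσ)]
  refine mul_le_mul_of_nonneg_left ?_ (kern_nonneg hσ)
  refine (norm_mulA_le (measurable_smoothing _ _) (fun ρ hρ => abs_smoothing_le hβ hβ'
    (mul_nonneg ht.1 (sub_nonneg.2 hσ.2)) hρ) _).trans ?_
  gcongr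
  exact hC _ (mul_mem_Icc ht ⟨hσ.1.le, hσ.2⟩)

lemma integrable_smoothInt (hβ : 0 ≤ β) (hβ' : β ≤ 1) {γ : ℝ} (hγ : γ < 1) (hG : ContinuousOn G (Icc 0 T))
    (ht : t ∈ Icc 0 T) :
    Integrable (fun σ => kern γ σ • mulA (smoothing β (t * (1 - σ))) (G (t * σ)))
      (volume.restrict (Ioc 0 1)) := by
  obtain ⟨C, hC⟩ := exists_norm_bound hG
  refine ((integrable_kern hγ).mul_const (2 * C)).mono' (aestronglyMeasurable_smoothInt hβ hβ' hG ht γ) ?_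
  filter_upwards [ae_restrict_mem measurableSet_Ioc] with σ hσ
  exact norm_smoothing_integrand_le hβ hβ' hC ht hσ

lemma continuousOn_smoothInt (hβ : 0 ≤ β) (hβ' : β < 1) (hG : ContinuousOn G (Icc 0 T)) :
    ContinuousOn (smoothInt β G) (Icc 0 T) := by
  obtain ⟨C, hC⟩ := exists_norm_bound hG
  refine continuousOn_of_dominated (bound := fun σ => kern β σ * (2 * C))
    (fun t ht => aestronglyMeasurable_smoothInt hβ hβ'.le hG ht β) (fun t ht => ?_)
    ((integrable_kern hβ').mul_const _) ?_
  · filter_upwards [ae_restrict_mem measurableSet_Ioc] with σ hσ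
    exact norm_smoothing_integrand_le hβ hβ'.le hC ht hσ
  · filter_upwards [ae_restrict_mem measurableSet_Ioc] with σ hσ
    have h : ContinuousOn (fun t => mulA (smoothing β (t * (1 - σ))) (G (t * σ))) (Icc 0 T) := ?_
    · exact h.const_smul (kern β σ)
    refine continuousOn_mulA (m := fun t => smoothing β (t * (1 - σ))) (C := 2)
      (fun t _ => measurable_smoothing _ _) (fun t ht ρ hρ => abs_smoothing_le hβ hβ'.le
        (mul_nonneg ht.1 (sub_nonneg.2 hσ.2)) hρ) (fun ρ _ => ?_)
      (continuousOn_comp_mul hG ⟨hσ.1.le, hσ.2⟩)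
    exact ((continuous_smoothing hβ ρ).comp (by fun_prop : Continuous fun t : ℝ => t * (1 - σ))).continuousOn

lemma continuousOn_duh (hG : ContinuousOn G (Icc 0 T)) : ContinuousOn (duh G) (Icc 0 T) := by
  have h : Continuous fun t : ℝ => t ^ (1 / 4 : ℝ) := Real.continuous_rpow_const (by norm_num)
  exact h.continuousOn.smul (continuousOn_smoothInt le_rfl zero_lt_one hG)

lemma duh_zero : duh G 0 = 0 := by
  rw [duh, Real.zero_rpow (by norm_num), zero_smul]

lemma mulA_zero_symbol (f : VF) : mulA (fun _ => 0) f = 0 := by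
  refine (FunA.eq_mulA ⟨measurable_const, 0, by simp⟩ ?_).symm
  rw [FunA, fourierVF_zero]
  filter_upwards [Lp.coeFn_zero C3 2 (volume : Measure R3)] with ξ h
  rw [h]; simp

lemma smoothInt_at_zero (hβ : 0 < β) : smoothInt β G 0 = 0 := by
  have : ∀ σ : ℝ, mulA (smoothing β (0 * (1 - σ))) (G (0 * σ)) = 0 := by
    intro σ
    have : smoothing β (0 * (1 - σ)) = fun _ => 0 := by
      funext ρ
      rw [smoothing, zero_mul, Real.zero_rpow hβ.ne', zero_mul, zero_mul]
    rw [this, mulA_zero_symbol]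
  simp only [smoothInt, this, smul_zero, integral_zero]

lemma locBdd_rpow {a : ℝ} (ha : 0 ≤ a) : LocBdd fun ρ => ρ ^ a :=
  LocBdd.of_continuous (Real.continuous_rpow_const ha).continuousOn (by fun_prop)

lemma smoothing_mul_rpow {τ ρ : ℝ} (hτ : 0 < τ) :
    τ ^ (-β) * smoothing β τ ρ = ρ ^ (2 * β) * heat τ ρ := by
  rw [smoothing, ← mul_assoc, ← mul_assoc, ← Real.rpow_add hτ, neg_add_cancel, Real.rpow_zero, one_mul]

lemma smoothing_zero_left (τ ρ : ℝ) : smoothing 0 τ ρ = heat τ ρ := by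
  simp [smoothing]

lemma ae_Ioo_of_Ioc : ∀ᵐ σ ∂(volume.restrict (Ioc (0 : ℝ) 1)), σ ∈ Ioo (0 : ℝ) 1 := by
  rw [← Measure.restrict_congr_set (Ioo_ae_eq_Ioc (a := (0 : ℝ)) (b := 1))]
  exact ae_restrict_mem measurableSet_Ioo

lemma kern_eq {σ : ℝ} : kern β σ = kern 0 σ * (1 - σ) ^ (-β) := by
  simp [kern]

/-- The derivatives of order `2β` of the unit interval form of Duhamel's integral. -/
lemma funA_smoothInt (hβ : 0 ≤ β) (hβ' : β < 1) (hG : ContinuousOn G (Icc 0 T)) (ht : t ∈ Ioc 0 T) :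
    FunA (fun ρ => ρ ^ (2 * β)) (smoothInt 0 G t) (t ^ (-β) • smoothInt β G t) := by
  have ht' : t ∈ Icc 0 T := ⟨ht.1.le, ht.2⟩
  rw [smoothInt, smoothInt, ← integral_smul]
  refine FunA.integral (locBdd_rpow (by linarith)) (integrable_smoothInt le_rfl zero_le_one zero_lt_one hG ht')
    ((integrable_smoothInt hβ hβ'.le hβ' hG ht').smul (t ^ (-β))) ?_
  -- The endpoint σ = 1 is dropped, since the identity divides by a power of t(1-σ).
  filter_upwards [ae_Ioo_of_Ioc] with σ hσ
  have h1 : 0 < 1 - σ := sub_pos.2 hσ.2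
  have hτ : 0 < t * (1 - σ) := mul_pos ht.1 h1
  have h2 := (bddSymbol_smoothing le_rfl zero_le_one hτ.le).funA (G (t * σ))
  have h3 := ((bddSymbol_smoothing hβ hβ'.le hτ.le).funA (G (t * σ))).const_mul ((t * (1 - σ)) ^ (-β))
  have h4 := (FunA.cancel h2 (h3.congr (m' := fun ρ => ρ ^ (2 * β) * smoothing 0 (t * (1 - σ)) ρ)
    fun ρ _ => by rw [smoothing_mul_rpow hτ, smoothing_zero_left])).smul (kern 0 σ)
  convert h4 using 1
  rw [smul_smul, smul_smul, Real.mul_rpow ht.1.le h1.le, kern_eq (β := β)]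
  congr 1; ring

lemma funA_duh (hβ : 0 ≤ β) (hβ' : β < 1) (hG : ContinuousOn G (Icc 0 T)) (ht : t ∈ Ioc 0 T) :
    FunA (fun ρ => ρ ^ (2 * β)) (duh G t) (t ^ (1 / 4 - β) • smoothInt β G t) := by
  have := (funA_smoothInt hβ hβ' hG ht).smul (t ^ (1 / 4 : ℝ))
  rwa [smul_smul, ← Real.rpow_add ht.1, ← sub_eq_add_neg] at this

lemma funA_zero (m : ℝ → ℝ) : FunA m 0 0 := by
  rw [FunA, fourierVF_zero]
  filter_upwards [Lp.coeFn_zero C3 2 (volume : Measure R3)] with ξ h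
  rw [h]; simp

/-- The case β = 1/4 is the one in which the prefactor t^{1/4-β} disappears. -/
lemma continuousOn_half_duh (hG : ContinuousOn G (Icc 0 T)) :
    ContinuousOnA (fun _ ρ => ρ ^ (1 / 2 : ℝ)) (duh G) (Icc 0 T) := by
  refine ⟨smoothInt (1 / 4) G, continuousOn_smoothInt (by norm_num) (by norm_num) hG, fun t ht => ?_⟩
  rcases ht.1.eq_or_lt with rfl | h0
  · rw [duh_zero, smoothInt_at_zero (by norm_num)]
    exact funA_zero _
  · have := funA_duh (β := 1 / 4) (by norm_num) (by norm_num) hG ⟨h0, ht.2⟩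
    rw [sub_self, Real.rpow_zero, one_smul] at this
    convert this using 2; norm_num

/-- Here β = 5/8, so the prefactor is t^{-3/8}, which the critical factor t^{3/8} cancels. -/
lemma funA_five_fourths_duh (hG : ContinuousOn G (Icc 0 T)) (ht : t ∈ Icc 0 T) :
    FunA (fun ρ => ρ ^ (5 / 4 : ℝ)) (t ^ (3 / 8 : ℝ) • duh G t) (smoothInt (5 / 8) G t) := by
  rcases ht.1.eq_or_lt with rfl | h0
  · rw [duh_zero, smoothInt_at_zero (by norm_num), smul_zero]
    exact funA_zero _
  · have := (funA_duh (β := 5 / 8) (by norm_num) (by norm_num) hG ⟨h0, ht.2⟩).smul (t ^ (3 / 8 : ℝ))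
    rw [smul_smul, ← Real.rpow_add h0] at this
    norm_num at this
    exact this

/-- The weighted bound of Duhamel's integral. -/
lemma TimeWeight.normA_duh_le {lam : ℝ} {ω : ℝ → ℝ → ℝ} (hω : TimeWeight lam T ω) (hβ : 0 ≤ β) (hβ' : β < 1)
    (hG : ContinuousOn G (Icc 0 T)) {R κ : ℝ} (hR : 0 ≤ R) (hκ : 0 ≤ κ) (ht : t ∈ Ioc 0 T)
    (hb : ∀ s ∈ Icc 0 T, normA (ω s) (G s) ≤ ENNReal.ofReal (R * Real.exp (κ * s))) :
    normA (fun ρ => ρ ^ (2 * β) * ω t ρ) (duh G t) ≤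
      ENNReal.ofReal (t ^ (1 / 4 - β) * (heatConst lam * (R * Real.exp (κ * t)) * kernInt β (κ * t))) := by
  have ht' : t ∈ Icc 0 T := ⟨ht.1.le, ht.2⟩
  have hloc : LocBdd (ω t) := LocBdd.of_continuous (hω.continuous t ht').continuousOn
    (hω.admissible t ht').measurable
  have h1 : normA (fun ρ => ρ ^ (2 * β) * ω t ρ) (duh G t) =
      ENNReal.ofReal (t ^ (1 / 4 - β)) * normA (ω t) (smoothInt β G t) := by
    have h0 := funA_duh hβ hβ' hG ht
    have : normA (fun ρ => ρ ^ (2 * β) * ω t ρ) (duh G t) = normA (ω t) (t ^ (1 / 4 - β) • smoothInt β G t) := by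
      refine (eLpNorm_congr_ae ?_).symm
      filter_upwards [h0] with ξ hξ
      rw [hξ, smul_smul, mul_comm]
    rw [this, normA_smul, Real.enorm_eq_ofReal (Real.rpow_nonneg ht.1.le _)]
  rw [h1, ENNReal.ofReal_mul (Real.rpow_nonneg ht.1.le _)]
  gcongr
  have hx : 0 ≤ κ * t := mul_nonneg hκ ht.1.le
  have hc := (heatConst_pos lam).le
  rw [kernInt, ← integral_const_mul]
  refine normA_integral_le hloc (hω.admissible t ht').measurable
    (integrable_smoothInt hβ hβ'.le hβ' hG ht') ((integrable_kern_exp hβ' hx).const_mul _) ?_ ?_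
  · filter_upwards [ae_restrict_mem measurableSet_Ioc] with σ hσ
    have := kern_nonneg (β := β) hσ
    positivity
  · filter_upwards [ae_restrict_mem measurableSet_Ioc] with σ hσ
    have hτ : 0 ≤ t * (1 - σ) := mul_nonneg ht.1.le (sub_nonneg.2 hσ.2)
    have hk := kern_nonneg (β := β) hσ
    have h2 : normA (ω t) (mulA (smoothing β (t * (1 - σ))) (G (t * σ))) =
        normA (fun ρ => 1 * (smoothing β (t - t * σ) ρ * ω t ρ)) (G (t * σ)) := by
      refine eLpNorm_congr_ae ?_
      filter_upwards [(bddSymbol_smoothing hβ hβ'.le hτ).funA (G (t * σ))] with ξ hξ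
      rw [hξ, smul_smul, one_mul, mul_comm, show t - t * σ = t * (1 - σ) by ring]
    have h3 := mul_mem_Icc ht' ⟨hσ.1.le, hσ.2⟩
    rw [normA_smul, Real.enorm_eq_ofReal hk, h2]
    calc _ ≤ ENNReal.ofReal (kern β σ) * (ENNReal.ofReal (heatConst lam) *
            ENNReal.ofReal (R * Real.exp (κ * (t * σ)))) := by
          gcongr
          refine (hω.normA_smoothing_le hβ hβ'.le h3.1 (by nlinarith [ht.1, hσ.2]) ht.2 _ _).trans ?_
          simp only [one_mul]
          gcongr
          exact hb _ h3
      _ = _ := by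
          rw [← ENNReal.ofReal_mul hc, ← ENNReal.ofReal_mul hk]
          congr 1
          -- Factoring out the growth at the final time leaves the damping that defines `kernInt` at
          -- κt.
          have : Real.exp (κ * (t * σ)) = Real.exp (κ * t) * Real.exp (-(κ * t * (1 - σ))) := by
            rw [← Real.exp_add]; ring_nf
          rw [this]; ring

/-- The rescaling of Duhamel's integral. -/
lemma integral_heat_eq_duh {a h : ℝ} (hh : 0 < h) (f : ℝ → VF) :
    ∫ s in a..(a + h), mulA (heat (a + h - s)) (f s) = duh (fun s => s ^ (3 / 4 : ℝ) • f (a + s)) h := by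
  have h1 := intervalIntegral.smul_integral_comp_add_mul (fun s => mulA (heat (a + h - s)) (f s)) h a
    (a := 0) (b := 1)
  rw [mul_zero, add_zero, mul_one] at h1
  rw [← h1, duh, smoothInt, intervalIntegral.integral_of_le zero_le_one, ← integral_smul, ← integral_smul]
  refine setIntegral_congr_fun measurableSet_Ioc fun σ hσ => ?_
  have e1 : smoothing 0 (h * (1 - σ)) = heat (a + h - (a + h * σ)) := by
    funext ρ; rw [smoothing_zero_left]; congr 1; ring
  rw [e1, map_smul, smul_smul, smul_smul, kern, neg_zero, Real.rpow_zero, mul_one,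
    Real.mul_rpow hh.le hσ.1.le]
  congr 1
  have e2 : h ^ (1 / 4 : ℝ) * h ^ (3 / 4 : ℝ) = h := by
    rw [← Real.rpow_add hh]; norm_num
  have e3 : σ ^ (-(3 / 4) : ℝ) * σ ^ (3 / 4 : ℝ) = 1 := by
    rw [← Real.rpow_add hσ.1]; norm_num
  linear_combination (-1 : ℝ) * e2 - h ^ (1 / 4 : ℝ) * h ^ (3 / 4 : ℝ) * e3

end Duh

end

section

/-! ### The fibered projection -/

section Projection

variable {P : VF →L[ℝ] VF}

lemma IsFiberedProjection.funA (hP : IsFiberedProjection P) {m : ℝ → ℝ} {f g : VF} (h : FunA m f g) :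
    FunA m (P f) (P g) := by
  obtain ⟨p, -, hp⟩ := hP.fibered
  filter_upwards [h, hp f, hp g] with ξ h1 h2 h3
  rw [h3, h2, h1, RCLike.real_smul_eq_coe_smul (K := ℂ), RCLike.real_smul_eq_coe_smul (K := ℂ), map_smul]

lemma IsFiberedProjection.proj_proj (hP : IsFiberedProjection P) (f : VF) : P (P f) = P f :=
  congrArg (fun Q : VF →L[ℝ] VF => Q f) hP.isStarProjection.isIdempotentElem

lemma IsFiberedProjection.norm_le (hP : IsFiberedProjection P) (f : VF) : ‖P f‖ ≤ ‖f‖ := by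
  refine (P.le_opNorm f).trans (mul_le_of_le_one_left (norm_nonneg _) hP.isStarProjection.norm_le)

lemma IsFiberedProjection.normA_le (hP : IsFiberedProjection P) {m : ℝ → ℝ} (hm : Measurable m) (f : VF) :
    normA m (P f) ≤ normA m f := by
  rcases eq_or_ne (normA m f) ∞ with h | h
  · rw [h]; exact le_top
  · obtain ⟨g, hg⟩ := exists_funA hm h.lt_top
    rw [hg.normA_eq, (hP.funA hg).normA_eq, ← ofReal_norm, ← ofReal_norm]
    exact ENNReal.ofReal_le_ofReal (hP.norm_le g)

lemma IsFiberedProjection.mulA_comm (hP : IsFiberedProjection P) {m : ℝ → ℝ} (hm : BddSymbol m) (f : VF) :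
    P (mulA m f) = mulA m (P f) :=
  (hP.funA (hm.funA f)).eq_mulA hm

lemma IsFiberedProjection.duh (hP : IsFiberedProjection P) {T t : ℝ} {G : ℝ → VF}
    (hG : ContinuousOn G (Icc 0 T)) (ht : t ∈ Icc 0 T) (hPG : ∀ s ∈ Icc 0 T, P (G s) = G s) :
    P (duh G t) = duh G t := by
  rw [NavierStokes.duh, map_smul, smoothInt,
    ← P.integral_comp_comm (integrable_smoothInt le_rfl zero_le_one zero_lt_one hG ht)]
  congr 1
  refine setIntegral_congr_fun measurableSet_Ioc fun σ hσ => ?_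
  rw [map_smul, hP.mulA_comm (bddSymbol_smoothing le_rfl zero_le_one
    (mul_nonneg ht.1 (sub_nonneg.2 hσ.2))), hPG _ (mul_mem_Icc ht ⟨hσ.1.le, hσ.2⟩)]

end Projection

/-! ### Scaling and continuity of the convection term -/

section Conv

variable {M : Matrix (Fin 3) (Fin 3) ℝ}

lemma InDom.smul {f : VF} (hf : InDom f) (c : ℝ) : InDom (c • f) := by
  rw [InDom, normA_smul]; exact ENNReal.mul_lt_top enorm_lt_top hf

lemma IsWeakPartial.smul {j : Fin 3} {f D : VF} (h : IsWeakPartial j f D) (c : ℝ) :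
    IsWeakPartial j (c • f) (c • D) := by
  intro φ
  have h1 := h φ
  rw [← inner_toLp, ← inner_toLp] at h1 ⊢
  rw [real_inner_smul_left, real_inner_smul_left, h1, mul_neg]

lemma IsProduct.smul {f g N : VF} (h : IsProduct M f g N) (a b : ℝ) :
    IsProduct M (a • f) (b • g) ((a * b) • N) := by
  obtain ⟨D, hD, hN⟩ := h
  refine ⟨fun j => b • D j, fun j => (hD j).smul b, ?_⟩
  have h3 : ∀ᵐ x, ∀ j, (b • D j) x = b • D j x := ae_all_iff.2 fun j => Lp.coeFn_smul b (D j)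
  filter_upwards [hN, h3, Lp.coeFn_smul a f, Lp.coeFn_smul (a * b) N] with x h1 h2 h4 h5
  have h6 : (fun i => (a • f) x i) = a • fun i => f x i := by
    rw [h4]; rfl
  rw [h5, Pi.smul_apply, h1, Finset.smul_sum, h6]
  refine Finset.sum_congr rfl fun j _ => ?_
  rw [h2, Matrix.mulVec_smul, Pi.smul_apply, smul_smul, smul_smul, smul_eq_mul]
  congr 1; ring

lemma conv_smul {f g : VF} (hf : InDom f) (hg : InDom g) (a b : ℝ) :
    conv M (a • f) (b • g) = (a * b) • conv M f g :=
  (conv_isProduct (hf.smul a) (hg.smul b)).unique ((conv_isProduct hf hg).smul a b)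

lemma continuousOn_conv {f g F G : ℝ → VF} {s : Set ℝ} (hf : ∀ t ∈ s, FunA (fun ρ => ρ ^ (5 / 4 : ℝ)) (f t) (F t))
    (hg : ∀ t ∈ s, FunA (fun ρ => ρ ^ (5 / 4 : ℝ)) (g t) (G t)) (hF : ContinuousOn F s) (hG : ContinuousOn G s) :
    ContinuousOn (fun t => conv M (f t) (g t)) s := by
  intro t₀ ht₀
  rw [ContinuousWithinAt, tendsto_iff_norm_sub_tendsto_zero]
  have h1 : Tendsto (fun t => prodConst M * ‖F t - F t₀‖ * ‖G t‖ + prodConst M * ‖F t₀‖ * ‖G t - G t₀‖)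
      (𝓝[s] t₀) (𝓝 0) := by
    have e1 : Tendsto (fun t => ‖F t - F t₀‖) (𝓝[s] t₀) (𝓝 0) := tendsto_iff_norm_sub_tendsto_zero.1 (hF t₀ ht₀)
    have e2 : Tendsto (fun t => ‖G t - G t₀‖) (𝓝[s] t₀) (𝓝 0) := tendsto_iff_norm_sub_tendsto_zero.1 (hG t₀ ht₀)
    have := ((e1.const_mul (prodConst M)).mul (hG t₀ ht₀).norm).add (e2.const_mul (prodConst M * ‖F t₀‖))
    simpa using this
  refine squeeze_zero' (Eventually.of_forall fun _ => norm_nonneg _) ?_ h1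
  filter_upwards [self_mem_nhdsWithin] with t ht
  have e : conv M (f t) (g t) - conv M (f t₀) (g t₀) =
      conv M (f t - f t₀) (g t) + conv M (f t₀) (g t - g t₀) := by
    rw [conv_sub_left (hf t ht).inDom (hf t₀ ht₀).inDom (hg t ht).inDom,
      conv_sub_right (hf t₀ ht₀).inDom (hg t ht).inDom (hg t₀ ht₀).inDom]
    abel
  rw [e]
  exact (norm_add_le _ _).trans (add_le_add (norm_conv_le ((hf t ht).sub (hf t₀ ht₀)) (hg t ht))
    (norm_conv_le (hf t₀ ht₀) ((hg t ht).sub (hg t₀ ht₀))))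

end Conv

/-! ### Mild solutions are weak solutions -/

section Mild

variable {T t : ℝ} {G : ℝ → VF} {w₀ : VF}

lemma continuousOn_cutHeat_neg (hG : ContinuousOn G (Icc 0 T)) (n : ℕ) :
    ContinuousOn (fun s => cutHeat n (-s) (G s)) (Icc 0 T) :=
  ((continuous_cutHeat n).comp continuous_neg).continuousOn.clm_apply hG

lemma intervalIntegrable_rpow_smul {E : Type*} [NormedAddCommGroup E] [NormedSpace ℝ E] {g : ℝ → E}
    (hg : ContinuousOn g (Icc 0 T)) (ht : t ∈ Icc 0 T) :
    IntervalIntegrable (fun s => s ^ (-(3 / 4) : ℝ) • g s) volume 0 t :=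
  (intervalIntegral.intervalIntegrable_rpow' (by norm_num)).smul_continuousOn
    (hg.mono (by rw [uIcc_of_le ht.1]; exact Icc_subset_Icc_right ht.2))

/-- Undoing the heat flow on bounded frequencies leaves an integral in which t occurs only as the
upper limit, and which can be differentiated directly. -/
lemma cutHeat_duh (hG : ContinuousOn G (Icc 0 T)) (ht : t ∈ Ioc 0 T) (n : ℕ) :
    cutHeat n (-t) (duh G t) = ∫ s in 0..t, s ^ (-(3 / 4) : ℝ) • cutHeat n (-s) (G s) := by
  have h1 := intervalIntegral.smul_integral_comp_mul_left (fun s => s ^ (-(3 / 4) : ℝ) • cutHeat n (-s) (G s)) t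
    (a := 0) (b := 1)
  rw [mul_zero, mul_one] at h1
  rw [← h1, duh, smoothInt, map_smul, intervalIntegral.integral_of_le zero_le_one,
    ← (cutHeat n (-t)).integral_comp_comm
      (integrable_smoothInt le_rfl zero_le_one zero_lt_one hG ⟨ht.1.le, ht.2⟩), ← integral_smul, ← integral_smul]
  refine setIntegral_congr_fun measurableSet_Ioc fun σ hσ => ?_
  have hτ : 0 ≤ t * (1 - σ) := mul_nonneg ht.1.le (sub_nonneg.2 hσ.2)
  have e1 : cutHeat n (-t) (mulA (smoothing 0 (t * (1 - σ))) (G (t * σ))) = cutHeat n (-(t * σ)) (G (t * σ)) := by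
    refine mulA_comp_eq (locBdd_heat _ n) (bddSymbol_smoothing le_rfl zero_le_one hτ) (locBdd_heat _ n)
      (fun ρ _ => ?_) _
    simp only [trunc]
    split_ifs
    · rw [smoothing_zero_left, ← heat_add]; congr 1; ring
    · rw [zero_mul]
  rw [map_smul, e1, smul_smul, smul_smul, kern, neg_zero, Real.rpow_zero, mul_one,
    Real.mul_rpow ht.1.le hσ.1.le, ← mul_assoc]
  congr 2
  nth_rewrite 2 [← Real.rpow_one t]
  rw [← Real.rpow_add ht.1]; norm_num

/-- The product rule for e^{-tA²}y(t), where y is the primitive obtained by undoing the heat flow.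
-/
lemma hasDerivAt_cut_mild (hG : ContinuousOn G (Icc 0 T)) (ht : t ∈ Ioo 0 T) (n : ℕ) :
    HasDerivAt (fun t => cut n (mulA (heat t) w₀ - duh G t))
      (-(cutSq n (mulA (heat t) w₀ - duh G t) + cut n (t ^ (-(3 / 4) : ℝ) • G t))) t := by
  set y : ℝ → VF := fun t => cut n w₀ - ∫ s in 0..t, s ^ (-(3 / 4) : ℝ) • cutHeat n (-s) (G s) with hy
  have hy1 : ∀ s ∈ Ioc 0 T, cutHeat n s (y s) = cut n (mulA (heat s) w₀ - duh G s) := by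
    intro s hs
    rw [hy]
    simp only
    rw [← cutHeat_duh hG hs, map_sub, map_sub, cutHeat_cut, cut_heat hs.1.le, cutHeat_cutHeat, add_neg_cancel,
      cutHeat_zero]
  have hc := continuousOn_cutHeat_neg hG n
  have hy2 : HasDerivAt y (-(t ^ (-(3 / 4) : ℝ) • cutHeat n (-t) (G t))) t := by
    refine HasDerivAt.const_sub _ (intervalIntegral.integral_hasDerivAt_right
      (intervalIntegrable_rpow_smul hc ⟨ht.1.le, ht.2.le⟩) ?_ ?_)
    · have : ContinuousOn (fun s => s ^ (-(3 / 4) : ℝ) • cutHeat n (-s) (G s)) (Ioo 0 T) := by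
        have h : ContinuousOn (fun s : ℝ => s ^ (-(3 / 4) : ℝ)) (Ioo 0 T) := fun s hs =>
          (Real.continuousAt_rpow_const s _ (Or.inl hs.1.ne')).continuousWithinAt
        exact h.smul (hc.mono Ioo_subset_Icc_self)
      exact this.stronglyMeasurableAtFilter isOpen_Ioo t ht
    · exact (Real.continuousAt_rpow_const t _ (Or.inl ht.1.ne')).smul
        (hc.continuousAt (Icc_mem_nhds ht.1 ht.2))
  have h3 := (hasDerivAt_cutHeat n t).clm_apply hy2
  refine (h3.congr_of_eventuallyEq ?_).congr_deriv ?_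
  · filter_upwards [Ioc_mem_nhds ht.1 ht.2] with s hs
    exact (hy1 s hs).symm
  · rw [neg_apply, ContinuousLinearMap.comp_apply, hy1 t ⟨ht.1, ht.2.le⟩, cutSq_cut, map_neg, map_smul,
      cutHeat_cutHeat, add_neg_cancel, cutHeat_zero, map_smul, neg_add]

lemma continuousOn_mild (hG : ContinuousOn G (Icc 0 T)) :
    ContinuousOn (fun t => mulA (heat t) w₀ - duh G t) (Icc 0 T) := by
  refine ContinuousOn.sub (continuousOn_mulA (m := heat) (C := 1) (fun _ _ => measurable_heat _)
    (fun t ht ρ _ => abs_heat_le_one ht.1 ρ) (fun ρ _ => ?_) continuousOn_const) (continuousOn_duh hG)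
  unfold heat; fun_prop

lemma cutSq_toLp (n : ℕ) (φ : 𝓢(R3, R3)) : cutSq n (φ.toLp 2) = -cut n ((Δ φ).toLp 2) := by
  have h := (funA_laplacian φ).comp ((bddSymbol_cut n).funA _)
  have h2 := h.const_mul (-1)
  rw [cutSq, ← (h2.congr fun ρ _ => ?_).eq_mulA (locBdd_sq n), neg_smul, one_smul, cut]
  simp only [trunc]; split_ifs <;> simp

lemma continuousOn_rpow_smul (hG : ContinuousOn G (Icc 0 T)) {a b : ℝ} (ha : 0 < a) (hb : b ≤ T) :
    ContinuousOn (fun t => t ^ (-(3 / 4) : ℝ) • G t) (Icc a b) := by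
  have h : ContinuousOn (fun s : ℝ => s ^ (-(3 / 4) : ℝ)) (Icc a b) := fun s hs =>
    (Real.continuousAt_rpow_const s _ (Or.inl (ha.trans_le hs.1).ne')).continuousWithinAt
  exact h.smul (hG.mono (Icc_subset_Icc ha.le hb))

lemma inner_cut_sub {w f : ℝ → VF} {a b : ℝ} (hab : a ≤ b) (hw : ContinuousOn w (Icc a b))
    (hf : ContinuousOn f (Icc a b)) {n : ℕ}
    (h : ∀ s ∈ Ioo a b, HasDerivAt (fun s => cut n (w s)) (-(cutSq n (w s) + cut n (f s))) s) (φ : 𝓢(R3, R3)) :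
    inner ℝ (cut n (w b - w a)) (φ.toLp 2 : VF) =
      inner ℝ (cut n (∫ s in a..b, w s)) ((Δ φ).toLp 2 : VF) - inner ℝ (cut n (∫ s in a..b, f s)) (φ.toLp 2 : VF) := by
  have i1 : ContinuousOn (fun s => cutSq n (w s)) (Icc a b) := (cutSq n).continuous.comp_continuousOn hw
  have i2 : ContinuousOn (fun s => cut n (f s)) (Icc a b) := (cut n).continuous.comp_continuousOn hf
  have h2 := intervalIntegral.integral_eq_sub_of_hasDerivAt_of_le hab
    ((cut n).continuous.comp_continuousOn hw) h ((i1.add i2).neg.intervalIntegrable_of_Icc hab)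
  rw [intervalIntegral.integral_neg, intervalIntegral.integral_add (i1.intervalIntegrable_of_Icc hab)
    (i2.intervalIntegrable_of_Icc hab), (cutSq n).intervalIntegral_comp_comm (hw.intervalIntegrable_of_Icc hab),
    (cut n).intervalIntegral_comp_comm (hf.intervalIntegrable_of_Icc hab)] at h2
  rw [map_sub]
  refine (congrArg (fun x : VF => inner ℝ x (φ.toLp 2 : VF)) h2.symm).trans ?_
  rw [inner_neg_left, inner_add_left, cutSq, inner_mulA (locBdd_sq n), ← cutSq, cutSq_toLp,
    inner_neg_right, cut, inner_mulA (bddSymbol_cut n) (∫ s in a..b, w s)]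
  ring

lemma tendsto_inner_cut (f g : VF) : Tendsto (fun n => inner ℝ (cut n f) g) atTop (𝓝 (inner ℝ f g)) :=
  (tendsto_cut f).inner tendsto_const_nhds

/-- The truncation is removed in the time-integrated equation, where A² has been moved to the test
function, so that only strong convergence of `cut` is needed. -/
lemma inner_sub_eq_of_cut {w f : ℝ → VF} {a b : ℝ} (hab : a ≤ b) (hw : ContinuousOn w (Icc a b))
    (hf : ContinuousOn f (Icc a b))
    (h : ∀ n, ∀ s ∈ Ioo a b, HasDerivAt (fun s => cut n (w s)) (-(cutSq n (w s) + cut n (f s))) s) (φ : 𝓢(R3, R3)) :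
    inner ℝ (w b - w a) (φ.toLp 2 : VF) =
      inner ℝ (∫ s in a..b, w s) ((Δ φ).toLp 2 : VF) - inner ℝ (∫ s in a..b, f s) (φ.toLp 2 : VF) := by
  have h1 := (tendsto_inner_cut (∫ s in a..b, w s) ((Δ φ).toLp 2)).sub
    (tendsto_inner_cut (∫ s in a..b, f s) (φ.toLp 2))
  have h2 := tendsto_inner_cut (w b - w a) (φ.toLp 2)
  have h3 := fun n => inner_cut_sub hab hw hf (h n) φ
  simp only [h3] at h2
  exact tendsto_nhds_unique h2 h1

lemma inner_mild_sub {w f : ℝ → VF} (hw : w = fun t => mulA (heat t) w₀ - duh G t)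
    (hf : f = fun t => t ^ (-(3 / 4) : ℝ) • G t) (hG : ContinuousOn G (Icc 0 T)) {a b : ℝ} (ha : 0 < a) (hab : a ≤ b)
    (hb : b ≤ T) (φ : 𝓢(R3, R3)) :
    inner ℝ (w b - w a) (φ.toLp 2 : VF) =
      ∫ s in a..b, (inner ℝ (w s) ((Δ φ).toLp 2 : VF) - inner ℝ (f s) (φ.toLp 2 : VF)) := by
  have hwc : ContinuousOn w (Icc a b) := by
    rw [hw]; exact (continuousOn_mild hG).mono (Icc_subset_Icc ha.le hb)
  have hfc : ContinuousOn f (Icc a b) := by rw [hf]; exact continuousOn_rpow_smul hG ha hb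
  have h1 : ∀ n, ∀ s ∈ Ioo a b, HasDerivAt (fun s => cut n (w s)) (-(cutSq n (w s) + cut n (f s))) s := by
    subst hw hf
    exact fun n s hs => hasDerivAt_cut_mild hG ⟨ha.trans hs.1, hs.2.trans_le hb⟩ n
  have e1 := integral_inner_const (hwc.intervalIntegrable_of_Icc hab) ((Δ φ).toLp 2)
  have e2 := integral_inner_const (hfc.intervalIntegrable_of_Icc hab) (φ.toLp 2)
  rw [inner_sub_eq_of_cut hab hwc hfc h1, ← e1, ← e2]
  exact (intervalIntegral.integral_sub ((hwc.inner continuousOn_const).intervalIntegrable_of_Icc hab)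
    ((hfc.inner continuousOn_const).intervalIntegrable_of_Icc hab)).symm

/-- A mild solution of the heat equation with a source is a weak solution. -/
lemma hasDerivWithinAt_mild {w f : ℝ → VF} (hw : w = fun t => mulA (heat t) w₀ - duh G t)
    (hf : f = fun t => t ^ (-(3 / 4) : ℝ) • G t) (hG : ContinuousOn G (Icc 0 T)) (φ : 𝓢(R3, R3)) (ht : t ∈ Ioc 0 T) :
    HasDerivWithinAt (fun s => inner ℝ (w s) (φ.toLp 2 : VF))
      (inner ℝ (w t) ((Δ φ).toLp 2 : VF) - inner ℝ (f t) (φ.toLp 2 : VF)) (Ioc 0 T) t := by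
  -- Starting at a positive time avoids the singularity of the source at 0.
  set a := t / 2
  have ha : 0 < a := half_pos ht.1
  have hat : a < t := half_lt_self ht.1
  have hsub : Icc a T ⊆ Icc 0 T := Icc_subset_Icc_left ha.le
  have hwc : ContinuousOn w (Icc a T) := by rw [hw]; exact (continuousOn_mild hG).mono hsub
  have hfc : ContinuousOn f (Icc a T) := by rw [hf]; exact continuousOn_rpow_smul hG ha le_rfl
  have hg : ContinuousOn (fun s => inner ℝ (w s) ((Δ φ).toLp 2 : VF) - inner ℝ (f s) (φ.toLp 2 : VF)) (Icc a T) :=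
    (hwc.inner continuousOn_const).sub (hfc.inner continuousOn_const)
  have htm : t ∈ Icc a T := ⟨hat.le, ht.2⟩
  have : Fact (t ∈ Icc a T) := ⟨htm⟩
  have h1 := (intervalIntegral.integral_hasDerivWithinAt_right (s := Icc a T) (t := Icc a T)
    ((hg.mono (Icc_subset_Icc_right ht.2)).intervalIntegrable_of_Icc hat.le)
    (hg.stronglyMeasurableAtFilter_nhdsWithin measurableSet_Icc t) (hg t htm)).const_add
      (inner ℝ (w a) (φ.toLp 2 : VF))
  refine (h1.congr (fun s hs => ?_) ?_).mono_of_mem_nhdsWithin ?_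
  · rw [← inner_mild_sub hw hf hG ha hs.1 hs.2, inner_sub_left]; ring
  · rw [← inner_mild_sub hw hf hG ha hat.le ht.2, inner_sub_left]; ring
  · filter_upwards [self_mem_nhdsWithin, mem_nhdsWithin_of_mem_nhds (Ioi_mem_nhds hat)] with s h2 h3
    exact ⟨h3.le, h2.2⟩

end Mild

end

section

/-! ### Strong solutions -/

lemma FunA.of_const_mul {m : ℝ → ℝ} {c : ℝ} {f g : VF} (h : FunA (fun ρ => c * m ρ) f g) : FunA m (c • f) g := by
  rw [FunA, fourierVF_smul]
  filter_upwards [h, Lp.coeFn_smul c (fourierVF f)] with ξ h1 h2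
  rw [h2, Pi.smul_apply, h1, smul_smul, mul_comm]

lemma FunA.to_const_mul {m : ℝ → ℝ} {c : ℝ} {f g : VF} (h : FunA m (c • f) g) : FunA (fun ρ => c * m ρ) f g := by
  rw [FunA, fourierVF_smul] at h
  filter_upwards [h, Lp.coeFn_smul c (fourierVF f)] with ξ h1 h2
  rw [h1, h2, Pi.smul_apply, smul_smul, mul_comm]

/-- The function `t ↦ t^{3/8} A^{5/4} u(t)` is given by `X` on `]0, T]`, and `X` is continuous on `[0, T]`,
with `X(0) = 0`. -/
structure CriticalPath (T : ℝ) (u X : ℝ → VF) : Prop where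
  funA : ∀ t ∈ Icc 0 T, FunA (fun ρ => ρ ^ (5 / 4 : ℝ)) (t ^ (3 / 8 : ℝ) • u t) (X t)
  continuousOn : ContinuousOn X (Icc 0 T)
  zero : X 0 = 0

section Critical

variable {T : ℝ} {u X : ℝ → VF}

/-- The limit condition at 0 says exactly that extension by zero is continuous; on [0, T]
compactness then becomes available. -/
lemma MemB0.exists_criticalPath (h : MemB0 (3 / 8) (5 / 4) T u) : ∃ X, CriticalPath T u X := by
  obtain ⟨U, hU, hc, -, hlim⟩ := h
  classical
  refine ⟨Function.update U 0 0, fun t ht => ?_, fun t ht => ?_, Function.update_self _ _ _⟩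
  · rcases ht.1.eq_or_lt with rfl | h0
    · rw [Function.update_self, Real.zero_rpow (by norm_num), zero_smul]
      exact funA_zero _
    · rw [Function.update_of_ne h0.ne']
      exact (hU t ⟨h0, ht.2⟩).of_const_mul
  · rcases ht.1.eq_or_lt with rfl | h0
    · have h1 : Icc 0 T = insert 0 (Ioc 0 T) := (Ioc_insert_left (ht.1.trans ht.2)).symm
      rw [ContinuousWithinAt, h1, nhdsWithin_insert, Function.update_self]
      refine Tendsto.sup ?_ ?_
      · rw [tendsto_pure_left]
        intro s hs
        rw [Function.update_self]
        exact mem_of_mem_nhds hs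
      · refine (tendsto_zero_iff_norm_tendsto_zero.2 hlim).congr' ?_
        filter_upwards [self_mem_nhdsWithin] with s hs
        rw [Function.update_of_ne hs.1.ne']
    · have h2 : ContinuousWithinAt U (Icc 0 T) t :=
        (hc t ⟨h0, ht.2⟩).mono_of_mem_nhdsWithin (by
          filter_upwards [self_mem_nhdsWithin, mem_nhdsWithin_of_mem_nhds (Ioi_mem_nhds h0)] with s h2 h3
          exact ⟨h3, h2.2⟩)
      refine h2.congr_of_eventuallyEq ?_ (Function.update_of_ne h0.ne' _ _)
      filter_upwards [mem_nhdsWithin_of_mem_nhds (Ioi_mem_nhds h0)] with s h3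
      exact Function.update_of_ne (ne_of_gt h3) _ _

lemma CriticalPath.memB0 (h : CriticalPath T u X) (hT : 0 < T) : MemB0 (3 / 8) (5 / 4) T u := by
  refine ⟨X, fun t ht => (h.funA t ⟨ht.1.le, ht.2⟩).to_const_mul, h.continuousOn.mono Ioc_subset_Icc_self, ?_, ?_⟩
  · obtain ⟨C, hC⟩ := exists_norm_bound h.continuousOn
    exact ⟨C, fun t ht => hC t ⟨ht.1.le, ht.2⟩⟩
  · have := (h.continuousOn 0 ⟨le_rfl, hT.le⟩).norm
    rw [ContinuousWithinAt, h.zero, norm_zero] at this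
    exact this.mono_left (nhdsWithin_mono _ Ioc_subset_Icc_self)

lemma inDom_of_smul {f : VF} {c : ℝ} (hc : c ≠ 0) (h : InDom (c • f)) : InDom f := by
  simpa [smul_smul, inv_mul_cancel₀ hc] using h.smul c⁻¹

lemma CriticalPath.inDom (h : CriticalPath T u X) {t : ℝ} (ht : t ∈ Ioc 0 T) : InDom (u t) :=
  inDom_of_smul (Real.rpow_pos_of_pos ht.1 _).ne' (h.funA t ⟨ht.1.le, ht.2⟩).inDom

lemma CriticalPath.exists_small (h : CriticalPath T u X) (hT : 0 < T) {ε : ℝ} (hε : 0 < ε) :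
    ∃ τ, 0 < τ ∧ ∀ t ∈ Icc 0 T, t ≤ τ → ‖X t‖ ≤ ε := by
  have h1 := (h.continuousOn 0 ⟨le_rfl, hT.le⟩)
  rw [Metric.continuousWithinAt_iff] at h1
  obtain ⟨δ, hδ, h2⟩ := h1 ε hε
  refine ⟨δ / 2, half_pos hδ, fun t ht hτ => ?_⟩
  have := h2 ht (by rw [Real.dist_eq, sub_zero, abs_of_nonneg ht.1]; linarith)
  rw [h.zero, dist_zero_right] at this
  exact this.le

variable {M : Matrix (Fin 3) (Fin 3) ℝ} {P : VF →L[ℝ] VF}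

lemma CriticalPath.continuousOn_conv (h : CriticalPath T u X) :
    ContinuousOn (fun t => P (conv M (u t) (u t))) (Ioc 0 T) := by
  have h1 : ContinuousOn (fun t => (t ^ (-(3 / 4) : ℝ)) • P (conv M (t ^ (3 / 8 : ℝ) • u t) (t ^ (3 / 8 : ℝ) • u t))) (Ioc 0 T) := by
    have h2 : ContinuousOn (fun s : ℝ => s ^ (-(3 / 4) : ℝ)) (Ioc 0 T) := fun s hs =>
      (Real.continuousAt_rpow_const s _ (Or.inl hs.1.ne')).continuousWithinAt
    exact h2.smul (P.continuous.comp_continuousOn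
      ((NavierStokes.continuousOn_conv h.funA h.funA h.continuousOn h.continuousOn).mono Ioc_subset_Icc_self))
  refine h1.congr fun t ht => ?_
  simp only
  rw [conv_smul (h.inDom ht) (h.inDom ht), map_smul, smul_smul, ← Real.rpow_add ht.1, ← Real.rpow_add ht.1]
  norm_num

/-- Strong solutions are weak solutions of the heat equation with source `P (M u · ∇) u`. -/
lemma IsStrongSolution.weakHeat (hu : IsStrongSolution M P (1 / 2) T u) (hX : CriticalPath T u X) :
    WeakHeat u (fun t => P (conv M (u t) (u t))) 0 T := by
  obtain ⟨N, hN, heq⟩ := hu.equation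
  intro φ t ht
  have h1 := ((heq φ).2 t ⟨ht.1, ht.2.le⟩).hasDerivAt (Ioc_mem_nhds ht.1 ht.2)
  rw [(hN t ⟨ht.1, ht.2.le⟩).unique (conv_isConvection (hX.inDom ⟨ht.1, ht.2.le⟩))] at h1
  simpa only [inner_toLp] using h1

lemma continuousOn_of_sobolev {r : ℝ} (hr : 0 ≤ r) {s : Set ℝ} (hu : ContinuousOnA (fun _ => symInhom r 0) u s) :
    ContinuousOn u s := by
  obtain ⟨U, hU, hf⟩ := hu
  have hsym : ∀ ρ : ℝ, 1 ≤ symInhom r 0 ρ := fun ρ => by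
    rw [symInhom, zero_mul, Real.exp_zero, mul_one]
    exact Real.one_le_rpow (by nlinarith [sq_nonneg ρ]) (by linarith)
  have hb : BddSymbol fun ρ => (symInhom r 0 ρ)⁻¹ := by
    refine ⟨by unfold symInhom; fun_prop, 1, fun ρ _ => ?_⟩
    rw [abs_of_nonneg (inv_nonneg.2 (zero_le_one.trans (hsym ρ)))]
    exact inv_le_one_of_one_le₀ (hsym ρ)
  refine ((mulA fun ρ => (symInhom r 0 ρ)⁻¹).continuous.comp_continuousOn hU).congr fun t ht => ?_
  refine ((funA_one (u t)).congr (m' := fun ρ => (symInhom r 0 ρ)⁻¹ * symInhom r 0 ρ) fun ρ _ => ?_).unique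
    ((hf t ht).comp (hb.funA (U t)))
  rw [inv_mul_cancel₀ (zero_lt_one.trans_le (hsym ρ)).ne']

/-- The factor s^{3/4} is inserted only to match the singular kernel built into `duh`; for a > 0 the
shifted source itself is not singular. -/
lemma continuousOn_shift {f : ℝ → VF} (hf : ContinuousOn f (Ioc 0 T)) {a : ℝ} (ha : 0 < a) :
    ContinuousOn (fun s => s ^ (3 / 4 : ℝ) • f (a + s)) (Icc 0 (T - a)) := by
  have h : Continuous fun s : ℝ => s ^ (3 / 4 : ℝ) := Real.continuous_rpow_const (by norm_num)
  exact h.continuousOn.smul (hf.comp (by fun_prop) fun s hs => ⟨by linarith [hs.1], by linarith [hs.2]⟩)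

/-- Duhamel's formula on a window `[a, a + h]`. -/
lemma IsStrongSolution.window (hu : IsStrongSolution M P (1 / 2) T u) (hX : CriticalPath T u X) {a h : ℝ} (ha : 0 < a)
    (hh : 0 < h) (hT : a + h ≤ T) :
    u (a + h) = mulA (heat h) (u a) -
      duh (fun s => s ^ (3 / 4 : ℝ) • P (conv M (u (a + s)) (u (a + s)))) h := by
  have h1 := ((hu.weakHeat hX).mono ha.le hT).duhamel (by linarith)
    ((continuousOn_of_sobolev (by norm_num) hu.continuousOn).mono (Icc_subset_Icc ha.le hT))
    (hX.continuousOn_conv.mono fun s hs => ⟨ha.trans_le hs.1, hs.2.trans hT⟩)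
  rw [h1, integral_heat_eq_duh hh, add_sub_cancel_left]

end Critical

/-! ### A priori bounds in weighted norms -/

section APriori

variable {T lam : ℝ} {u X : ℝ → VF} {M : Matrix (Fin 3) (Fin 3) ℝ} {P : VF →L[ℝ] VF} {ω : ℝ → ℝ → ℝ}

/-- The bound `h^{3/8} ‖A^{5/4} ω(a + h, A) u(a + h)‖ ≤ r` on the window `]a, a + τ]`. -/
def WindowBound (T : ℝ) (ω : ℝ → ℝ → ℝ) (u : ℝ → VF) (a τ r : ℝ) : Prop :=
  ∀ h, 0 < h → h ≤ τ → a + h ≤ T →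
    normA (fun ρ => ρ ^ (5 / 4 : ℝ) * ω (a + h) ρ) (h ^ (3 / 8 : ℝ) • u (a + h)) ≤ ENNReal.ofReal r

lemma TimeWeight.mono (hω : TimeWeight lam T ω) {T' : ℝ} (hT : T' ≤ T) : TimeWeight lam T' ω :=
  ⟨fun t ht => hω.admissible t ⟨ht.1, ht.2.trans hT⟩, fun t ht => hω.continuous t ⟨ht.1, ht.2.trans hT⟩,
    fun s t hs hst ht => hω.le_exp_mul s t hs hst (ht.trans hT)⟩

/-- A constant in the bound of the nonlinear term of Duhamel's formula. -/
def duhConst (M : Matrix (Fin 3) (Fin 3) ℝ) (lam : ℝ) : ℝ := heatConst lam * prodConst M * kernInt (5 / 8) 0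

lemma duhConst_nonneg : 0 ≤ duhConst M lam :=
  mul_nonneg (mul_nonneg (heatConst_pos lam).le prodConst_nonneg) (kernInt_nonneg _ _)

lemma normA_conv_self_le (hω : Admissible (ω 0)) {f : VF} (hf : InDom f) {r : ℝ} (hr : 0 ≤ r)
    (h : normA (fun ρ => ρ ^ (5 / 4 : ℝ) * ω 0 ρ) f ≤ ENNReal.ofReal r) :
    normA (ω 0) (conv M f f) ≤ ENNReal.ofReal (prodConst M * r ^ 2) := by
  refine (normA_conv_le hf hf hω).trans ?_
  rw [pow_two, ← mul_assoc, ENNReal.ofReal_mul (mul_nonneg prodConst_nonneg hr), ENNReal.ofReal_mul prodConst_nonneg]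
  gcongr

/-- Duhamel's formula from time a. The free part is bounded by ε and the nonlinear part is quadratic
in r, with a constant independent of the window and of the weight, because the norm is scale
invariant. -/
lemma WindowBound.step (hP : IsFiberedProjection P) (hω : TimeWeight lam T ω)
    (hu : IsStrongSolution M P (1 / 2) T u) (hX : CriticalPath T u X) {a τ r ε : ℝ} (ha : 0 < a) (hr : 0 ≤ r)
    (hε : 0 ≤ ε) (hw : WindowBound T ω u a τ r)
    (hi : ∀ h, 0 < h → h ≤ τ → a + h ≤ T →
      normA (fun ρ => ρ ^ (5 / 4 : ℝ) * ω (a + h) ρ) (h ^ (3 / 8 : ℝ) • mulA (heat h) (u a)) ≤ ENNReal.ofReal ε) :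
    WindowBound T ω u a τ (ε + duhConst M lam * r ^ 2) := by
  intro h h0 hτ hT
  set G : ℝ → VF := fun s => s ^ (3 / 4 : ℝ) • P (conv M (u (a + s)) (u (a + s))) with hGdef
  have hG : ContinuousOn G (Icc 0 h) :=
    (continuousOn_shift hX.continuousOn_conv ha).mono (Icc_subset_Icc_right (by linarith))
  have hωs := (hω.shift ha.le).mono (show h ≤ T - a by linarith)
  have hadm := hωs.admissible h ⟨h0.le, le_rfl⟩
  have hb : ∀ s ∈ Icc 0 h, normA (ω (a + s)) (G s) ≤ ENNReal.ofReal (prodConst M * r ^ 2 * Real.exp (0 * s)) := by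
    intro s hs
    rw [zero_mul, Real.exp_zero, mul_one]
    rcases hs.1.eq_or_lt with rfl | hs0
    · simp only [hGdef]
      rw [Real.zero_rpow (by norm_num), zero_smul, (funA_zero _).normA_eq]
      simp
    · have hd : InDom (u (a + s)) := hX.inDom ⟨by linarith, by linarith [hs.2]⟩
      have e : G s = P (conv M (s ^ (3 / 8 : ℝ) • u (a + s)) (s ^ (3 / 8 : ℝ) • u (a + s))) := by
        rw [conv_smul hd hd, map_smul, ← Real.rpow_add hs0]
        norm_num [hGdef]
      rw [e]
      refine (hP.normA_le (hωs.admissible s hs).measurable _).trans ?_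
      exact normA_conv_self_le (ω := fun _ => ω (a + s)) (hωs.admissible s hs) (hd.smul _) hr
        (hw s hs0 (hs.2.trans hτ) (by linarith [hs.2]))
  have h1 := hωs.normA_duh_le (β := 5 / 8) (by norm_num) (by norm_num) hG
    (mul_nonneg prodConst_nonneg (sq_nonneg r)) le_rfl ⟨h0, le_rfl⟩ hb
  have e2 : (2 * (5 / 8) : ℝ) = 5 / 4 := by norm_num
  rw [e2] at h1
  have hm : Measurable fun ρ => ρ ^ (5 / 4 : ℝ) * ω (a + h) ρ := (measurable_rpow_const _).mul hadm.measurable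
  rw [hu.window hX ha h0 hT, smul_sub, ENNReal.ofReal_add hε (mul_nonneg duhConst_nonneg (sq_nonneg r))]
  refine (normA_sub_le hm _ _).trans (add_le_add (hi h h0 hτ hT) ?_)
  rw [normA_smul, Real.enorm_eq_ofReal (Real.rpow_nonneg h0.le _)]
  refine (mul_le_mul_right h1 _).trans (le_of_eq ?_)
  rw [← ENNReal.ofReal_mul (Real.rpow_nonneg h0.le _), ← mul_assoc, ← Real.rpow_add h0, duhConst]
  norm_num
  congr 1
  ring

end APriori

end

section

/-! ### Exponential weights -/

section ExpWeight

variable {T lam : ℝ} {θ : ℝ → ℝ} {u X : ℝ → VF} {M : Matrix (Fin 3) (Fin 3) ℝ} {P : VF →L[ℝ] VF}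

/-- The assumptions on the radius of analyticity `θ`. -/
structure Radius (lam T : ℝ) (θ : ℝ → ℝ) : Prop where
  nonneg : ∀ t ∈ Icc 0 T, 0 ≤ θ t
  lam_nonneg : 0 ≤ lam
  le_add : ∀ s t : ℝ, s ∈ Icc 0 T → t ∈ Icc 0 T → s + t ∈ Icc 0 T → θ (s + t) ≤ lam * Real.sqrt s + θ t

lemma Radius.le (hθ : Radius lam T θ) {s t : ℝ} (hs : 0 ≤ s) (hst : s ≤ t) (ht : t ≤ T) :
    θ t ≤ lam * Real.sqrt (t - s) + θ s := by
  have := hθ.le_add (t - s) s ⟨by linarith, by linarith⟩ ⟨hs, hst.trans ht⟩ ⟨by linarith, by linarith⟩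
  rwa [sub_add_cancel] at this

/-- The weight `e^{θ(t) ρ}`. -/
def expWeight (θ : ℝ → ℝ) (t ρ : ℝ) : ℝ := Real.exp (θ t * ρ)

/-- The weight `e^{θ(t) ρ}`, truncated at height `e^N`. -/
def minWeight (θ : ℝ → ℝ) (N t ρ : ℝ) : ℝ := Real.exp (min (θ t * ρ) N)

lemma expWeight_pos (t ρ : ℝ) : 0 < expWeight θ t ρ := Real.exp_pos _

lemma minWeight_pos (N t ρ : ℝ) : 0 < minWeight θ N t ρ := Real.exp_pos _

lemma Radius.expWeight (hθ : Radius lam T θ) : TimeWeight lam T (expWeight θ) := by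
  refine ⟨fun t ht => ⟨by unfold NavierStokes.expWeight; fun_prop, fun _ => (Real.exp_pos _).le, fun a b c _ _ _ h => ?_⟩,
    fun t _ => by unfold NavierStokes.expWeight; fun_prop, fun s t hs hst ht ρ hρ => ?_⟩
  · rw [NavierStokes.expWeight, NavierStokes.expWeight, NavierStokes.expWeight, ← Real.exp_add, ← mul_add]
    have := hθ.nonneg t ht
    gcongr
  · rw [NavierStokes.expWeight, NavierStokes.expWeight, ← Real.exp_add, ← add_mul]
    have := hθ.le hs hst ht
    gcongr

/-- Capping keeps both properties, with constants independent of N: x ↦ min(x, N) is monotone and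
subadditive on x ≥ 0, and min(x + y, N) ≤ x + min(y, N) for x ≥ 0. -/
lemma Radius.minWeight (hθ : Radius lam T θ) {N : ℝ} (hN : 0 ≤ N) : TimeWeight lam T (minWeight θ N) := by
  refine ⟨fun t ht => ⟨by unfold NavierStokes.minWeight; fun_prop, fun _ => (Real.exp_pos _).le, fun a b c ha hb _ h => ?_⟩,
    fun t _ => by unfold NavierStokes.minWeight; fun_prop, fun s t hs hst ht ρ hρ => ?_⟩
  · rw [NavierStokes.minWeight, NavierStokes.minWeight, NavierStokes.minWeight, ← Real.exp_add]
    have h0 := hθ.nonneg t ht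
    have h1 : θ t * c ≤ θ t * a + θ t * b := by rw [← mul_add]; gcongr
    have h2 := mul_nonneg h0 ha
    have h3 := mul_nonneg h0 hb
    refine Real.exp_le_exp.2 ?_
    rcases le_total (θ t * a) N with h | h <;> rcases le_total (θ t * b) N with h' | h' <;>
      rcases le_total (θ t * c) N with h'' | h'' <;> simp only [min_eq_left, min_eq_right, h, h', h''] <;> linarith
  · rw [NavierStokes.minWeight, NavierStokes.minWeight, ← Real.exp_add]
    have h1 : θ t * ρ ≤ lam * Real.sqrt (t - s) * ρ + θ s * ρ := by
      rw [← add_mul]; have := hθ.le hs hst ht; gcongr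
    have h2 : 0 ≤ lam * Real.sqrt (t - s) * ρ := by have := hθ.lam_nonneg; positivity
    refine Real.exp_le_exp.2 ?_
    rcases le_total (θ s * ρ) N with h | h
    · rw [min_eq_left h]; exact (min_le_left _ _).trans h1
    · rw [min_eq_right h]; exact (min_le_right _ _).trans (by linarith)

lemma minWeight_le_expWeight (N t ρ : ℝ) : minWeight θ N t ρ ≤ expWeight θ t ρ :=
  Real.exp_le_exp.2 (min_le_left _ _)

lemma minWeight_add_le {N d : ℝ} (hd : 0 ≤ d) (t ρ : ℝ) :
    minWeight θ (N + d) t ρ ≤ Real.exp d * minWeight θ N t ρ := by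
  rw [minWeight, minWeight, ← Real.exp_add]
  refine Real.exp_le_exp.2 ?_
  rcases le_total (θ t * ρ) N with h | h
  · rw [min_eq_left h]; exact (min_le_left _ _).trans (by linarith)
  · rw [min_eq_right h]; exact (min_le_right _ _).trans (by linarith)

lemma measurable_freeSymbol (h : ℝ) : Measurable fun ρ => smoothing (3 / 8) h ρ * Real.exp (lam * Real.sqrt h * ρ) :=
  (measurable_smoothing _ _).mul (by fun_prop)

lemma abs_freeSymbol_le {h ρ : ℝ} (hh : 0 ≤ h) (hρ : 0 ≤ ρ) :
    |smoothing (3 / 8) h ρ * Real.exp (lam * Real.sqrt h * ρ)| ≤ heatConst lam := by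
  rw [abs_of_nonneg (mul_nonneg (smoothing_nonneg hh hρ) (Real.exp_pos _).le)]
  exact smoothing_mul_exp_le lam (by norm_num) (by norm_num) hh hρ

/-- The weighted norms of the free evolution on short windows are uniformly small. -/
lemma Radius.exists_free_small (hθ : Radius lam T θ) (hT : 0 < T)
    (hreg : ContinuousOnA (fun t => symHom (1 / 2) (θ t)) u (Icc 0 T)) {ε : ℝ} (hε : 0 < ε) :
    ∃ τ, 0 < τ ∧ ∀ a h, 0 ≤ a → 0 < h → h ≤ τ → a + h ≤ T →
      normA (fun ρ => ρ ^ (5 / 4 : ℝ) * NavierStokes.expWeight θ (a + h) ρ) (h ^ (3 / 8 : ℝ) • mulA (heat h) (u a)) ≤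
        ENNReal.ofReal ε := by
  obtain ⟨V, hV, hVf⟩ := hreg
  set g : ℝ × ℝ → VF := fun x => mulA (fun ρ => smoothing (3 / 8) x.1 ρ * Real.exp (lam * Real.sqrt x.1 * ρ)) (V x.2)
  -- The map g vanishes at h = 0 and is jointly continuous on a compact set, so uniform continuity
  -- gives a window length which does not depend on a.
  have hg : ContinuousOn g (Icc 0 T ×ˢ Icc 0 T) := by
    refine continuousOn_mulA (C := heatConst lam) (fun x _ => measurable_freeSymbol x.1)
      (fun x hx ρ hρ => abs_freeSymbol_le hx.1.1 hρ) (fun ρ _ => ?_)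
      (hV.comp continuousOn_snd fun x hx => hx.2)
    have h1 := (continuous_smoothing (β := 3 / 8) (by norm_num) ρ).comp (continuous_fst (X := ℝ) (Y := ℝ))
    exact (h1.mul (by fun_prop)).continuousOn
  have huc := (isCompact_Icc.prod isCompact_Icc).uniformContinuousOn_of_continuous hg
  rw [Metric.uniformContinuousOn_iff] at huc
  obtain ⟨δ, hδ, h1⟩ := huc ε hε
  refine ⟨δ / 2, half_pos hδ, fun a h ha hh hτ haT => ?_⟩
  have ha' : a ∈ Icc 0 T := ⟨ha, by linarith⟩
  have h2 := h1 (h, a) ⟨⟨hh.le, by linarith⟩, ha'⟩ (0, a) ⟨⟨le_rfl, hT.le⟩, ha'⟩ (by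
    rw [Prod.dist_eq, dist_self, Real.dist_eq, sub_zero, abs_of_pos hh, max_eq_left hh.le]; linarith)
  have h3 : g (0, a) = 0 := by
    have : (fun ρ => smoothing (3 / 8) 0 ρ * Real.exp (lam * Real.sqrt 0 * ρ)) = fun _ => 0 := by
      funext ρ; rw [smoothing, Real.zero_rpow (by norm_num), zero_mul, zero_mul, zero_mul]
    simp only [g]
    rw [this, mulA_zero_symbol]
  rw [h3, dist_zero_right] at h2
  have h4 := (((BddSymbol.funA ⟨measurable_freeSymbol (lam := lam) h, heatConst lam, fun ρ hρ => abs_freeSymbol_le hh.le hρ⟩)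
    (V a))).normA_eq
  have h5 := (hVf a ha').comp (BddSymbol.funA ⟨measurable_freeSymbol (lam := lam) h, heatConst lam, fun ρ hρ => abs_freeSymbol_le hh.le hρ⟩
    (V a))
  calc _ = normA (fun ρ => ρ ^ (5 / 4 : ℝ) * NavierStokes.expWeight θ (a + h) ρ * (h ^ (3 / 8 : ℝ) * heat h ρ)) (u a) := by
        have h6 := ((bddSymbol_heat hh.le).funA (u a)).const_mul (h ^ (3 / 8 : ℝ))
        refine eLpNorm_congr_ae ?_
        filter_upwards [h6] with ξ hξ
        rw [hξ, smul_smul]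
    _ ≤ normA (fun ρ => smoothing (3 / 8) h ρ * Real.exp (lam * Real.sqrt h * ρ) * symHom (1 / 2) (θ a) ρ) (u a) := by
        refine normA_mono (fun ρ hρ => ?_) _
        -- Of the 5/4 derivatives, 1/2 are those controlled by the hypothesis on u; the remaining
        -- 3/4 are paid by h^{3/8}.
        have e : ρ ^ (5 / 4 : ℝ) = ρ ^ (2 * (3 / 8) : ℝ) * ρ ^ (1 / 2 : ℝ) := by
          rw [← Real.rpow_add_of_nonneg hρ (by norm_num) (by norm_num)]; norm_num
        have h7 := hθ.expWeight.le_exp_mul a (a + h) ha (by linarith) haT ρ hρ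
        rw [add_sub_cancel_left] at h7
        have h8 := heat_pos h ρ
        have h9 : 0 < NavierStokes.expWeight θ (a + h) ρ := Real.exp_pos _
        have h10 : 0 < NavierStokes.expWeight θ a ρ := Real.exp_pos _
        have h11 : 0 ≤ smoothing (3 / 8) h ρ := smoothing_nonneg hh.le hρ
        have e2 : symHom (1 / 2) (θ a) ρ = ρ ^ (1 / 2 : ℝ) * NavierStokes.expWeight θ a ρ := rfl
        rw [abs_of_nonneg (by positivity), e2, abs_of_nonneg (by positivity), e, smoothing]
        calc _ = ρ ^ (2 * (3 / 8) : ℝ) * ρ ^ (1 / 2 : ℝ) * (h ^ (3 / 8 : ℝ) * heat h ρ) * NavierStokes.expWeight θ (a + h) ρ := by ring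
          _ ≤ ρ ^ (2 * (3 / 8) : ℝ) * ρ ^ (1 / 2 : ℝ) * (h ^ (3 / 8 : ℝ) * heat h ρ) *
              (Real.exp (lam * Real.sqrt h * ρ) * NavierStokes.expWeight θ a ρ) := by gcongr
          _ = _ := by ring
    _ = ‖g (h, a)‖ₑ := h5.normA_eq
    _ ≤ ENNReal.ofReal ε := by
        rw [← ofReal_norm]; exact ENNReal.ofReal_le_ofReal h2.le

/-- The unweighted critical norms on short windows are uniformly small. -/
lemma CriticalPath.exists_window_small (hX : CriticalPath T u X) (hT : 0 < T) {ε : ℝ} (hε : 0 < ε) :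
    ∃ τ, 0 < τ ∧ ∀ a h, 0 ≤ a → 0 < h → h ≤ τ → a + h ≤ T →
      normA (fun ρ => ρ ^ (5 / 4 : ℝ)) (h ^ (3 / 8 : ℝ) • u (a + h)) ≤ ENNReal.ofReal ε := by
  obtain ⟨τ₁, hτ₁, h1⟩ := hX.exists_small hT hε
  obtain ⟨B, hB⟩ := exists_norm_bound hX.continuousOn
  have hlim : Tendsto (fun h : ℝ => (h / τ₁) ^ (3 / 8 : ℝ) * B) (𝓝 0) (𝓝 0) := by
    have : Continuous fun h : ℝ => (h / τ₁) ^ (3 / 8 : ℝ) * B :=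
      ((Real.continuous_rpow_const (by norm_num)).comp (by fun_prop : Continuous fun h : ℝ => h / τ₁)).mul_const B
    have := this.tendsto 0
    rwa [zero_div, Real.zero_rpow (by norm_num), zero_mul] at this
  obtain ⟨δ, hδ, h2⟩ := Metric.eventually_nhds_iff.1 (hlim.eventually_le_const hε)
  refine ⟨δ / 2, half_pos hδ, fun a h ha hh hτ haT => ?_⟩
  have hs : a + h ∈ Icc 0 T := ⟨by linarith, haT⟩
  have hs0 : 0 < a + h := by linarith
  have h3 : h ^ (3 / 8 : ℝ) • u (a + h) = (h / (a + h)) ^ (3 / 8 : ℝ) • ((a + h) ^ (3 / 8 : ℝ) • u (a + h)) := by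
    rw [smul_smul, ← Real.mul_rpow (by positivity) hs0.le, div_mul_cancel₀ _ hs0.ne']
  rw [h3, normA_smul, (hX.funA _ hs).normA_eq, Real.enorm_eq_ofReal (by positivity), ← ofReal_norm,
    ← ENNReal.ofReal_mul (by positivity)]
  refine ENNReal.ofReal_le_ofReal ?_
  -- Near time 0 the path X itself is small. Afterwards X is merely bounded, but the ratio h/(a+h) ≤
  -- h/τ₁ is small.
  rcases le_total (a + h) τ₁ with h4 | h4
  · refine (mul_le_of_le_one_left (norm_nonneg _) (Real.rpow_le_one (by positivity) ?_ (by norm_num))).trans (h1 _ hs h4)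
    rw [div_le_one hs0]; linarith
  · have h5 := h2 (y := h) (by rw [Real.dist_eq, sub_zero, abs_of_pos hh]; linarith)
    refine le_trans ?_ h5
    have hB0 : 0 ≤ B := (norm_nonneg _).trans (hB _ hs)
    gcongr
    exact hB _ hs

/-- On each bounded set of frequencies the cap becomes inactive once k is large, and truncations
determine the norm. -/
lemma WindowBound.of_minWeight {a τ r d : ℝ} (hd : 0 < d)
    (h : ∀ k : ℕ, WindowBound T (NavierStokes.minWeight θ (k * d)) u a τ r) : WindowBound T (expWeight θ) u a τ r := by
  intro s hs hτ hT
  refine normA_le_of_trunc (by unfold expWeight; fun_prop) fun n => ?_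
  obtain ⟨k, hk⟩ := exists_nat_ge (|θ (a + s)| * n / d)
  refine le_trans (normA_mono (fun ρ hρ => ?_) _) (h k s hs hτ hT)
  simp only [trunc]
  split_ifs with hn
  · refine le_of_eq ?_
    rw [expWeight, NavierStokes.minWeight, min_eq_left]
    rw [div_le_iff₀ hd] at hk
    refine le_trans ?_ hk
    calc θ (a + s) * ρ ≤ |θ (a + s)| * ρ := by gcongr; exact le_abs_self _
      _ ≤ _ := by gcongr
  · rw [abs_zero]; exact abs_nonneg _

/-- A priori bounds for strong solutions in analytic norms. -/
lemma IsStrongSolution.exists_windowBound (hP : IsFiberedProjection P) (hθ : Radius lam T θ) (hT : 0 < T)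
    (hu : IsStrongSolution M P (1 / 2) T u) (hX : CriticalPath T u X)
    (hreg : ContinuousOnA (fun t => symHom (1 / 2) (θ t)) u (Icc 0 T)) {ε : ℝ} (hε : 0 < ε) :
    ∃ τ, 0 < τ ∧ ∀ a, 0 < a → WindowBound T (NavierStokes.expWeight θ) u a τ ε := by
  set C := duhConst M lam
  have hC : 0 ≤ C := duhConst_nonneg
  -- The condition 9Ce ≤ 1 means e + C(3e)² ≤ 2e: a provisional bound 3e improves itself to 2e.
  obtain ⟨e, he, he1, he2⟩ : ∃ e, 0 < e ∧ 2 * e ≤ ε ∧ 9 * C * e ≤ 1 := by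
    refine ⟨min (ε / 2) (1 / (9 * C + 1)), by positivity, ?_, ?_⟩
    · linarith [min_le_left (ε / 2) (1 / (9 * C + 1))]
    · have := min_le_right (ε / 2) (1 / (9 * C + 1))
      calc 9 * C * min (ε / 2) (1 / (9 * C + 1)) ≤ 9 * C * (1 / (9 * C + 1)) := by gcongr
        _ ≤ 1 := by rw [mul_one_div, div_le_one (by positivity)]; linarith
  obtain ⟨τ₁, hτ₁, h1⟩ := hθ.exists_free_small hT hreg he
  obtain ⟨τ₂, hτ₂, h2⟩ := hX.exists_window_small hT (ε := 2 * e) (by linarith)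
  refine ⟨min τ₁ τ₂, lt_min hτ₁ hτ₂, fun a ha => ?_⟩
  -- Raising the cap by log(3/2) multiplies the norm by at most 3/2, which turns 2e into 3e.
  have hd : 0 < Real.log (3 / 2) := Real.log_pos (by norm_num)
  refine WindowBound.of_minWeight hd fun k h hh hτ haT => ?_
  refine le_trans ?_ (ENNReal.ofReal_le_ofReal he1)
  suffices H : WindowBound T (NavierStokes.minWeight θ (k * Real.log (3 / 2))) u a (min τ₁ τ₂) (2 * e) from H h hh hτ haT
  clear! h
  -- Induction on the height of the cap replaces a continuity argument: the norm with a higher cap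
  -- is finite because the previous one is. At height 0 the weight is 1.
  induction k with
  | zero =>
    intro h hh hτ haT
    refine le_trans (normA_mono (fun ρ hρ => ?_) _) (h2 a h ha.le hh (hτ.trans (min_le_right _ _)) haT)
    have h0 : 0 ≤ θ (a + h) * ρ := mul_nonneg (hθ.nonneg _ ⟨by linarith, haT⟩) hρ
    rw [NavierStokes.minWeight, Nat.cast_zero, zero_mul, min_eq_right h0, Real.exp_zero, mul_one]
  | succ k ih =>
    have hstep : WindowBound T (NavierStokes.minWeight θ ((k + 1 : ℕ) * Real.log (3 / 2))) u a (min τ₁ τ₂) (3 * e) := by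
      intro h hh hτ haT
      have h3 : normA (fun ρ => ρ ^ (5 / 4 : ℝ) * NavierStokes.minWeight θ ((k + 1 : ℕ) * Real.log (3 / 2)) (a + h) ρ)
          (h ^ (3 / 8 : ℝ) • u (a + h)) ≤ ENNReal.ofReal (3 / 2) *
          normA (fun ρ => ρ ^ (5 / 4 : ℝ) * NavierStokes.minWeight θ (k * Real.log (3 / 2)) (a + h) ρ)
          (h ^ (3 / 8 : ℝ) • u (a + h)) := by
        refine normA_le_mul (fun ρ hρ => ?_) _
        have h4 := minWeight_add_le (θ := θ) (N := k * Real.log (3 / 2)) hd.le (a + h) ρ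
        rw [Real.exp_log (by norm_num)] at h4
        have h5 : ∀ N, 0 < NavierStokes.minWeight θ N (a + h) ρ := fun N => Real.exp_pos _
        have h6 := Real.rpow_nonneg hρ (5 / 4)
        rw [abs_of_nonneg (mul_nonneg h6 (h5 _).le), abs_of_nonneg (mul_nonneg h6 (h5 _).le), Nat.cast_add, Nat.cast_one,
          add_mul, one_mul]
        calc _ ≤ ρ ^ (5 / 4 : ℝ) * (3 / 2 * NavierStokes.minWeight θ (k * Real.log (3 / 2)) (a + h) ρ) := by gcongr
          _ = _ := by ring
      refine h3.trans ((mul_le_mul_right (ih h hh hτ haT) _).trans (le_of_eq ?_))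
      rw [← ENNReal.ofReal_mul (by norm_num)]
      congr 1; ring
    have h6 := hstep.step hP (hθ.minWeight (by positivity)) hu hX ha (by linarith) he.le (fun h hh hτ haT => by
      refine le_trans (normA_mono (fun ρ hρ => ?_) _) (h1 a h ha.le hh (hτ.trans (min_le_left _ _)) haT)
      have h6 := Real.rpow_nonneg hρ (5 / 4)
      rw [abs_of_nonneg (mul_nonneg h6 (minWeight_pos _ _ _).le), abs_of_nonneg (mul_nonneg h6 (expWeight_pos _ _).le)]
      exact mul_le_mul_of_nonneg_left (minWeight_le_expWeight _ _ _) h6)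
    intro h hh hτ haT
    refine (h6 h hh hτ haT).trans (ENNReal.ofReal_le_ofReal ?_)
    nlinarith

end ExpWeight

end

section

/-! ### Global bounds in the critical norm -/

section GlobalBound

variable {T lam : ℝ} {θ : ℝ → ℝ} {u X : ℝ → VF} {M : Matrix (Fin 3) (Fin 3) ℝ} {P : VF →L[ℝ] VF} {ω : ℝ → ℝ → ℝ}

lemma WindowBound.rescale {a τ r h : ℝ} (hw : WindowBound T ω u a τ r) (ha : 0 < a) (hh : 0 < h) (hτ : h ≤ τ)
    (hT : a + h ≤ T) {c : ℝ} (hc : ((a + h) / h) ^ (3 / 8 : ℝ) ≤ c) :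
    normA (fun ρ => ρ ^ (5 / 4 : ℝ) * ω (a + h) ρ) ((a + h) ^ (3 / 8 : ℝ) • u (a + h)) ≤ ENNReal.ofReal (c * r) := by
  have h1 : (a + h) ^ (3 / 8 : ℝ) • u (a + h) = ((a + h) / h) ^ (3 / 8 : ℝ) • (h ^ (3 / 8 : ℝ) • u (a + h)) := by
    rw [smul_smul, ← Real.mul_rpow (by positivity) hh.le, div_mul_cancel₀ _ hh.ne']
  rw [h1, normA_smul, Real.enorm_eq_ofReal (by positivity),
    ENNReal.ofReal_mul ((Real.rpow_nonneg (by positivity) _).trans hc)]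
  gcongr
  exact hw h hh hτ hT

/-- The bound `t^{3/8} ‖A^{5/4} ω(t, A) u(t)‖ ≤ b`. -/
def CriticalBound (ω : ℝ → ℝ → ℝ) (u : ℝ → VF) (t b : ℝ) : Prop :=
  normA (fun ρ => ρ ^ (5 / 4 : ℝ) * ω t ρ) (t ^ (3 / 8 : ℝ) • u t) ≤ ENNReal.ofReal b

lemma criticalBound_zero {b : ℝ} : CriticalBound ω u 0 b := by
  rw [CriticalBound, Real.zero_rpow (by norm_num), zero_smul, (funA_zero _).normA_eq]
  simp

lemma CriticalBound.mono {t b b' : ℝ} (h : CriticalBound ω u t b) (hb : b ≤ b') : CriticalBound ω u t b' :=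
  h.trans (ENNReal.ofReal_le_ofReal hb)

/-- For small t the window from t/2 to t is used, so that the ratio of the time factors is fixed.
For larger t a window of fixed length ending at t is used, and the ratio is at most T/s. All windows
start at positive times. -/
lemma exists_criticalBound
    (h : ∀ ε, 0 < ε → ∃ τ, 0 < τ ∧ ∀ a, 0 < a → WindowBound T ω u a τ ε) :
    (∃ B, 1 ≤ B ∧ ∀ t ∈ Icc 0 T, CriticalBound ω u t B) ∧
      ∀ ε, 0 < ε → ∃ τ, 0 < τ ∧ ∀ t ∈ Icc 0 T, t ≤ τ → CriticalBound ω u t ε := by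
  have small : ∀ ε, 0 < ε → ∃ τ, 0 < τ ∧ ∀ t ∈ Icc 0 T, t ≤ τ → CriticalBound ω u t ε := by
    intro ε hε
    obtain ⟨τ, hτ, hw⟩ := h (ε / 2) (half_pos hε)
    refine ⟨τ, hτ, fun t ht htτ => ?_⟩
    rcases ht.1.eq_or_lt with rfl | h0
    · exact criticalBound_zero
    · have h1 := (hw (t / 2) (half_pos h0)).rescale (h := t / 2) (c := 2) (half_pos h0) (half_pos h0)
        (by linarith) (by linarith [ht.2]) (by
          rw [add_halves, div_div_cancel₀ h0.ne']
          calc (2 : ℝ) ^ (3 / 8 : ℝ) ≤ 2 ^ (1 : ℝ) := Real.rpow_le_rpow_of_exponent_le (by norm_num) (by norm_num)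
            _ = 2 := Real.rpow_one 2)
      rwa [add_halves, mul_div_cancel₀ _ two_ne_zero] at h1
  refine ⟨?_, small⟩
  obtain ⟨τ₁, hτ₁, h1⟩ := small 1 one_pos
  obtain ⟨τ, hτ, hw⟩ := h 1 one_pos
  set s := min τ (τ₁ / 2)
  have hs : 0 < s := lt_min hτ (half_pos hτ₁)
  refine ⟨max 1 ((T / s) ^ (3 / 8 : ℝ)), le_max_left _ _, fun t ht => ?_⟩
  rcases le_total t τ₁ with h2 | h2
  · exact (h1 t ht h2).mono (le_max_left _ _)
  · have hst : s < t := (min_le_right _ _).trans_lt (by linarith)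
    have h3 := (hw (t - s) (sub_pos.2 hst)).rescale (h := s) (c := (T / s) ^ (3 / 8 : ℝ)) (sub_pos.2 hst) hs
      (min_le_left _ _) (by linarith [ht.2]) (by
        rw [sub_add_cancel]
        have := hs.trans hst
        have := ht.2
        gcongr)
    rw [sub_add_cancel, mul_one] at h3
    exact h3.trans (ENNReal.ofReal_le_ofReal (le_max_right _ _))

/-- Makes the terms linear in w contractive on all of [0, T]. The bound b may depend on t: up to
time τ it is small and the kernel is merely bounded; after τ it is B and the kernel is small because
κt ≥ κτ. -/
lemma exists_rate {B : ℝ} (hB : 1 ≤ B) (hBb : ∀ t ∈ Icc 0 T, CriticalBound ω u t B)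
    (hsmall : ∀ ε, 0 < ε → ∃ τ, 0 < τ ∧ ∀ t ∈ Icc 0 T, t ≤ τ → CriticalBound ω u t ε) {c : ℝ} (hc : 0 < c) :
    ∃ κ, 0 ≤ κ ∧ ∀ t ∈ Icc 0 T, ∃ b, 0 ≤ b ∧ b ≤ B ∧ CriticalBound ω u t b ∧ b * kernInt (5 / 8) (κ * t) ≤ c := by
  have hL := kernInt_nonneg (5 / 8) 0
  set ε := min 1 (c / (kernInt (5 / 8) 0 + 1))
  have hε : 0 < ε := lt_min one_pos (by positivity)
  obtain ⟨τ, hτ, h1⟩ := hsmall ε hε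
  obtain ⟨x, hx, hx0⟩ := (((tendsto_kernInt (β := 5 / 8) (by norm_num)).eventually_le_const
    (show 0 < c / B by positivity)).and (eventually_ge_atTop 0)).exists
  refine ⟨x / τ, by positivity, fun t ht => ?_⟩
  rcases le_total t τ with h2 | h2
  · refine ⟨ε, hε.le, (min_le_left _ _).trans hB, h1 t ht h2, ?_⟩
    have h3 := kernInt_anti (β := 5 / 8) (by norm_num) le_rfl (mul_nonneg (div_nonneg hx0 hτ.le) ht.1)
    calc ε * kernInt (5 / 8) (x / τ * t) ≤ c / (kernInt (5 / 8) 0 + 1) * kernInt (5 / 8) 0 := by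
          gcongr
          · exact kernInt_nonneg _ _
          · exact min_le_right _ _
      _ ≤ c := by
          rw [div_mul_eq_mul_div, div_le_iff₀ (by positivity)]
          nlinarith
  · refine ⟨B, by linarith, le_rfl, hBb t ht, ?_⟩
    have h3 : x ≤ x / τ * t := by
      rw [div_mul_eq_mul_div, le_div_iff₀ hτ]; gcongr
    have h4 := (kernInt_anti (β := 5 / 8) (by norm_num) hx0 h3).trans hx
    rw [le_div_iff₀ (by linarith)] at h4
    linarith

end GlobalBound

/-! ### Mild solutions of the perturbation equation -/

section Perturbation

variable {T lam : ℝ} {u X w Y : ℝ → VF} {M : Matrix (Fin 3) (Fin 3) ℝ} {P : VF →L[ℝ] VF} {ω : ℝ → ℝ → ℝ}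
  {G : ℝ → VF} {w₀ W₀ : VF}

/-- The solution of the heat equation with source `-t^{-3/4} G(t)`. -/
def mild (w₀ : VF) (G : ℝ → VF) (t : ℝ) : VF := mulA (heat t) w₀ - duh G t

lemma mild_zero : mild w₀ G 0 = w₀ := by
  have : heat 0 = fun _ => 1 := funext heat_zero
  rw [mild, duh_zero, this, mulA_one, sub_zero]

lemma smoothing_free {t : ℝ} (ht : 0 ≤ t) (hW : FunA (fun ρ => ρ ^ (1 / 2 : ℝ)) w₀ W₀) :
    FunA (fun ρ => ρ ^ (5 / 4 : ℝ)) (t ^ (3 / 8 : ℝ) • mulA (heat t) w₀) (mulA (smoothing (3 / 8) t) W₀) := by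
  have h1 := hW.comp ((bddSymbol_smoothing (β := 3 / 8) (by norm_num) (by norm_num) ht).funA W₀)
  have h2 := (bddSymbol_heat ht).funA w₀
  refine FunA.of_const_mul (h2.cancel (h1.congr fun ρ hρ => ?_))
  have e : ρ ^ (5 / 4 : ℝ) = ρ ^ (2 * (3 / 8) : ℝ) * ρ ^ (1 / 2 : ℝ) := by
    rw [← Real.rpow_add_of_nonneg hρ (by norm_num) (by norm_num)]; norm_num
  rw [e, smoothing]; ring

lemma criticalPath_mild (hG : ContinuousOn G (Icc 0 T)) (hW : FunA (fun ρ => ρ ^ (1 / 2 : ℝ)) w₀ W₀) :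
    CriticalPath T (mild w₀ G) fun t => mulA (smoothing (3 / 8) t) W₀ - smoothInt (5 / 8) G t := by
  refine ⟨fun t ht => ?_, ?_, ?_⟩
  · rw [mild, smul_sub]
    exact (smoothing_free ht.1 hW).sub (funA_five_fourths_duh hG ht)
  · refine ContinuousOn.sub (continuousOn_mulA (m := smoothing (3 / 8)) (C := 2) (fun _ _ => measurable_smoothing _ _)
      (fun t ht ρ hρ => abs_smoothing_le (by norm_num) (by norm_num) ht.1 hρ) (fun ρ _ => ?_) continuousOn_const)
      (continuousOn_smoothInt (by norm_num) (by norm_num) hG)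
    exact (continuous_smoothing (by norm_num) ρ).continuousOn
  · have : smoothing (3 / 8) 0 = fun _ => 0 := by
      funext ρ; rw [smoothing, Real.zero_rpow (by norm_num), zero_mul, zero_mul]
    rw [this, mulA_zero_symbol, smoothInt_at_zero (by norm_num), sub_zero]

/-- Weighted bounds for the free evolution. -/
lemma TimeWeight.normA_heat_le (hω : TimeWeight lam T ω) {α β t : ℝ} (hα : 0 ≤ α) (hβ : 0 ≤ β) (hβ' : β ≤ 1)
    (ht : t ∈ Ioc 0 T) (f : VF) :
    normA (fun ρ => ρ ^ (2 * β + α) * ω t ρ) (t ^ β • mulA (heat t) f) ≤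
      ENNReal.ofReal (heatConst lam) * normA (fun ρ => ρ ^ α * ω 0 ρ) f := by
  have h1 := hω.normA_smoothing_le hβ hβ' le_rfl ht.1.le ht.2 (fun ρ => ρ ^ α) f
  rw [sub_zero] at h1
  refine le_trans (le_of_eq ?_) h1
  have h2 := ((bddSymbol_heat ht.1.le).funA f).const_mul (t ^ β)
  refine eLpNorm_congr_ae ?_
  filter_upwards [h2] with ξ hξ
  rw [hξ, smul_smul, smoothing, Real.rpow_add_of_nonneg (two_pi_norm_nonneg ξ) (by linarith) hα]
  congr 1; ring

lemma TimeWeight.criticalBound_mild (hω : TimeWeight lam T ω) (hG : ContinuousOn G (Icc 0 T)) {R κ δ t : ℝ} (hR : 0 ≤ R)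
    (hκ : 0 ≤ κ) (hδ : 0 ≤ δ) (hw : normA (fun ρ => ρ ^ (1 / 2 : ℝ) * ω 0 ρ) w₀ ≤ ENNReal.ofReal δ)
    (hb : ∀ s ∈ Icc 0 T, normA (ω s) (G s) ≤ ENNReal.ofReal (R * Real.exp (κ * s))) (ht : t ∈ Icc 0 T) :
    CriticalBound ω (mild w₀ G) t (heatConst lam * (δ + R * Real.exp (κ * t) * kernInt (5 / 8) (κ * t))) := by
  rcases ht.1.eq_or_lt with rfl | h0
  · exact criticalBound_zero
  have hc := (heatConst_pos lam).le
  have hm : Measurable fun ρ => ρ ^ (5 / 4 : ℝ) * ω t ρ := (measurable_rpow_const _).mul (hω.admissible t ht).measurable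
  have h1 := hω.normA_heat_le (α := 1 / 2) (β := 3 / 8) (by norm_num) (by norm_num) (by norm_num) ⟨h0, ht.2⟩ w₀
  have h2 := hω.normA_duh_le (β := 5 / 8) (by norm_num) (by norm_num) hG hR hκ ⟨h0, ht.2⟩ hb
  have e1 : (2 * (3 / 8) + 1 / 2 : ℝ) = 5 / 4 := by norm_num
  have e2 : (2 * (5 / 8) : ℝ) = 5 / 4 := by norm_num
  rw [e1] at h1
  rw [e2] at h2
  rw [CriticalBound, mild, smul_sub, mul_add, ENNReal.ofReal_add (mul_nonneg hc hδ)
    (mul_nonneg hc (mul_nonneg (mul_nonneg hR (Real.exp_pos _).le) (kernInt_nonneg _ _))), ENNReal.ofReal_mul hc]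
  refine (normA_sub_le hm _ _).trans (add_le_add (h1.trans (by gcongr)) ?_)
  rw [normA_smul, Real.enorm_eq_ofReal (Real.rpow_nonneg h0.le _)]
  refine (mul_le_mul_right h2 _).trans (le_of_eq ?_)
  rw [← ENNReal.ofReal_mul (Real.rpow_nonneg h0.le _), ← mul_assoc, ← Real.rpow_add h0]
  norm_num [mul_assoc]

lemma duh_sub {G' : ℝ → VF} (hG : ContinuousOn G (Icc 0 T)) (hG' : ContinuousOn G' (Icc 0 T)) {t : ℝ} (ht : t ∈ Icc 0 T) :
    duh (fun s => G s - G' s) t = duh G t - duh G' t := by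
  rw [duh, duh, duh, ← smul_sub, smoothInt, smoothInt, smoothInt,
    ← integral_sub (integrable_smoothInt le_rfl zero_le_one zero_lt_one hG ht)
      (integrable_smoothInt le_rfl zero_le_one zero_lt_one hG' ht)]
  simp only [map_sub, smul_sub]

lemma mild_sub {G' : ℝ → VF} (hG : ContinuousOn G (Icc 0 T)) (hG' : ContinuousOn G' (Icc 0 T)) {t : ℝ} (ht : t ∈ Icc 0 T) :
    mild w₀ G t - mild w₀ G' t = mild 0 (fun s => G s - G' s) t := by
  rw [mild, mild, mild, duh_sub hG hG' ht, map_zero]; abel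

/-- The rescaled nonlinearity `t^{3/4} P [(Mu·∇)w + (Mw·∇)u + (Mw·∇)w]` of the perturbation equation. -/
def pert (M : Matrix (Fin 3) (Fin 3) ℝ) (P : VF →L[ℝ] VF) (u w : ℝ → VF) (t : ℝ) : VF :=
  P (conv M (t ^ (3 / 8 : ℝ) • u t) (t ^ (3 / 8 : ℝ) • w t) + conv M (t ^ (3 / 8 : ℝ) • w t) (t ^ (3 / 8 : ℝ) • u t) +
    conv M (t ^ (3 / 8 : ℝ) • w t) (t ^ (3 / 8 : ℝ) • w t))

lemma continuousOn_pert (hX : CriticalPath T u X) (hY : CriticalPath T w Y) :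
    ContinuousOn (pert M P u w) (Icc 0 T) := by
  refine P.continuous.comp_continuousOn (ContinuousOn.add (ContinuousOn.add ?_ ?_) ?_)
  · exact continuousOn_conv hX.funA hY.funA hX.continuousOn hY.continuousOn
  · exact continuousOn_conv hY.funA hX.funA hY.continuousOn hX.continuousOn
  · exact continuousOn_conv hY.funA hY.funA hY.continuousOn hY.continuousOn

lemma normA_conv_le_ofReal {ω : ℝ → ℝ} (hω : Admissible ω) {f g : VF} (hf : InDom f) (hg : InDom g) {a b : ℝ} (ha : 0 ≤ a)
    (h1 : normA (fun ρ => ρ ^ (5 / 4 : ℝ) * ω ρ) f ≤ ENNReal.ofReal a)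
    (h2 : normA (fun ρ => ρ ^ (5 / 4 : ℝ) * ω ρ) g ≤ ENNReal.ofReal b) :
    normA ω (conv M f g) ≤ ENNReal.ofReal (prodConst M * a * b) := by
  refine (normA_conv_le hf hg hω).trans ?_
  rw [ENNReal.ofReal_mul (mul_nonneg prodConst_nonneg ha), ENNReal.ofReal_mul prodConst_nonneg]
  gcongr

lemma normA_pert_le (hP : IsFiberedProjection P) (hX : CriticalPath T u X) (hY : CriticalPath T w Y) {t a b : ℝ}
    (ht : t ∈ Icc 0 T) (hω : Admissible (ω t)) (ha : 0 ≤ a) (hb : 0 ≤ b) (hu : CriticalBound ω u t b)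
    (hw : CriticalBound ω w t a) :
    normA (ω t) (pert M P u w t) ≤ ENNReal.ofReal (prodConst M * (2 * b * a + a ^ 2)) := by
  have hf := (hX.funA t ht).inDom
  have hg := (hY.funA t ht).inDom
  have hm := hω.measurable
  have hC := prodConst_nonneg (M := M)
  refine (hP.normA_le hm _).trans ((normA_add_le hm _ _).trans ?_)
  have e : prodConst M * (2 * b * a + a ^ 2) = prodConst M * b * a + prodConst M * a * b + prodConst M * a * a := by ring
  rw [e, ENNReal.ofReal_add (by positivity) (by positivity), ENNReal.ofReal_add (by positivity) (by positivity)]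
  refine add_le_add ((normA_add_le hm _ _).trans (add_le_add ?_ ?_)) ?_
  · exact normA_conv_le_ofReal hω hf hg hb hu hw
  · exact normA_conv_le_ofReal hω hg hf ha hw hu
  · exact normA_conv_le_ofReal hω hg hg ha hw hw

lemma FunA.norm_le_of_normA {m : ℝ → ℝ} {f F : VF} (h : FunA m f F) {a : ℝ} (ha : 0 ≤ a) (hb : normA m f ≤ ENNReal.ofReal a) :
    ‖F‖ ≤ a := by
  rw [h.normA_eq, ← ofReal_norm] at hb
  exact (ENNReal.ofReal_le_ofReal_iff ha).1 hb

/-- Bilinearity, with (Mw·∇)w - (Mw'·∇)w' = (M(w-w')·∇)w + (Mw'·∇)(w-w'). No weight appears, since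
the contraction is measured in plain L². -/
lemma norm_pert_sub_le (hP : IsFiberedProjection P) {w' Y' : ℝ → VF} (hX : CriticalPath T u X) (hY : CriticalPath T w Y)
    (hY' : CriticalPath T w' Y') {t a b d : ℝ} (ht : t ∈ Icc 0 T) (hb : ‖X t‖ ≤ b) (ha : ‖Y t‖ ≤ a) (ha' : ‖Y' t‖ ≤ a)
    (hd : ‖Y t - Y' t‖ ≤ d) : ‖pert M P u w t - pert M P u w' t‖ ≤ prodConst M * (2 * b + 2 * a) * d := by
  have hf := hX.funA t ht
  have hg := hY.funA t ht
  have hg' := hY'.funA t ht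
  have hC := prodConst_nonneg (M := M)
  have hb0 := (norm_nonneg _).trans hb
  have ha0 := (norm_nonneg _).trans ha
  have hd0 := (norm_nonneg _).trans hd
  set f := t ^ (3 / 8 : ℝ) • u t with hfd
  set g := t ^ (3 / 8 : ℝ) • w t with hgd
  set g' := t ^ (3 / 8 : ℝ) • w' t with hgd'
  have e : pert M P u w t - pert M P u w' t =
      P (conv M f (g - g') + conv M (g - g') f + (conv M (g - g') g + conv M g' (g - g'))) := by
    rw [pert, pert, ← map_sub, conv_sub_right hf.inDom hg.inDom hg'.inDom, conv_sub_left hg.inDom hg'.inDom hf.inDom,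
      conv_sub_left hg.inDom hg'.inDom hg.inDom, conv_sub_right hg'.inDom hg.inDom hg'.inDom]
    congr 1
    simp only [← hfd, ← hgd, ← hgd']
    abel
  rw [e]
  refine (hP.norm_le _).trans ?_
  have h1 := (norm_conv_le (M := M) hf (hg.sub hg'))
  have h2 := (norm_conv_le (M := M) (hg.sub hg') hf)
  have h3 := (norm_conv_le (M := M) (hg.sub hg') hg)
  have h4 := (norm_conv_le (M := M) hg' (hg.sub hg'))
  have k1 : prodConst M * ‖X t‖ * ‖Y t - Y' t‖ ≤ prodConst M * b * d := by gcongr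
  have k2 : prodConst M * ‖Y t - Y' t‖ * ‖X t‖ ≤ prodConst M * d * b := by gcongr
  have k3 : prodConst M * ‖Y t - Y' t‖ * ‖Y t‖ ≤ prodConst M * d * a := by gcongr
  have k4 : prodConst M * ‖Y' t‖ * ‖Y t - Y' t‖ ≤ prodConst M * a * d := by gcongr
  refine (norm_add_le _ _).trans ?_
  have k5 := norm_add_le (conv M f (g - g')) (conv M (g - g') f)
  have k6 := norm_add_le (conv M (g - g') g) (conv M g' (g - g'))
  linarith

end Perturbation

end

section

/-! ### The fixed point argument -/

section FixedPoint

variable {T lam : ℝ} {u X w Y : ℝ → VF} {M : Matrix (Fin 3) (Fin 3) ℝ} {P : VF →L[ℝ] VF} {ω : ℝ → ℝ → ℝ}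
  {w₀ W₀ : VF}

lemma CriticalPath.norm_le (hY : CriticalPath T w Y) {t b : ℝ} (ht : t ∈ Icc 0 T) (hω : ∀ ρ, 0 ≤ ρ → 1 ≤ ω t ρ)
    (hb : 0 ≤ b) (h : CriticalBound ω w t b) : ‖Y t‖ ≤ b := by
  refine (hY.funA t ht).norm_le_of_normA hb (le_trans (normA_mono (fun ρ hρ => ?_) _) h)
  rw [abs_mul]
  exact le_mul_of_one_le_right (abs_nonneg _) ((hω ρ hρ).trans (le_abs_self _))

/-- The function `s ↦ e^{κ s} H(s)`, extended to all times. -/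
def timeExt (hT : 0 ≤ T) (κ : ℝ) (H : C(Icc (0 : ℝ) T, VF)) (s : ℝ) : VF := Real.exp (κ * s) • IccExtend hT H s

lemma continuous_timeExt (hT : 0 ≤ T) (κ : ℝ) (H : C(Icc (0 : ℝ) T, VF)) : Continuous (timeExt hT κ H) := by
  have h : Continuous fun s : ℝ => Real.exp (κ * s) := by fun_prop
  exact h.smul H.continuous.Icc_extend'

lemma timeExt_of_mem (hT : 0 ≤ T) (κ : ℝ) (H : C(Icc (0 : ℝ) T, VF)) {s : ℝ} (hs : s ∈ Icc 0 T) :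
    timeExt hT κ H s = Real.exp (κ * s) • H ⟨s, hs⟩ := by
  rw [timeExt, IccExtend_of_mem hT H hs]

/-- The map whose fixed points are the mild solutions of the perturbation equation. -/
def pertMap (M : Matrix (Fin 3) (Fin 3) ℝ) (P : VF →L[ℝ] VF) (hX : CriticalPath T u X)
    (hW : FunA (fun ρ => ρ ^ (1 / 2 : ℝ)) w₀ W₀) (hT : 0 ≤ T) (κ : ℝ) (H : C(Icc (0 : ℝ) T, VF)) :
    C(Icc (0 : ℝ) T, VF) where
  toFun s := Real.exp (-(κ * s)) • pert M P u (mild w₀ (timeExt hT κ H)) s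
  continuous_toFun := by
    have h1 := (continuousOn_pert (M := M) (P := P) hX
      (criticalPath_mild (continuous_timeExt hT κ H).continuousOn hW)).domRestrict
    have h2 : Continuous fun s : Icc (0 : ℝ) T => Real.exp (-(κ * s)) := by fun_prop
    exact h2.smul h1

/-- The smallness conditions of the fixed point argument. -/
structure PertConst (M : Matrix (Fin 3) (Fin 3) ℝ) (lam T : ℝ) (ω : ℝ → ℝ → ℝ) (u : ℝ → VF) (κ R δ A : ℝ) : Prop where
  rate_nonneg : 0 ≤ κ
  radius_nonneg : 0 ≤ R
  data_nonneg : 0 ≤ δ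
  -- Budget of the fixed point argument: each of the linear term acting on the source, the linear
  -- term acting on the data, and the quadratic term may use a quarter of the radius; for the
  -- contraction, the linear and quadratic terms may use a factor 1/4 each.
  bound : ∀ t ∈ Icc 0 T, ∃ b, 0 ≤ b ∧ CriticalBound ω u t b ∧
    prodConst M * (2 * b) * heatConst lam * kernInt (5 / 8) (κ * t) ≤ 1 / 4 ∧
    prodConst M * (2 * b) * heatConst lam * δ ≤ R / 4
  path_le : heatConst lam * (δ + R * Real.exp (κ * T) * kernInt (5 / 8) 0) ≤ A
  sq_le : prodConst M * A ^ 2 ≤ R / 4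
  mul_le : prodConst M * (2 * A) * heatConst lam * kernInt (5 / 8) 0 ≤ 1 / 4

variable {κ R δ A : ℝ}

lemma PertConst.kernInt_le (hc : PertConst M lam T ω u κ R δ A) {t : ℝ} (ht : t ∈ Icc 0 T) :
    kernInt (5 / 8) (κ * t) ≤ kernInt (5 / 8) 0 :=
  kernInt_anti (by norm_num) le_rfl (mul_nonneg hc.rate_nonneg ht.1)

lemma PertConst.path_le' (hc : PertConst M lam T ω u κ R δ A) {t : ℝ} (ht : t ∈ Icc 0 T) :
    heatConst lam * (δ + R * Real.exp (κ * t) * kernInt (5 / 8) (κ * t)) ≤ A := by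
  refine le_trans ?_ hc.path_le
  have h1 := hc.radius_nonneg
  have h2 := hc.rate_nonneg
  have h3 := (heatConst_pos lam).le
  have h4 := kernInt_nonneg (5 / 8) (κ * t)
  have h5 := hc.kernInt_le ht
  have h6 := ht.2
  gcongr

/-- The closed set of functions on which the fixed point argument takes place. -/
def pertBall (T : ℝ) (ω : ℝ → ℝ → ℝ) (R : ℝ) : Set C(Icc (0 : ℝ) T, VF) :=
  {H | ∀ s : Icc (0 : ℝ) T, normA (ω s) (H s) ≤ ENNReal.ofReal R}

/-- Lower semicontinuity of the weighted norms at each time. Thus completeness is that of C([0,T],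
L²), and no weighted function space is needed. -/
lemma TimeWeight.isClosed_pertBall (hω : TimeWeight lam T ω) : IsClosed (pertBall T ω R) := by
  have : pertBall T ω R = ⋂ s : Icc (0 : ℝ) T, (fun H => H s) ⁻¹' {f | normA (ω s) f ≤ ENNReal.ofReal R} := by
    ext H; simp [pertBall]
  rw [this]
  refine isClosed_iInter fun s => (isClosed_normA_le ?_ (hω.admissible s s.2).measurable _).preimage
    (by fun_prop)
  exact LocBdd.of_continuous (hω.continuous s s.2).continuousOn (hω.admissible s s.2).measurable

lemma normA_timeExt_le (hT : 0 ≤ T) {H : C(Icc (0 : ℝ) T, VF)} (hR : 0 ≤ R) (hH : H ∈ pertBall T ω R) {s : ℝ}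
    (hs : s ∈ Icc 0 T) : normA (ω s) (timeExt hT κ H s) ≤ ENNReal.ofReal (R * Real.exp (κ * s)) := by
  rw [timeExt_of_mem hT κ H hs, normA_smul, Real.enorm_eq_ofReal (Real.exp_pos _).le, mul_comm, ENNReal.ofReal_mul hR]
  gcongr
  exact hH ⟨s, hs⟩

lemma PertConst.criticalBound
    (hc : PertConst M lam T ω u κ R δ A) (hω : TimeWeight lam T ω) (hT : 0 ≤ T)
    (hw : normA (fun ρ => ρ ^ (1 / 2 : ℝ) * ω 0 ρ) w₀ ≤ ENNReal.ofReal δ) {H : C(Icc (0 : ℝ) T, VF)} (hH : H ∈ pertBall T ω R) {t : ℝ} (ht : t ∈ Icc 0 T) :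
    CriticalBound ω (mild w₀ (timeExt hT κ H)) t (heatConst lam * (δ + R * Real.exp (κ * t) * kernInt (5 / 8) (κ * t))) :=
  hω.criticalBound_mild (continuous_timeExt hT κ H).continuousOn hc.radius_nonneg hc.rate_nonneg hc.data_nonneg hw
    (fun _ hs => normA_timeExt_le hT hc.radius_nonneg hH hs) ht

lemma PertConst.mapsTo
    (hc : PertConst M lam T ω u κ R δ A) (hP : IsFiberedProjection P) (hω : TimeWeight lam T ω)
    (hX : CriticalPath T u X) (hW : FunA (fun ρ => ρ ^ (1 / 2 : ℝ)) w₀ W₀) (hT : 0 ≤ T)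
    (hw : normA (fun ρ => ρ ^ (1 / 2 : ℝ) * ω 0 ρ) w₀ ≤ ENNReal.ofReal δ) : MapsTo (pertMap M P hX hW hT κ) (pertBall T ω R) (pertBall T ω R) := by
  intro H hH s
  obtain ⟨t, ht⟩ := s
  have hC := prodConst_nonneg (M := M)
  have hh := (heatConst_pos lam).le
  have hR := hc.radius_nonneg
  have hδ := hc.data_nonneg
  obtain ⟨b, hb0, hb, h1, h2⟩ := hc.bound t ht
  have hL := kernInt_nonneg (5 / 8) (κ * t)
  set L := kernInt (5 / 8) (κ * t)
  set E := Real.exp (κ * t) with hE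
  have hE0 : 0 < E := Real.exp_pos _
  have hE1 : 1 ≤ E := Real.one_le_exp (mul_nonneg hc.rate_nonneg ht.1)
  set a := heatConst lam * (δ + R * E * L) with ha
  have ha0 : 0 ≤ a := by positivity
  have haA : a ≤ A := hc.path_le' ht
  have h3 := normA_pert_le (M := M) hP hX (criticalPath_mild (continuous_timeExt hT κ H).continuousOn hW) ht
    (hω.admissible t ht) ha0 hb0 hb (hc.criticalBound hω hT hw hH ht)
  change normA (ω t) (Real.exp (-(κ * t)) • pert M P u (mild w₀ (timeExt hT κ H)) t) ≤ ENNReal.ofReal R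
  rw [normA_smul, Real.enorm_eq_ofReal (Real.exp_pos _).le, Real.exp_neg, ← hE]
  refine (mul_le_mul_right h3 _).trans ?_
  rw [← ENNReal.ofReal_mul (by positivity)]
  refine ENNReal.ofReal_le_ofReal ?_
  rw [inv_mul_le_iff₀ hE0]
  have k1 : prodConst M * a ^ 2 ≤ R / 4 := le_trans (by gcongr) hc.sq_le
  have k2 : prodConst M * (2 * b) * a = prodConst M * (2 * b) * heatConst lam * δ +
      prodConst M * (2 * b) * heatConst lam * L * (R * E) := by rw [ha]; ring
  have k3 : prodConst M * (2 * b) * heatConst lam * L * (R * E) ≤ 1 / 4 * (R * E) := by gcongr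
  have k4 : R ≤ E * R := le_mul_of_one_le_left hR hE1
  calc prodConst M * (2 * b * a + a ^ 2) = prodConst M * (2 * b) * a + prodConst M * a ^ 2 := by ring
    _ ≤ E * R := by rw [k2]; nlinarith

/-- The difference of two mild paths has zero data and source H - H', so it is estimated with the
trivial weight. The sizes of the paths and of u come from their weighted bounds, which dominate the
unweighted ones as ω ≥ 1. -/
lemma PertConst.dist_le
    (hc : PertConst M lam T ω u κ R δ A) (hP : IsFiberedProjection P) (hω : TimeWeight lam T ω)
    (hlam : 0 ≤ lam) (hω1 : ∀ t ∈ Icc 0 T, ∀ ρ, 0 ≤ ρ → 1 ≤ ω t ρ) (hX : CriticalPath T u X)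
    (hW : FunA (fun ρ => ρ ^ (1 / 2 : ℝ)) w₀ W₀) (hT : 0 ≤ T)
    (hw : normA (fun ρ => ρ ^ (1 / 2 : ℝ) * ω 0 ρ) w₀ ≤ ENNReal.ofReal δ) {H H' : C(Icc (0 : ℝ) T, VF)} (hH : H ∈ pertBall T ω R) (hH' : H' ∈ pertBall T ω R) :
    dist (pertMap M P hX hW hT κ H) (pertMap M P hX hW hT κ H') ≤ 1 / 2 * dist H H' := by
  refine (ContinuousMap.dist_le (by positivity)).2 fun s => ?_
  obtain ⟨t, ht⟩ := s
  have hC := prodConst_nonneg (M := M)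
  have hh := (heatConst_pos lam).le
  obtain ⟨b, hb0, hb, h1, -⟩ := hc.bound t ht
  have hL := kernInt_nonneg (5 / 8) (κ * t)
  have hG := (continuous_timeExt hT κ H).continuousOn (s := Icc 0 T)
  have hG' := (continuous_timeExt hT κ H').continuousOn (s := Icc 0 T)
  have hY := criticalPath_mild hG hW
  have hY' := criticalPath_mild hG' hW
  have ha0 : 0 ≤ heatConst lam * (δ + R * Real.exp (κ * t) * kernInt (5 / 8) (κ * t)) := by
    have hR := hc.radius_nonneg
    have hδ := hc.data_nonneg
    positivity
  have haA := hc.path_le' ht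
  have n1 := (hY.norm_le ht (hω1 t ht) ha0 (hc.criticalBound hω hT hw hH ht)).trans haA
  have n2 := (hY'.norm_le ht (hω1 t ht) ha0 (hc.criticalBound hω hT hw hH' ht)).trans haA
  have n3 := hX.norm_le ht (hω1 t ht) hb0 hb
  have hdiff : ∀ s ∈ Icc 0 T, normA (fun _ => 1) (timeExt hT κ H s - timeExt hT κ H' s) ≤
      ENNReal.ofReal (dist H H' * Real.exp (κ * s)) := by
    intro s hs
    rw [normA_one, ← ofReal_norm, timeExt_of_mem hT κ H hs, timeExt_of_mem hT κ H' hs, ← smul_sub, norm_smul,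
      Real.norm_eq_abs, Real.abs_exp, mul_comm, ← dist_eq_norm]
    exact ENNReal.ofReal_le_ofReal (mul_le_mul_of_nonneg_right (ContinuousMap.dist_apply_le_dist _) (Real.exp_pos _).le)
  have n4 := (TimeWeight.one (T := T) hlam).criticalBound_mild (w₀ := 0) (hG.sub hG') dist_nonneg hc.rate_nonneg le_rfl
    (by rw [(funA_zero _).normA_eq]; simp) hdiff ht
  set L := kernInt (5 / 8) (κ * t)
  set E := Real.exp (κ * t) with hE
  have hE0 : 0 < E := Real.exp_pos _
  set d := dist H H'
  have hd0 : 0 ≤ d := dist_nonneg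
  have n5 := (hY.funA t ht).sub (hY'.funA t ht)
  rw [← smul_sub, mild_sub hG hG' ht] at n5
  simp only [CriticalBound, mul_one] at n4
  have n6 := n5.norm_le_of_normA (by positivity) n4
  rw [zero_add] at n6
  have n7 := norm_pert_sub_le (M := M) hP hX hY hY' ht n3 n1 n2 n6
  change dist (Real.exp (-(κ * t)) • pert M P u (mild w₀ (timeExt hT κ H)) t)
    (Real.exp (-(κ * t)) • pert M P u (mild w₀ (timeExt hT κ H')) t) ≤ 1 / 2 * d
  rw [dist_eq_norm, ← smul_sub, norm_smul, Real.norm_eq_abs, Real.abs_exp, Real.exp_neg, ← hE, inv_mul_le_iff₀ hE0]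
  refine n7.trans ?_
  have hA0 : 0 ≤ A := ha0.trans haA
  have k1 : prodConst M * (2 * A) * heatConst lam * L ≤ 1 / 4 :=
    le_trans (mul_le_mul_of_nonneg_left (hc.kernInt_le ht) (by positivity)) hc.mul_le
  calc prodConst M * (2 * b + 2 * A) * (heatConst lam * (d * E * L)) =
      (prodConst M * (2 * b) * heatConst lam * L + prodConst M * (2 * A) * heatConst lam * L) * (d * E) := by ring
    _ ≤ (1 / 4 + 1 / 4) * (d * E) := by gcongr
    _ = E * (1 / 2 * d) := by ring

/-- Existence of a mild solution of the perturbation equation, with bounds in the weighted norm. -/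
lemma PertConst.exists_mild
    (hc : PertConst M lam T ω u κ R δ A) (hP : IsFiberedProjection P) (hω : TimeWeight lam T ω)
    (hlam : 0 ≤ lam) (hω1 : ∀ t ∈ Icc 0 T, ∀ ρ, 0 ≤ ρ → 1 ≤ ω t ρ) (hX : CriticalPath T u X)
    (hW : FunA (fun ρ => ρ ^ (1 / 2 : ℝ)) w₀ W₀) (hT : 0 ≤ T)
    (hw : normA (fun ρ => ρ ^ (1 / 2 : ℝ) * ω 0 ρ) w₀ ≤ ENNReal.ofReal δ) : ∃ G : ℝ → VF, ContinuousOn G (Icc 0 T) ∧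
    (∀ t ∈ Icc 0 T, G t = pert M P u (mild w₀ G) t) ∧
    ∀ t ∈ Icc 0 T, normA (ω t) (G t) ≤ ENNReal.ofReal (R * Real.exp (κ * t)) := by
  have hmaps := hc.mapsTo (P := P) hP hω hX hW hT hw
  have hcontr : ContractingWith (1 / 2) (hmaps.restrict (pertMap M P hX hW hT κ) _ _) := by
    refine ⟨by norm_num, LipschitzWith.of_dist_le_mul fun H H' => ?_⟩
    have := hc.dist_le (P := P) hP hω hlam hω1 hX hW hT hw H.2 H'.2
    simpa [Subtype.dist_eq, MapsTo.val_restrict_apply] using this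
  obtain ⟨H, hH, hfix, -⟩ := hcontr.exists_fixedPoint' hω.isClosed_pertBall.isComplete hmaps (x := 0)
    (fun s => by rw [ContinuousMap.zero_apply, (funA_zero _).normA_eq]; simp) (edist_ne_top _ _)
  refine ⟨timeExt hT κ H, (continuous_timeExt hT κ H).continuousOn, fun t ht => ?_, fun t ht =>
    normA_timeExt_le hT hc.radius_nonneg hH ht⟩
  have h1 : H ⟨t, ht⟩ = Real.exp (-(κ * t)) • pert M P u (mild w₀ (timeExt hT κ H)) t :=
    (DFunLike.congr_fun hfix ⟨t, ht⟩).symm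
  rw [timeExt_of_mem hT κ H ht, h1, smul_smul, ← Real.exp_add, add_neg_cancel, Real.exp_zero, one_smul]

end FixedPoint

end

section

/-! ### The perturbed solution -/

section Perturbed

variable {T lam : ℝ} {u X w Y : ℝ → VF} {M : Matrix (Fin 3) (Fin 3) ℝ} {P : VF →L[ℝ] VF} {ω : ℝ → ℝ → ℝ}
  {G : ℝ → VF} {w₀ W₀ : VF}

/-- Used with β = 1/4 for the A^{1/2} bound and with β = 0 for the L² bound. The restriction β ≤ 1/4
keeps the power of t nonnegative. -/
lemma TimeWeight.normA_mild_le (hω : TimeWeight lam T ω) {β : ℝ} (hβ : 0 ≤ β) (hβ' : β ≤ 1 / 4)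
    (hG : ContinuousOn G (Icc 0 T)) {R κ δ t : ℝ} (hR : 0 ≤ R)
    (hκ : 0 ≤ κ) (hδ : 0 ≤ δ) (hw : normA (fun ρ => ρ ^ (2 * β) * ω 0 ρ) w₀ ≤ ENNReal.ofReal δ)
    (hb : ∀ s ∈ Icc 0 T, normA (ω s) (G s) ≤ ENNReal.ofReal (R * Real.exp (κ * s))) (ht : t ∈ Ioc 0 T) :
    normA (fun ρ => ρ ^ (2 * β) * ω t ρ) (mild w₀ G t) ≤
      ENNReal.ofReal (heatConst lam * (δ + T ^ (1 / 4 - β) * (R * Real.exp (κ * T)) * kernInt β 0)) := by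
  have hc := (heatConst_pos lam).le
  have ht' : t ∈ Icc 0 T := ⟨ht.1.le, ht.2⟩
  have hm : Measurable fun ρ => ρ ^ (2 * β) * ω t ρ := (measurable_rpow_const _).mul (hω.admissible t ht').measurable
  have h1 := hω.normA_heat_le (α := 2 * β) (β := 0) (by linarith) le_rfl zero_le_one ht w₀
  rw [mul_zero, zero_add, Real.rpow_zero, one_smul] at h1
  have h2 := hω.normA_duh_le hβ (by linarith) hG hR hκ ht hb
  have hT : 0 ≤ T := ht.1.le.trans ht.2
  have h3 := kernInt_nonneg β 0
  rw [mild, mul_add, ENNReal.ofReal_add (by positivity) (by positivity), ENNReal.ofReal_mul hc]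
  refine (normA_sub_le hm _ _).trans (add_le_add (h1.trans (by gcongr)) (h2.trans (ENNReal.ofReal_le_ofReal ?_)))
  have h4 := kernInt_anti (β := β) (by linarith) le_rfl (mul_nonneg hκ ht.1.le)
  have h5 := kernInt_nonneg β (κ * t)
  have h6 : t ^ (1 / 4 - β) ≤ T ^ (1 / 4 - β) := Real.rpow_le_rpow ht.1.le ht.2 (by linarith)
  have h7 : Real.exp (κ * t) ≤ Real.exp (κ * T) := by have := ht.2; gcongr
  calc t ^ (1 / 4 - β) * (heatConst lam * (R * Real.exp (κ * t)) * kernInt β (κ * t)) ≤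
      T ^ (1 / 4 - β) * (heatConst lam * (R * Real.exp (κ * T)) * kernInt β 0) := by
        have := Real.rpow_nonneg ht.1.le (1 / 4 - β)
        gcongr
    _ = _ := by ring

lemma CriticalPath.add (hX : CriticalPath T u X) (hY : CriticalPath T w Y) :
    CriticalPath T (fun t => u t + w t) (fun t => X t + Y t) :=
  ⟨fun t ht => by simpa only [smul_add] using (hX.funA t ht).add (hY.funA t ht), hX.continuousOn.add hY.continuousOn,
    by rw [hX.zero, hY.zero, add_zero]⟩

lemma symInhom_half_le {ρ : ℝ} (hρ : 0 ≤ ρ) : symInhom (1 / 2) 0 ρ ≤ 1 + ρ ^ (1 / 2 : ℝ) := by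
  rw [symInhom, zero_mul, Real.exp_zero, mul_one]
  have h := Real.rpow_add_le_add_rpow (zero_le_one (α := ℝ)) (sq_nonneg ρ) (p := 1 / 2 / 2) (by norm_num) (by norm_num)
  refine h.trans (le_of_eq ?_)
  rw [Real.one_rpow, ← Real.rpow_two, ← Real.rpow_mul hρ]
  norm_num

/-- Since ⟨ρ⟩^{1/2} ≤ 1 + ρ^{1/2}, continuity of Duhamel's integral in L² and of its A^{1/2}
derivative together give continuity in H^{1/2}; the heat flow commutes with ⟨A⟩^{1/2}. -/
lemma continuousOnA_mild (hG : ContinuousOn G (Icc 0 T)) (hw : w₀ ∈ sobolev (1 / 2)) :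
    ContinuousOnA (fun _ => symInhom (1 / 2) 0) (mild w₀ G) (Icc 0 T) := by
  have hsm : Measurable (symInhom (1 / 2) 0) := by unfold symInhom; fun_prop
  obtain ⟨W, hW⟩ := exists_funA hsm hw
  have hpos : ∀ ρ : ℝ, 0 ≤ ρ → 0 < 1 + ρ ^ (1 / 2 : ℝ) := fun ρ hρ => by positivity
  have hb : BddSymbol fun ρ => symInhom (1 / 2) 0 ρ / (1 + ρ ^ (1 / 2 : ℝ)) := by
    refine ⟨hsm.div (by fun_prop), 1, fun ρ hρ => ?_⟩
    have h0 : 0 ≤ symInhom (1 / 2) 0 ρ := by unfold symInhom; positivity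
    rw [abs_of_nonneg (div_nonneg h0 (hpos ρ hρ).le), div_le_one (hpos ρ hρ)]
    exact symInhom_half_le hρ
  obtain ⟨D, hD, hDf⟩ := continuousOn_half_duh hG
  refine ⟨fun t => mulA (heat t) W - mulA (fun ρ => symInhom (1 / 2) 0 ρ / (1 + ρ ^ (1 / 2 : ℝ))) (duh G t + D t), ?_, fun t ht => ?_⟩
  · refine ContinuousOn.sub (continuousOn_mulA (m := heat) (C := 1) (fun _ _ => measurable_heat _)
      (fun t ht ρ _ => abs_heat_le_one ht.1 ρ) (fun ρ _ => ?_) continuousOn_const)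
      ((mulA _).continuous.comp_continuousOn ((continuousOn_duh hG).add hD))
    unfold heat; fun_prop
  · have h1 := (bddSymbol_heat ht.1).funA w₀
    have h2 := hW.comp ((bddSymbol_heat ht.1).funA W)
    refine (h1.cancel (h2.congr fun ρ _ => mul_comm _ _)).sub ?_
    refine (((funA_one _).add_symbol (hDf t ht)).comp (hb.funA _)).congr fun ρ hρ => ?_
    rw [div_mul_cancel₀ _ (hpos ρ hρ).ne']

lemma ContinuousOnA.add {m : ℝ → ℝ → ℝ} {J : Set ℝ} (h : ContinuousOnA m u J) (h' : ContinuousOnA m w J) :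
    ContinuousOnA m (fun t => u t + w t) J := by
  obtain ⟨U, hU, hf⟩ := h
  obtain ⟨U', hU', hf'⟩ := h'
  exact ⟨_, hU.add hU', fun t ht => (hf t ht).add (hf' t ht)⟩

lemma ContinuousOnA.mem_sobolev {r : ℝ} {J : Set ℝ} (h : ContinuousOnA (fun _ => symInhom r 0) u J) {t : ℝ} (ht : t ∈ J) :
    u t ∈ sobolev r := by
  obtain ⟨U, -, hf⟩ := h
  change normA _ _ < ∞
  rw [(hf t ht).normA_eq]
  exact enorm_lt_top

lemma IsFiberedProjection.map_eq (hP : IsFiberedProjection P) {s : Set VF} {f : VF} (hf : f ∈ P '' s) : P f = f := by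
  obtain ⟨g, -, rfl⟩ := hf
  exact hP.proj_proj g

lemma IsFiberedProjection.mem_sobolev (hP : IsFiberedProjection P) {r : ℝ} {f : VF} (hf : f ∈ P '' sobolev r) :
    f ∈ sobolev r := by
  obtain ⟨g, hg, rfl⟩ := hf
  exact (hP.normA_le (by unfold symInhom; fun_prop) g).trans_lt hg

lemma IsStrongSolution.hasDerivWithinAt (hu : IsStrongSolution M P (1 / 2) T u) (hX : CriticalPath T u X) (φ : 𝓢(R3, R3))
    {t : ℝ} (ht : t ∈ Ioc 0 T) :
    HasDerivWithinAt (fun s => inner ℝ (u s) (φ.toLp 2 : VF))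
      (inner ℝ (u t) ((Δ φ).toLp 2 : VF) - inner ℝ (P (conv M (u t) (u t))) (φ.toLp 2 : VF)) (Ioc 0 T) t := by
  obtain ⟨N, hN, heq⟩ := hu.equation
  have h1 := (heq φ).2 t ht
  rw [(hN t ht).unique (conv_isConvection (hX.inDom ht))] at h1
  simpa only [inner_toLp] using h1

/-- The nonlinearity of the sum of a solution and a perturbation. -/
lemma conv_add_self (hX : CriticalPath T u X) (hY : CriticalPath T w Y) {t : ℝ} (ht : t ∈ Ioc 0 T) :
    P (conv M (u t + w t) (u t + w t)) = P (conv M (u t) (u t)) + t ^ (-(3 / 4) : ℝ) • pert M P u w t := by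
  have hf := hX.inDom ht
  have hg := hY.inDom ht
  have e : t ^ (-(3 / 4) : ℝ) * (t ^ (3 / 8 : ℝ) * t ^ (3 / 8 : ℝ)) = 1 := by
    rw [← Real.rpow_add ht.1, ← Real.rpow_add ht.1]; norm_num
  rw [pert, conv_smul hf hg, conv_smul hg hf, conv_smul hg hg, ← smul_add, ← smul_add, map_smul, smul_smul, e, one_smul,
    ← map_add, conv_add_left hf hg (hf.add hg), conv_add_right hf hf hg, conv_add_right hg hf hg]
  congr 1
  abel

lemma isStrongSolution_add_mild (hP : IsFiberedProjection P) (hT : 0 < T) (hu : IsStrongSolution M P (1 / 2) T u)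
    (hX : CriticalPath T u X) (hG : ContinuousOn G (Icc 0 T)) (hGeq : ∀ t ∈ Icc 0 T, G t = pert M P u (mild w₀ G) t)
    (hw : w₀ ∈ sobolev (1 / 2)) (hPw : P w₀ = w₀) (hY : CriticalPath T (mild w₀ G) Y) :
    IsStrongSolution M P (1 / 2) T fun t => u t + mild w₀ G t := by
  have hcont := hu.continuousOn.add (continuousOnA_mild hG hw)
  have hV := hX.add hY
  refine ⟨hcont, fun t ht => ⟨_, hcont.mem_sobolev ht, ?_⟩, hV.memB0 hT,
    fun t => conv M (u t + mild w₀ G t) (u t + mild w₀ G t), fun t ht => conv_isConvection (hV.inDom ht), fun φ => ⟨?_, fun t ht => ?_⟩⟩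
  · have h1 : P (duh G t) = duh G t := hP.duh hG ht fun s hs => by rw [hGeq s hs, pert, hP.proj_proj]
    have h2 : P (mulA (heat t) w₀) = mulA (heat t) w₀ := by rw [hP.mulA_comm (bddSymbol_heat ht.1), hPw]
    rw [map_add, hP.map_eq (hu.mem_range t ht), mild, map_sub, h1, h2]
  · simp only [← inner_toLp]
    have h1 : ContinuousOn (fun t => u t + mild w₀ G t) (Ioc 0 T) :=
      (continuousOn_of_sobolev (by norm_num) hcont).mono Ioc_subset_Icc_self
    exact (h1.inner continuousOn_const).sub ((hV.continuousOn_conv (M := M) (P := P)).inner continuousOn_const)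
  · simp only [← inner_toLp]
    have h1 := (hu.hasDerivWithinAt hX φ ht).add
      (hasDerivWithinAt_mild (w₀ := w₀) (w := mild w₀ G) rfl rfl hG φ ht)
    rw [conv_add_self hX hY ht, ← hGeq t ⟨ht.1.le, ht.2⟩]
    refine (h1.congr_deriv ?_).congr_of_eventuallyEq ?_ ?_
    · rw [inner_add_left, inner_add_left]; ring
    · exact Eventually.of_forall fun s => inner_add_left _ _ _
    · exact inner_add_left _ _ _

/-- Conditions under which the smallness conditions of the fixed point argument are satisfied. -/
lemma exists_pertConst
    (h : ∀ ε, 0 < ε → ∃ τ, 0 < τ ∧ ∀ a, 0 < a → WindowBound T ω u a τ ε) :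
    ∃ κ K A δ₀, 0 ≤ κ ∧ 0 < K ∧ 0 < A ∧ 0 < δ₀ ∧ ∀ δ, 0 ≤ δ → δ ≤ δ₀ → PertConst M lam T ω u κ (K * δ) δ (A * δ) := by
  obtain ⟨⟨B, hB1, hB⟩, hsmall⟩ := exists_criticalBound h
  set C := prodConst M
  have hC : 0 ≤ C := prodConst_nonneg
  set H := heatConst lam
  have hH : 0 < H := heatConst_pos lam
  set L := kernInt (5 / 8) 0
  have hL : 0 ≤ L := kernInt_nonneg _ _
  -- This c turns the feedback of the linear term, 2CHb times the kernel, into at most 1/4.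
  obtain ⟨κ, hκ, hb⟩ := exists_rate hB1 hB hsmall (c := 1 / (8 * C * H + 1)) (by positivity)
  have hB0 : 0 < B := by linarith
  -- Chosen so that the linear term applied to the data, at most 2CBHδ, is below a quarter of the
  -- radius Kδ.
  obtain ⟨K, hK⟩ : ∃ K, K = 8 * C * B * H + 1 := ⟨_, rfl⟩
  have hK0 : 0 < K := by rw [hK]; positivity
  have hK1 : 1 ≤ K := by rw [hK]; linarith [show 0 ≤ 8 * C * B * H by positivity]
  obtain ⟨A, hA⟩ : ∃ A, A = H * (1 + K * Real.exp (κ * T) * L) := ⟨_, rfl⟩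
  have hA0 : 0 < A := by rw [hA]; positivity
  -- The two terms of the denominator serve the two quadratic conditions. The rate κ is fixed before
  -- δ, and radius and path bound are multiples of δ.
  refine ⟨κ, K, A, 1 / (4 * C * A ^ 2 + 8 * C * A * H * L + 1), hκ, hK0, hA0, by positivity, fun δ hδ hδ₀ => ?_⟩
  rw [le_div_iff₀ (by positivity)] at hδ₀
  have e1 : 0 ≤ 4 * C * A ^ 2 * δ := by positivity
  have e2 : 0 ≤ 8 * C * A * H * L * δ := by positivity
  refine ⟨hκ, by positivity, hδ, fun t ht => ?_, ?_, ?_, ?_⟩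
  · obtain ⟨b, hb0, hbB, hbu, hbk⟩ := hb t ht
    refine ⟨b, hb0, hbu, ?_, ?_⟩
    · rw [le_div_iff₀ (by positivity)] at hbk
      nlinarith [mul_nonneg hb0 (kernInt_nonneg (5 / 8) (κ * t))]
    · have : C * (2 * b) * H * δ ≤ C * (2 * B) * H * δ := by gcongr
      refine this.trans ?_
      rw [hK]
      nlinarith
  · rw [hA]; apply le_of_eq; ring
  · have : 4 * C * A ^ 2 * δ * δ ≤ 1 * δ := by gcongr; linarith
    nlinarith
  · nlinarith

/-- Local Lipschitz stability of strong solutions in analytic norms. -/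
theorem exists_perturbed {θ : ℝ → ℝ} (hP : IsFiberedProjection P) (hT : 0 < T) (hθ : Radius lam T θ)
    (hu : IsStrongSolution M P (1 / 2) T u) (hreg : ContinuousOnA (fun t => symHom (1 / 2) (θ t)) u (Icc 0 T)) :
    ∃ δ₀ : ℝ, 0 < δ₀ ∧ ∃ K₁ K₂ K₃ : ℝ, 0 < K₁ ∧ 0 < K₂ ∧ 0 < K₃ ∧
      ∀ δ : ℝ, 0 ≤ δ → δ ≤ δ₀ → ∀ v₀ ∈ P '' sobolev (1 / 2),
        normA (symHom (1 / 2) (θ 0)) (v₀ - u 0) ≤ ENNReal.ofReal δ →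
        ∃ v : ℝ → VF, IsStrongSolution M P (1 / 2) T v ∧ v 0 = v₀ ∧
          (∀ t ∈ Ioc 0 T, normA (symHom (1 / 2) (θ t)) (v t - u t) ≤ ENNReal.ofReal (K₁ * δ)) ∧
          (∀ t ∈ Ioc 0 T, ENNReal.ofReal (t ^ (3 / 8 : ℝ)) * normA (symHom (5 / 4) (θ t)) (v t - u t)
              ≤ ENNReal.ofReal (K₂ * δ)) ∧
          (normA (symInhom (1 / 2) (θ 0)) (v₀ - u 0) ≤ ENNReal.ofReal δ →
            ∀ t ∈ Ioc 0 T, normA (symHom 0 (θ t)) (v t - u t) ≤ ENNReal.ofReal (K₃ * δ)) := by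
  obtain ⟨X, hX⟩ := hu.memB0.exists_criticalPath
  have hω := hθ.expWeight
  have hω1 : ∀ t ∈ Icc 0 T, ∀ ρ, 0 ≤ ρ → 1 ≤ expWeight θ t ρ := fun t ht ρ hρ =>
    Real.one_le_exp (mul_nonneg (hθ.nonneg t ht) hρ)
  have h0 : (0 : ℝ) ∈ Icc 0 T := ⟨le_rfl, hT.le⟩
  obtain ⟨κ, K, A, δ₀, hκ, hK, hA, hδ₀, hconst⟩ := exists_pertConst (M := M) (lam := lam)
    fun ε hε => hu.exists_windowBound hP hθ hT hX hreg hε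
  have hH := heatConst_pos lam
  have hL : ∀ β, 0 ≤ kernInt β 0 := fun β => kernInt_nonneg _ _
  have hK' : ∀ β : ℝ, 0 < heatConst lam * (1 + T ^ (1 / 4 - β) * (K * Real.exp (κ * T)) * kernInt β 0) := fun β => by
    have := hL β; positivity
  refine ⟨δ₀, hδ₀, _, A, _, hK' (1 / 4), hA, hK' 0, fun δ hδ hδδ₀ v₀ hv₀ hv => ?_⟩
  have hc := hconst δ hδ hδδ₀
  have hw : normA (fun ρ => ρ ^ (1 / 2 : ℝ) * expWeight θ 0 ρ) (v₀ - u 0) ≤ ENNReal.ofReal δ := hv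
  obtain ⟨W₀, hW⟩ := exists_funA (measurable_rpow_const (1 / 2)) (f := v₀ - u 0) (by
    refine (normA_mono (fun ρ hρ => ?_) _).trans_lt (hw.trans_lt ENNReal.ofReal_lt_top)
    rw [abs_mul]
    exact le_mul_of_one_le_right (abs_nonneg _) ((hω1 0 h0 ρ hρ).trans (le_abs_self _)))
  obtain ⟨G, hG, hGeq, hGb⟩ := hc.exists_mild hP hω hθ.lam_nonneg hω1 hX hW hT.le hw
  have hR : 0 ≤ K * δ := hc.radius_nonneg
  have hsob : v₀ - u 0 ∈ sobolev (1 / 2) :=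
    (normA_sub_le (by unfold symInhom; fun_prop) _ _).trans_lt
      (ENNReal.add_lt_top.2 ⟨hP.mem_sobolev hv₀, hP.mem_sobolev (hu.mem_range 0 h0)⟩)
  refine ⟨fun t => u t + mild (v₀ - u 0) G t, isStrongSolution_add_mild hP hT hu hX hG hGeq hsob ?_
    (criticalPath_mild hG hW), ?_, fun t ht => ?_, fun t ht => ?_, fun hv' t ht => ?_⟩
  · rw [map_sub, hP.map_eq hv₀, hP.map_eq (hu.mem_range 0 h0)]
  · simp only [mild_zero, add_sub_cancel]
  · have h1 := hω.normA_mild_le (β := 1 / 4) (by norm_num) le_rfl hG hR hκ hδ (w₀ := v₀ - u 0)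
      (by norm_num at hw ⊢; exact hw) hGb ht
    rw [add_sub_cancel_left]
    have e : (2 * (1 / 4) : ℝ) = 1 / 2 := by norm_num
    rw [e] at h1
    refine h1.trans (ENNReal.ofReal_le_ofReal (le_of_eq ?_))
    ring
  · rw [add_sub_cancel_left]
    have ht' : t ∈ Icc 0 T := ⟨ht.1.le, ht.2⟩
    have h1 : CriticalBound (expWeight θ) (mild (v₀ - u 0) G) t (A * δ) :=
      (hω.criticalBound_mild hG hR hκ hδ hw hGb ht').mono (hc.path_le' ht')
    rwa [CriticalBound, normA_smul, Real.enorm_eq_ofReal (Real.rpow_nonneg ht.1.le _)] at h1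
  -- The same solution and the same bound on G serve here; only the data enter through a stronger
  -- norm, which dominates the weighted L² norm because ⟨ρ⟩ ≥ 1.
  · have h1 := hω.normA_mild_le (β := 0) le_rfl (by norm_num) hG hR hκ hδ (w₀ := v₀ - u 0) (by
      refine (normA_mono (fun ρ hρ => ?_) _).trans hv'
      rw [mul_zero, Real.rpow_zero, one_mul, symInhom, abs_mul]
      refine le_mul_of_one_le_left (abs_nonneg _) ((Real.one_le_rpow ?_ (by norm_num)).trans (le_abs_self _))
      nlinarith [sq_nonneg ρ]) hGb ht
    rw [add_sub_cancel_left]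
    rw [mul_zero] at h1
    refine h1.trans (ENNReal.ofReal_le_ofReal (le_of_eq ?_))
    ring

end Perturbed

end

end NavierStokes

end

theorem mainTheorem8
    (M : Matrix (Fin 3) (Fin 3) ℝ)
    (P : NavierStokes.VF →L[ℝ] NavierStokes.VF) (hP : NavierStokes.IsFiberedProjection P)
    (T : ℝ) (hT : 0 < T)
    (θ : ℝ → ℝ) (hθ_cont : ContinuousOn θ (Icc 0 T)) (hθ_nonneg : ∀ t ∈ Icc 0 T, 0 ≤ θ t)
    (lam : ℝ) (hlam : 0 ≤ lam)
    (hθ : ∀ s t : ℝ, s ∈ Icc 0 T → t ∈ Icc 0 T → s + t ∈ Icc 0 T →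
      θ (s + t) ≤ lam * Real.sqrt s + θ t)
    (u : ℝ → NavierStokes.VF) (hu : NavierStokes.IsStrongSolution M P (1 / 2) T u)
    (hu_reg : NavierStokes.ContinuousOnA
      (fun t => NavierStokes.symHom (1 / 2) (θ t)) u (Icc 0 T)) :
    ∃ δ₀ : ℝ, 0 < δ₀ ∧ ∃ K₁ K₂ K₃ : ℝ, 0 < K₁ ∧ 0 < K₂ ∧ 0 < K₃ ∧
      ∀ δ : ℝ, 0 ≤ δ → δ ≤ δ₀ → ∀ v₀ ∈ P '' NavierStokes.sobolev (1 / 2),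
        NavierStokes.normA (NavierStokes.symHom (1 / 2) (θ 0)) (v₀ - u 0) ≤ ENNReal.ofReal δ →
        ∃ v : ℝ → NavierStokes.VF,
          NavierStokes.IsStrongSolution M P (1 / 2) T v ∧ v 0 = v₀ ∧
          (∀ t ∈ Ioc 0 T,
            NavierStokes.normA (NavierStokes.symHom (1 / 2) (θ t)) (v t - u t)
              ≤ ENNReal.ofReal (K₁ * δ)) ∧
          (∀ t ∈ Ioc 0 T,
            ENNReal.ofReal (t ^ (3 / 8 : ℝ)) *
              NavierStokes.normA (NavierStokes.symHom (5 / 4) (θ t)) (v t - u t)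
              ≤ ENNReal.ofReal (K₂ * δ)) ∧
          (NavierStokes.normA (NavierStokes.symInhom (1 / 2) (θ 0)) (v₀ - u 0)
              ≤ ENNReal.ofReal δ →
            ∀ t ∈ Ioc 0 T,
              NavierStokes.normA (NavierStokes.symHom 0 (θ t)) (v t - u t)
                ≤ ENNReal.ofReal (K₃ * δ)) :=
  NavierStokes.exists_perturbed hP hT ⟨hθ_nonneg, hlam, hθ⟩ hu hu_reg
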